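/- Let $n\ge2$, $p\ge2$ and $k_+,k_-\ge0$ be real constants ($n$ an integer). Write $x=(x',x_n)$ for the points of $\mathbb R^n$, $B_r=\{|x|<r\}$, $B_r^+=B_r\cap\{x_n>0\}$, $(\partial B_r)^+=\partial B_r\cap\{x_n>0\}$, $\Gamma_r=B_r\cap\{x_n=0\}$, $\Gamma=\Gamma_1$, $t^+=\max\{t,0\}$, $t^-=-\min\{t,0\}$. Let $u$ be a weak solution of $$\Delta u=0\ \text{ in }B_1^+,\qquad u=g\ \text{ on }(\partial B_1)^+,\qquad \frac{\partial u}{\partial x_n}=k_+(u^+)^{p-1}-k_-(u^-)^{p-1}\ \text{ on }\Gamma,$$ that is: $u\in W^{1,2}(B_1^+)$ has trace $g$ on $(\partial B_1)^+$ and a trace in $L^p(\Gamma)$ on $\Gamma$, and $$\int_{B_1^+}\nabla u\cdot\nabla\xi\,dx=-\int_\Gamma\bigl(k_+(u^+)^{p-1}-k_-(u^-)^{p-1}\bigr)\,\xi\,dx'$$ for every $\xi\in C^\infty(\overline{B_1^+})$ vanishing on $(\partial B_1)^+$. Let $F(u)=k_-(u^-)^p+k_+(u^+)^p$. Then the perturbed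 Almgren frequency $$\tilde N(r)=r\,\frac{\int_{B_r^+}|\nabla u|^2\,dx+\frac2p\int_{\Gamma_r}F(u)\,dx'}{\int_{(\partial B_r)^+}u^2\,d\sigma},$$ where the values of $u$ on $\Gamma_r$ and $(\partial B_r)^+$ are taken in the sense of traces, is well defined and monotone nondecreasing in $r\in(0,1)$: if $u\not\equiv0$, the denominator is positive for every $r\in(0,1)$ and $\tilde N(r)\le\tilde N(s)$ for $0<r\le s<1$ (if $u\equiv0$, we set $\tilde N\equiv0$). -/

import Mathlib

open MeasureTheory Set Filter Topology
open scoped Gradient ContDiff ENNReal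

noncomputable section

namespace PenalizedObstacle

/-- The Euclidean space `ℝⁿ` with `n = d + 1`. A point is written `x = (x', x_n)`, where `x_n` is
the coordinate with the last index `Fin.last d`. -/
abbrev Space (d : ℕ) : Type := EuclideanSpace ℝ (Fin (d + 1))

/-- The open upper half ball `B_r⁺ = {x | |x| < r, x_n > 0}`. -/
def halfBall (d : ℕ) (r : ℝ) : Set (Space d) :=
  {x | ‖x‖ < r ∧ 0 < x (Fin.last d)}

/-- The embedding `x' ↦ (x', 0)` of `ℝ^{n-1}` into `ℝⁿ`. -/
def flat (d : ℕ) (y : EuclideanSpace ℝ (Fin d)) : Space d :=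
  WithLp.toLp 2 (Fin.snoc (α := fun _ => ℝ) (fun i => y i) 0)

/-- The measure `dx'` on the flat ball `Γ_r = {x | |x| < r, x_n = 0}`: the `(n-1)`-dimensional
Lebesgue measure, seen as a measure on `ℝⁿ`. -/
def flatMeasure (d : ℕ) (r : ℝ) : Measure (Space d) :=
  ((volume : Measure (EuclideanSpace ℝ (Fin d))).restrict (Metric.ball 0 r)).map (flat d)

/-- The surface measure `dσ` on the spherical cap `(∂B_r)⁺ = {x | |x| = r, x_n > 0}`, seen as a
measure on `ℝⁿ`: the surface measure of the unit sphere is transported by `z ↦ r z`, multiplied by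
`r^{n-1}`, and restricted to the upper half space. -/
def capMeasure (d : ℕ) (r : ℝ) : Measure (Space d) :=
  (ENNReal.ofReal (r ^ d) •
    ((volume : Measure (Space d)).toSphere.map
      (fun z : Metric.sphere (0 : Space d) 1 => r • (z : Space d)))).restrict
    {x | 0 < x (Fin.last d)}

/-- `G` is a weak (distributional) gradient of `u` in the open set `U`. -/
def IsWeakGradient {d : ℕ} (U : Set (Space d)) (u : Space d → ℝ) (G : Space d → Space d) : Prop :=
  LocallyIntegrableOn u U ∧ LocallyIntegrableOn G U ∧
    ∀ φ : Space d → ℝ, ContDiff ℝ ∞ φ → HasCompactSupport φ → tsupport φ ⊆ U →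
      ∫ x in U, u x • ∇ φ x = -∫ x in U, φ x • G x

open Classical in
/-- The weak gradient of `u` in the open set `U` (unique almost everywhere in `U`). -/
def weakGradient {d : ℕ} (U : Set (Space d)) (u : Space d → ℝ) : Space d → Space d :=
  if h : ∃ G, IsWeakGradient U u G then h.choose else 0

/-- `u` belongs to the Sobolev space `W^{1,2}(U)`. -/
def MemW12 {d : ℕ} (U : Set (Space d)) (u : Space d → ℝ) : Prop :=
  MemLp u 2 (volume.restrict U) ∧
    ∃ G, IsWeakGradient U u G ∧ MemLp G 2 (volume.restrict U)

/-- `τ ∈ L²(μ)` is the trace of `u ∈ W^{1,2}(U)` on the piece of the boundary of `U` with surface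
measure `μ`: there are functions, smooth up to the boundary of `U`, that converge to `u` in
`W^{1,2}(U)` and to `τ` in `L²(μ)`. -/
def IsTrace {d : ℕ} (U : Set (Space d)) (μ : Measure (Space d)) (u τ : Space d → ℝ) : Prop :=
  MemLp τ 2 μ ∧ ∃ φ : ℕ → Space d → ℝ, (∀ k, ContDiff ℝ ∞ (φ k)) ∧
    Tendsto (fun k => eLpNorm (fun x => φ k x - u x) 2 (volume.restrict U)) atTop (𝓝 0) ∧
    Tendsto (fun k => eLpNorm (fun x => ∇ (φ k) x - weakGradient U u x) 2 (volume.restrict U))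
      atTop (𝓝 0) ∧
    Tendsto (fun k => eLpNorm (fun x => φ k x - τ x) 2 μ) atTop (𝓝 0)

open Classical in
/-- The trace of `u ∈ W^{1,2}(U)` on the piece of the boundary with surface measure `μ` (unique
`μ`-almost everywhere). -/
def trace {d : ℕ} (U : Set (Space d)) (μ : Measure (Space d)) (u : Space d → ℝ) : Space d → ℝ :=
  if h : ∃ τ, IsTrace U μ u τ then h.choose else 0

/-- `u` is a weak solution of `Δu = 0` in `B_1⁺`, `u = g` on `(∂B_1)⁺`,
`∂u/∂x_n = k₊ (u⁺)^{p-1} - k₋ (u⁻)^{p-1}` on `Γ`. -/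
structure IsWeakSolution (d : ℕ) (p kp km : ℝ) (g u : Space d → ℝ) : Prop where
  /-- `u ∈ W^{1,2}(B_1⁺)` -/
  memW12 : MemW12 (halfBall d 1) u
  /-- the trace of `u` on `Γ` is in `L^p(Γ)` -/
  trace_flat : IsTrace (halfBall d 1) (flatMeasure d 1) u
      (trace (halfBall d 1) (flatMeasure d 1) u) ∧
    MemLp (trace (halfBall d 1) (flatMeasure d 1) u) (ENNReal.ofReal p) (flatMeasure d 1)
  /-- `u = g` on `(∂B_1)⁺` -/
  trace_cap : IsTrace (halfBall d 1) (capMeasure d 1) u g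
  /-- the weak form of the equation and of the condition on `Γ` -/
  weak_eq : ∀ ξ : Space d → ℝ, ContDiff ℝ ∞ ξ →
    (∀ x, ‖x‖ = 1 → 0 < x (Fin.last d) → ξ x = 0) →
    ∫ x in halfBall d 1, inner ℝ (weakGradient (halfBall d 1) u x) (∇ ξ x) =
      -∫ x, (kp * (max (trace (halfBall d 1) (flatMeasure d 1) u x) 0) ^ (p - 1)
          - km * (max (-trace (halfBall d 1) (flatMeasure d 1) u x) 0) ^ (p - 1)) * ξ x
        ∂(flatMeasure d 1)

/-- `F(t) = k₋ (t⁻)^p + k₊ (t⁺)^p`. -/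
def penalty (p kp km t : ℝ) : ℝ :=
  km * (max (-t) 0) ^ p + kp * (max t 0) ^ p

/-- `H(r) = ∫_{(∂B_r)⁺} u² dσ`. -/
def height (d : ℕ) (u : Space d → ℝ) (r : ℝ) : ℝ :=
  ∫ x, (trace (halfBall d r) (capMeasure d r) u x) ^ 2 ∂(capMeasure d r)

/-- `∫_{B_r⁺} |∇u|² dx + (2/p) ∫_{Γ_r} F(u) dx'`. -/
def perturbedEnergy (d : ℕ) (p kp km : ℝ) (u : Space d → ℝ) (r : ℝ) : ℝ :=
  (∫ x in halfBall d r, ‖weakGradient (halfBall d 1) u x‖ ^ 2) +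
    2 / p * ∫ x, penalty p kp km (trace (halfBall d 1) (flatMeasure d 1) u x) ∂(flatMeasure d r)

/-- The perturbed Almgren frequency functional. -/
def perturbedFrequency (d : ℕ) (p kp km : ℝ) (u : Space d → ℝ) (r : ℝ) : ℝ :=
  r * (perturbedEnergy d p kp km u r / height d u r)

end PenalizedObstacle

end

namespace PenalizedObstacle

/-! ### The penalty and its derivative -/

/-! Write `A(r)` for the Dirichlet integral over the half ball, `b(r)` for the integral of `F(u)`
over the flat ball, `H(r)` for the height and `D = A + (2/p) b`, with `n = d + 1`. Formally, three
facts suffice. Testing the equation with `u` gives `H' = (d/r) H + 2 (A + b)`, because `u` times the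
flux is `F(u)`. A Rellich inequality gives `r D' ≥ (d-1) D + (2/p) b + 2 r ∫ u_ν²` over the cap.
Cauchy-Schwarz gives `(A + b)² ≤ H ∫ u_ν²`. Together, `N'/N ≥ 2 (A + b) (1 - 2/p) b / (D H) + (2/p)
b / (r D)`, which is nonnegative since `p ≥ 2`.

No regularity of `u` beyond the weak formulation is used. The Rellich inequality comes from an inner
variation: `p` times the flux is the derivative of the convex function `F`, so testing with `η u`
and `η u(c ·)` shows that `u` has no more localized energy than its dilate, up to a term linear in
`u(c ·) - u` (`Solution.dilation_comparison`). Changing variables moves the dilation onto the smooth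
cutoff `η`, and differentiating at `c = 1` gives `Solution.rellich`. Such test functions are
admissible by `Solution.test`.

Nor are `A` and `b` differentiated. Radial cutoffs converging to indicators of shells put every
identity in terms of increments of integrals over balls, with `U = ∫ u²`, `W = ∫ u ⟨∇u, x⟩` and `S =
∫ ⟨∇u, x⟩²`. The height enters through `r H = (d+1) U + 2 W` and `U' = H` (`Solution.mul_height`,
`Solution.hasDerivAt_mass`). `FrequencyData` collects these relations; `FrequencyData.le_of_pos`
bounds increments of the frequency below by those of a function with nonnegative derivative.

For positivity, a bounded frequency gives `H' ≤ C H`, so a zero of `H` propagates outwards by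
Grönwall, and inwards because `H` is nondecreasing (`FrequencyData.eq_zero_of_exists`). Then `U` is
constant and `u` vanishes. -/

/-- The boundary flux `k₊ (t⁺)^{p-1} - k₋ (t⁻)^{p-1}`. -/
noncomputable def flux (p kp km t : ℝ) : ℝ :=
  kp * (max t 0) ^ (p - 1) - km * (max (-t) 0) ^ (p - 1)

theorem max_rpow_sub_one_mul {p : ℝ} (hp : 2 ≤ p) (t : ℝ) :
    (max t 0) ^ (p - 1) * t = (max t 0) ^ p := by
  rcases le_or_gt t 0 with h | h
  · rw [max_eq_right h, Real.zero_rpow (by linarith), Real.zero_rpow (by linarith), zero_mul]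
  · rw [max_eq_left h.le, Real.rpow_sub_one h.ne', div_mul_cancel₀ _ h.ne']

theorem flux_mul_self {p : ℝ} (hp : 2 ≤ p) (kp km t : ℝ) :
    flux p kp km t * t = penalty p kp km t := by
  have h1 := max_rpow_sub_one_mul hp t
  have h2 := max_rpow_sub_one_mul hp (-t)
  unfold flux penalty
  linear_combination kp * h1 + km * h2

theorem penalty_nonneg {p kp km : ℝ} (hkp : 0 ≤ kp) (hkm : 0 ≤ km) (t : ℝ) :
    0 ≤ penalty p kp km t := by
  unfold penalty; positivity

theorem continuous_flux {p : ℝ} (hp : 2 ≤ p) (kp km : ℝ) : Continuous (flux p kp km) := by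
  unfold flux
  have h : 0 ≤ p - 1 := by linarith
  refine (continuous_const.mul ?_).sub (continuous_const.mul ?_)
  · exact (continuous_id.max continuous_const).rpow_const fun _ => Or.inr h
  · exact (continuous_neg.max continuous_const).rpow_const fun _ => Or.inr h

theorem continuous_penalty {p : ℝ} (hp : 2 ≤ p) (kp km : ℝ) :
    Continuous (penalty p kp km) := by
  unfold penalty
  have h : 0 ≤ p := by linarith
  refine (continuous_const.mul ?_).add (continuous_const.mul ?_)
  · exact (continuous_neg.max continuous_const).rpow_const fun _ => Or.inr h
  · exact (continuous_id.max continuous_const).rpow_const fun _ => Or.inr h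

/-- Convexity of `t ↦ (t⁺)^p`. For `a > 0` this is Bernoulli's inequality for the ratio `b⁺ / a`;
going from `b⁺` back to `b` only lowers the left side. -/
theorem max_rpow_tangent {p : ℝ} (hp : 2 ≤ p) (a b : ℝ) :
    p * ((max a 0) ^ (p - 1) * (b - a)) ≤ (max b 0) ^ p - (max a 0) ^ p := by
  rcases le_or_gt a 0 with h | h
  · rw [max_eq_right h, Real.zero_rpow (by linarith), Real.zero_rpow (by linarith)]
    have : 0 ≤ (max b 0) ^ p := by positivity
    linarith
  · rw [max_eq_left h.le]
    set c := max b 0 with hc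
    have hc0 : 0 ≤ c := le_max_right _ _
    have hbc : b ≤ c := le_max_left _ _
    have key := one_add_mul_self_le_rpow_one_add (s := c / a - 1)
      (by have : 0 ≤ c / a := by positivity
          linarith) (p := p) (by linarith)
    have e : (1 + (c / a - 1)) ^ p = c ^ p / a ^ p := by
      rw [add_sub_cancel, Real.div_rpow hc0 h.le]
    rw [e, le_div_iff₀ (by positivity)] at key
    have e2 : a ^ p = a ^ (p - 1) * a := by
      rw [Real.rpow_sub_one h.ne', div_mul_cancel₀ _ h.ne']
    have e3 : (1 + p * (c / a - 1)) * a ^ p = a ^ p + p * (a ^ (p - 1) * (c - a)) := by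
      rw [e2]; field_simp
    rw [e3] at key
    have : p * (a ^ (p - 1) * (b - a)) ≤ p * (a ^ (p - 1) * (c - a)) := by gcongr
    linarith

/-- The flux is `F' / p`, and `F` is convex because both coefficients are nonnegative: this is its
tangent inequality. -/
theorem flux_mul_sub_le {p kp km : ℝ} (hp : 2 ≤ p) (hkp : 0 ≤ kp) (hkm : 0 ≤ km) (a b : ℝ) :
    flux p kp km a * (b - a) ≤ 1 / p * (penalty p kp km b - penalty p kp km a) := by
  have h1 := max_rpow_tangent hp a b
  have h2 := max_rpow_tangent hp (-a) (-b)
  rw [one_div, ← div_eq_inv_mul, le_div_iff₀ (by linarith)]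
  unfold flux penalty
  nlinarith [mul_le_mul_of_nonneg_left h1 hkp, mul_le_mul_of_nonneg_left h2 hkm]

theorem abs_flux_le {p kp km : ℝ} (hp : 2 ≤ p) (hkp : 0 ≤ kp) (hkm : 0 ≤ km) (t : ℝ) :
    |flux p kp km t| ≤ (kp + km) * |t| ^ (p - 1) := by
  have h : 0 ≤ p - 1 := by linarith
  have h1 : (max t 0) ^ (p - 1) ≤ |t| ^ (p - 1) :=
    Real.rpow_le_rpow (le_max_right _ _) (max_le (le_abs_self _) (abs_nonneg _)) h
  have h2 : (max (-t) 0) ^ (p - 1) ≤ |t| ^ (p - 1) :=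
    Real.rpow_le_rpow (le_max_right _ _) (max_le (neg_le_abs _) (abs_nonneg _)) h
  have h3 : 0 ≤ (max t 0) ^ (p - 1) := by positivity
  have h4 : 0 ≤ (max (-t) 0) ^ (p - 1) := by positivity
  unfold flux
  rw [abs_le]
  constructor <;>
    nlinarith [mul_le_mul_of_nonneg_left h1 hkp, mul_le_mul_of_nonneg_left h2 hkm,
      mul_nonneg hkp h3, mul_nonneg hkm h4]

/-- A crude Young inequality: replace the smaller of `a` and `b` by the larger. It makes the flux of
one function in `L^p` integrable against another. -/
theorem rpow_sub_one_mul_le {p a b : ℝ} (hp : 2 ≤ p) (ha : 0 ≤ a) (hb : 0 ≤ b) :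
    a ^ (p - 1) * b ≤ a ^ p + b ^ p := by
  have h0 : 0 ≤ p - 1 := by linarith
  rcases le_total a b with h | h
  · have : a ^ (p - 1) * b ≤ b ^ (p - 1) * b := by gcongr
    have e : b ^ (p - 1) * b = b ^ p := by
      have := max_rpow_sub_one_mul hp b
      rwa [max_eq_left hb] at this
    have : 0 ≤ a ^ p := by positivity
    linarith
  · have : a ^ (p - 1) * b ≤ a ^ (p - 1) * a := by gcongr
    have e : a ^ (p - 1) * a = a ^ p := by
      have := max_rpow_sub_one_mul hp a
      rwa [max_eq_left ha] at this
    have : 0 ≤ b ^ p := by positivity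
    linarith

theorem abs_flux_mul_le {p kp km : ℝ} (hp : 2 ≤ p) (hkp : 0 ≤ kp) (hkm : 0 ≤ km) (a b : ℝ) :
    |flux p kp km a * b| ≤ (kp + km) * (|a| ^ p + |b| ^ p) := by
  rw [abs_mul]
  calc |flux p kp km a| * |b| ≤ (kp + km) * |a| ^ (p - 1) * |b| := by
        gcongr; exact abs_flux_le hp hkp hkm a
    _ = (kp + km) * (|a| ^ (p - 1) * |b|) := by ring
    _ ≤ _ := by gcongr; exact rpow_sub_one_mul_le hp (abs_nonneg _) (abs_nonneg _)

/-! ### Truncation -/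

/-- A smooth bounded truncation of the identity at height of order `M`. -/
noncomputable def trunc (M t : ℝ) : ℝ := M * Real.arctan (t / M)

theorem contDiff_trunc (M : ℝ) : ContDiff ℝ ∞ (trunc M) := by
  unfold trunc
  exact contDiff_const.mul (Real.contDiff_arctan.comp (contDiff_id.div_const M))

theorem hasDerivAt_trunc {M : ℝ} (hM : 0 < M) (t : ℝ) :
    HasDerivAt (trunc M) (1 / (1 + (t / M) ^ 2)) t := by
  have h := ((Real.hasDerivAt_arctan (t / M)).comp t
    ((hasDerivAt_id t).div_const M)).const_mul M
  convert! h using 1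
  field_simp

theorem deriv_trunc_mem {M : ℝ} (t : ℝ) : |1 / (1 + (t / M) ^ 2)| ≤ 1 := by
  rw [abs_of_nonneg (by positivity), div_le_one (by positivity)]
  nlinarith [sq_nonneg (t / M)]

/-- Mean value inequality from `0`. The bound does not depend on `M`, so it dominates the
truncations as `M → ∞`. -/
theorem abs_trunc_le {M : ℝ} (hM : 0 < M) (t : ℝ) : |trunc M t| ≤ |t| := by
  have h := Convex.norm_image_sub_le_of_norm_hasDerivWithin_le (f := trunc M)
    (f' := fun t => 1 / (1 + (t / M) ^ 2)) (C := 1) (s := univ) (x := 0) (y := t)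
    (fun x _ => (hasDerivAt_trunc hM x).hasDerivWithinAt) (fun x _ => deriv_trunc_mem x)
    convex_univ (mem_univ _) (mem_univ _)
  simpa [trunc] using h

theorem abs_trunc_le_const {M : ℝ} (hM : 0 < M) (t : ℝ) : |trunc M t| ≤ M * 2 := by
  unfold trunc
  rw [abs_mul, abs_of_pos hM]
  gcongr
  have h1 := Real.arctan_lt_pi_div_two (t / M)
  have h2 := Real.neg_pi_div_two_lt_arctan (t / M)
  have h3 := Real.pi_le_four
  rw [abs_le]; constructor <;> linarith

theorem tendsto_deriv_trunc (t : ℝ) :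
    Tendsto (fun k : ℕ => 1 / (1 + (t / ((k : ℝ) + 1)) ^ 2)) atTop (𝓝 1) := by
  have h : Tendsto (fun k : ℕ => t / ((k : ℝ) + 1)) atTop (𝓝 0) :=
    tendsto_const_nhds.div_atTop (tendsto_atTop_add_const_right _ _ tendsto_natCast_atTop_atTop)
  have : Tendsto (fun k : ℕ => 1 / (1 + (t / ((k : ℝ) + 1)) ^ 2)) atTop (𝓝 (1 / (1 + 0 ^ 2))) :=
    (tendsto_const_nhds (x := (1 : ℝ))).div ((h.pow 2).const_add 1) (by norm_num)
  simpa using this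

/-- This is the limit of difference quotients of `arctan` at `0` with increment `t / (k + 1)`; the
case `t = 0` is separate because the slope needs a nonzero increment. -/
theorem tendsto_trunc (t : ℝ) :
    Tendsto (fun k : ℕ => trunc ((k : ℝ) + 1) t) atTop (𝓝 t) := by
  rcases eq_or_ne t 0 with rfl | ht
  · simp [trunc]
  have h : Tendsto (fun k : ℕ => t / ((k : ℝ) + 1)) atTop (𝓝[≠] 0) := by
    refine tendsto_nhdsWithin_iff.2 ⟨tendsto_const_nhds.div_atTop
      (tendsto_atTop_add_const_right _ _ tendsto_natCast_atTop_atTop), ?_⟩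
    filter_upwards with k
    simp only [mem_compl_iff, mem_singleton_iff]
    positivity
  have hd := (hasDerivAt_iff_tendsto_slope.1 (Real.hasDerivAt_arctan 0)).comp h
  have := hd.const_mul t
  simp only [ne_eq, OfNat.ofNat_ne_zero, not_false_eq_true, zero_pow, add_zero, div_one,
    mul_one] at this
  refine this.congr fun k => ?_
  have : (k : ℝ) + 1 ≠ 0 := by positivity
  simp only [Function.comp, slope_def_field, Real.arctan_zero, sub_zero, trunc]
  field_simp

/-! ### A monotonicity criterion -/

/-- A continuous function whose increments to the right are bounded below by a function with
nonnegative right derivative is nondecreasing. -/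
theorem le_of_forall_increment_ge {f : ℝ → ℝ} {a b : ℝ} (hab : a ≤ b)
    (hf : ContinuousOn f (Icc a b))
    (h : ∀ x ∈ Ico a b, ∃ (L : ℝ → ℝ) (c : ℝ), 0 ≤ c ∧ HasDerivAt L c x ∧
      ∀ᶠ z in 𝓝[>] x, L z - L x ≤ f z - f x) : f a ≤ f b := by
  -- The barrier for `-f` is the constant `-f a`; what remains is that the right slopes of `-f` are
  -- frequently below every positive number.
  have key := image_le_of_liminf_slope_right_le_deriv_boundary (f := fun x => - f x)
    (B := fun _ => - f a) (B' := fun _ => 0) (a := a) (b := b) hf.neg le_rfl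
    continuousOn_const (fun x _ => hasDerivWithinAt_const _ _ _) ?_ (right_mem_Icc.2 hab)
  · simpa using key
  intro x hx r hr
  obtain ⟨L, c, hc, hL, hLf⟩ := h x hx
  have h1 := (hasDerivWithinAt_iff_tendsto_slope' (lt_irrefl x)).1
    (hL.hasDerivWithinAt (s := Ioi x))
  have h2 : ∀ᶠ z in 𝓝[>] x, -r < slope L x z := h1 (Ioi_mem_nhds (by linarith))
  refine Eventually.frequently ?_
  filter_upwards [h2, hLf, self_mem_nhdsWithin] with z hz1 hz2 hz3
  have hz3' : 0 < z - x := sub_pos.2 hz3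
  rw [slope_def_field] at hz1 ⊢
  rw [lt_div_iff₀ hz3'] at hz1
  rw [div_lt_iff₀ hz3']
  linarith

/-! ### Geometry of half balls and their boundary measures -/

theorem isOpen_halfBall (d : ℕ) (r : ℝ) : IsOpen (halfBall d r) := by
  have h1 : Continuous fun x : Space d => x (Fin.last d) := by fun_prop
  exact (isOpen_lt continuous_norm continuous_const).inter (isOpen_lt continuous_const h1)

theorem halfBall_eq_inter (d : ℕ) {r s : ℝ} (h : r ≤ s) :
    halfBall d r = Metric.ball 0 r ∩ halfBall d s := by
  ext x
  simp only [halfBall, mem_ofPred_eq, mem_inter_iff, mem_ball_zero_iff]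
  constructor
  · rintro ⟨h1, h2⟩; exact ⟨h1, h1.trans_le h, h2⟩
  · rintro ⟨h1, -, h2⟩; exact ⟨h1, h2⟩

theorem halfBall_subset_halfBall (d : ℕ) {r s : ℝ} (h : r ≤ s) : halfBall d r ⊆ halfBall d s := by
  rw [halfBall_eq_inter d h]; exact inter_subset_right

theorem volume_restrict_halfBall (d : ℕ) {r s : ℝ} (h : r ≤ s) :
    (volume : Measure (Space d)).restrict (halfBall d r) =
      (volume.restrict (halfBall d s)).restrict (Metric.ball 0 r) := by
  rw [Measure.restrict_restrict measurableSet_ball, ← halfBall_eq_inter d h]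

theorem halfBall_subset_ball (d : ℕ) (r : ℝ) : halfBall d r ⊆ Metric.ball 0 r :=
  fun _ hx => mem_ball_zero_iff.2 hx.1

instance (d : ℕ) (r : ℝ) :
    IsFiniteMeasure ((volume : Measure (Space d)).restrict (halfBall d r)) :=
  ⟨by
    rw [Measure.restrict_apply_univ]
    exact (measure_mono (halfBall_subset_ball d r)).trans_lt measure_ball_lt_top⟩

theorem continuous_flat (d : ℕ) : Continuous (flat d) := by
  unfold flat
  refine (PiLp.continuous_toLp 2 _).comp ?_
  refine continuous_pi fun i => ?_
  induction i using Fin.lastCases with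
  | last => simpa using continuous_const
  | cast i => simp only [Fin.snoc_castSucc]; fun_prop

theorem norm_flat (d : ℕ) (y : EuclideanSpace ℝ (Fin d)) : ‖flat d y‖ = ‖y‖ := by
  rw [EuclideanSpace.norm_eq, EuclideanSpace.norm_eq, Fin.sum_univ_castSucc]
  simp [flat]

theorem flat_smul (d : ℕ) (c : ℝ) (y : EuclideanSpace ℝ (Fin d)) :
    flat d (c • y) = c • flat d y := by
  ext i
  induction i using Fin.lastCases with
  | last => simp [flat]
  | cast i => simp [flat]

theorem flat_preimage_ball (d : ℕ) (r : ℝ) :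
    flat d ⁻¹' Metric.ball 0 r = Metric.ball 0 r := by
  ext y; simp [norm_flat]

theorem flatMeasure_eq_restrict (d : ℕ) {r s : ℝ} (h : r ≤ s) :
    flatMeasure d r = (flatMeasure d s).restrict (Metric.ball 0 r) := by
  unfold flatMeasure
  rw [Measure.restrict_map (continuous_flat d).measurable measurableSet_ball,
    flat_preimage_ball, Measure.restrict_restrict measurableSet_ball,
    inter_eq_left.2 (Metric.ball_subset_ball h)]

instance (d : ℕ) (r : ℝ) : IsFiniteMeasure (flatMeasure d r) := by
  unfold flatMeasure
  have : IsFiniteMeasure ((volume : Measure (EuclideanSpace ℝ (Fin d))).restrict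
      (Metric.ball 0 r)) := ⟨by
    rw [Measure.restrict_apply_univ]; exact measure_ball_lt_top⟩
  infer_instance

/-- A measure that does not charge the spheres around the origin. -/
def NullSpheres {d : ℕ} (μ : Measure (Space d)) : Prop := ∀ t : ℝ, μ (Metric.sphere 0 t) = 0

theorem nullSpheres_volume (d : ℕ) (r : ℝ) :
    NullSpheres ((volume : Measure (Space d)).restrict (halfBall d r)) := fun t => by
  refine Measure.absolutelyContinuous_of_le Measure.restrict_le_self ?_
  exact Measure.addHaar_sphere _ _ _

/-- For `d = 0` the flat ball would be a point, hence a sphere of radius `0` with positive mass.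
This is where `1 ≤ d` enters. -/
theorem nullSpheres_flatMeasure {d : ℕ} (hd : 1 ≤ d) (r : ℝ) :
    NullSpheres (flatMeasure d r) := fun t => by
  have : Nontrivial (EuclideanSpace ℝ (Fin d)) := by
    have : Nonempty (Fin d) := ⟨⟨0, hd⟩⟩
    infer_instance
  unfold flatMeasure
  rw [Measure.map_apply (continuous_flat d).measurable Metric.isClosed_sphere.measurableSet]
  have : flat d ⁻¹' Metric.sphere 0 t = Metric.sphere 0 t := by
    ext y; simp [norm_flat]
  rw [this]
  refine Measure.absolutelyContinuous_of_le Measure.restrict_le_self ?_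
  exact Measure.addHaar_sphere _ _ _

/-! ### Dilations -/

theorem map_smul_restrict {E : Type*} [NormedAddCommGroup E] [NormedSpace ℝ E]
    [MeasurableSpace E] [BorelSpace E] [FiniteDimensional ℝ E] (μ : Measure E)
    [μ.IsAddHaarMeasure] {c : ℝ} (hc : 0 < c) {A B : Set E} (hB : MeasurableSet B)
    (hAB : (fun x => c • x) ⁻¹' B = A) :
    (μ.restrict A).map (fun x => c • x) =
      ENNReal.ofReal ((c ^ Module.finrank ℝ E)⁻¹) • μ.restrict B := by
  rw [← hAB, ← Measure.restrict_map (by fun_prop) hB, Measure.map_addHaar_smul μ hc.ne',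
    Measure.restrict_smul, abs_of_pos (by positivity)]

theorem map_smul_halfBall (d : ℕ) {c : ℝ} (hc : 0 < c) (r : ℝ) :
    ((volume : Measure (Space d)).restrict (halfBall d r)).map (fun x => c • x) =
      ENNReal.ofReal ((c ^ (d + 1))⁻¹) • volume.restrict (halfBall d (c * r)) := by
  have h := map_smul_restrict (volume : Measure (Space d)) hc (A := halfBall d r)
    (B := halfBall d (c * r)) (isOpen_halfBall d _).measurableSet (by
      ext x
      simp only [halfBall, preimage_ofPred_eq, mem_ofPred_eq, norm_smul, Real.norm_eq_abs,
        abs_of_pos hc, PiLp.smul_apply, smul_eq_mul]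
      rw [mul_lt_mul_iff_right₀ hc, mul_pos_iff_of_pos_left hc])
  simpa using h

theorem map_smul_flatMeasure (d : ℕ) {c : ℝ} (hc : 0 < c) (r : ℝ) :
    (flatMeasure d r).map (fun x => c • x) =
      ENNReal.ofReal ((c ^ d)⁻¹) • flatMeasure d (c * r) := by
  have h := map_smul_restrict (volume : Measure (EuclideanSpace ℝ (Fin d))) hc
    (A := Metric.ball 0 r) (B := Metric.ball 0 (c * r)) measurableSet_ball (by
      ext x
      simp only [mem_preimage, mem_ball_zero_iff, norm_smul, Real.norm_eq_abs, abs_of_pos hc]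
      rw [mul_lt_mul_iff_right₀ hc])
  unfold flatMeasure
  rw [Measure.map_map (by fun_prop) (continuous_flat d).measurable]
  have e : (fun x : Space d => c • x) ∘ flat d = flat d ∘ fun y => c • y := by
    ext1 y; simp [flat_smul]
  rw [e, ← Measure.map_map (continuous_flat d).measurable (by fun_prop), h, Measure.map_smul]
  simp

/-! ### Radial cutoffs and cumulative integrals -/

/-- The integral of `f` over the ball of radius `t`. -/
noncomputable def cumul {d : ℕ} (μ : Measure (Space d)) (f : Space d → ℝ) (t : ℝ) : ℝ :=
  ∫ x in Metric.ball 0 t, f x ∂μ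

theorem cumul_volume {d : ℕ} {t : ℝ} (ht : t ≤ 1) (f : Space d → ℝ) :
    cumul (volume.restrict (halfBall d 1)) f t = ∫ x in halfBall d t, f x := by
  rw [cumul, ← volume_restrict_halfBall d ht]

theorem cumul_flat {d : ℕ} {t : ℝ} (ht : t ≤ 1) (f : Space d → ℝ) :
    cumul (flatMeasure d 1) f t = ∫ x, f x ∂(flatMeasure d t) := by
  rw [cumul, ← flatMeasure_eq_restrict d ht]

theorem cumul_eq_indicator {d : ℕ} (μ : Measure (Space d)) (f : Space d → ℝ) (t : ℝ) :
    cumul μ f t = ∫ x, (Metric.ball (0 : Space d) t).indicator f x ∂μ := by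
  rw [cumul, integral_indicator measurableSet_ball]

/-- Dominated convergence: off the sphere of radius `t`, the indicator of the ball of radius `s` is
eventually constant as `s → t`. Continuity is all that is needed of the energies as functions of the
radius. -/
theorem continuous_cumul {d : ℕ} {μ : Measure (Space d)} (hμ : NullSpheres μ)
    {f : Space d → ℝ} (hf : Integrable f μ) : Continuous (cumul μ f) := by
  rw [continuous_iff_continuousAt, show cumul μ f = _ from funext (cumul_eq_indicator μ f)]
  intro t
  unfold ContinuousAt
  refine tendsto_integral_filter_of_dominated_convergence (l := 𝓝 t)
    (F := fun s x => (Metric.ball (0 : Space d) s).indicator f x) (fun x => ‖f x‖)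
    ?_ ?_ hf.norm ?_
  · exact Eventually.of_forall fun s => hf.1.indicator measurableSet_ball
  · exact Eventually.of_forall fun s => Eventually.of_forall fun x =>
      norm_indicator_le_norm_self _ _
  · have : ∀ᵐ x ∂μ, x ∉ Metric.sphere (0 : Space d) t := measure_eq_zero_iff_ae_notMem.1 (hμ t)
    filter_upwards [this] with x hx
    have hx' : ‖x‖ ≠ t := by simpa using hx
    refine tendsto_const_nhds.congr' ?_
    rcases lt_or_gt_of_ne hx' with h | h
    · filter_upwards [lt_mem_nhds h] with s hs
      rw [indicator_of_mem (by simpa using h), indicator_of_mem (by simpa using hs)]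
    · filter_upwards [gt_mem_nhds h] with s hs
      rw [indicator_of_notMem (by simpa using h.le), indicator_of_notMem (by simpa using hs.le)]

theorem cumul_mono {d : ℕ} {μ : Measure (Space d)} {f : Space d → ℝ} (hf : Integrable f μ)
    (h0 : ∀ x, 0 ≤ f x) : Monotone (cumul μ f) := fun _ _ h =>
  setIntegral_mono_set hf.integrableOn (Eventually.of_forall h0)
    (Metric.ball_subset_ball h).eventuallyLE

theorem cumul_nonneg {d : ℕ} {μ : Measure (Space d)} {f : Space d → ℝ} (h0 : ∀ x, 0 ≤ f x)
    (t : ℝ) : 0 ≤ cumul μ f t := integral_nonneg h0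

/-- The radial function whose derivative with respect to `‖x‖ ^ 2` is `-ρ` and that vanishes
on the unit sphere. -/
noncomputable def radial (d : ℕ) (ρ : ℝ → ℝ) (x : Space d) : ℝ := ∫ σ in ‖x‖ ^ 2..1, ρ σ

section radial
variable {d : ℕ} {ρ : ℝ → ℝ}

theorem hasDerivAt_tail (hρ : Continuous ρ) (s : ℝ) :
    HasDerivAt (fun s => ∫ σ in s..1, ρ σ) (-ρ s) s :=
  intervalIntegral.integral_hasDerivAt_left (hρ.intervalIntegrable _ _)
    hρ.stronglyMeasurable.stronglyMeasurableAtFilter hρ.continuousAt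

theorem contDiff_radial (hρ : ContDiff ℝ ∞ ρ) : ContDiff ℝ ∞ (radial d ρ) := by
  have h : ContDiff ℝ ∞ fun s => ∫ σ in s..1, ρ σ := by
    rw [contDiff_infty_iff_deriv]
    have hd := hasDerivAt_tail hρ.continuous
    refine ⟨fun s => (hd s).differentiableAt, ?_⟩
    rw [show deriv (fun s => ∫ σ in s..1, ρ σ) = fun s => -ρ s from
      funext fun s => (hd s).deriv]
    exact hρ.neg
  exact h.comp (contDiff_norm_sq ℝ)

/-- The variable `‖x‖ ^ 2` keeps the weight smooth at the origin, and a gradient parallel to `x`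
turns `⟨G, ∇η⟩` into a multiple of the radial derivative. -/
theorem gradient_radial (hρ : Continuous ρ) (x : Space d) :
    ∇ (radial d ρ) x = (-(2 * ρ (‖x‖ ^ 2))) • x := by
  have h2 := (hasDerivAt_tail hρ (‖x‖ ^ 2)).comp_hasFDerivAt x
    (hasStrictFDerivAt_norm_sq x).hasFDerivAt
  refine HasGradientAt.gradient ?_
  rw [hasGradientAt_iff_hasFDerivAt]
  convert! h2 using 1
  ext y
  simp
  ring

theorem radial_eq_zero {R : ℝ} (hR0 : 0 ≤ R) (hR : R ≤ 1) (h : ∀ σ, R ^ 2 ≤ σ → ρ σ = 0)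
    {x : Space d} (hx : R ≤ ‖x‖) : radial d ρ x = 0 := by
  refine intervalIntegral.integral_zero_ae (Eventually.of_forall fun σ hσ => h σ ?_)
  have h1 : R ^ 2 ≤ ‖x‖ ^ 2 := by gcongr
  have h2 : R ^ 2 ≤ 1 := by nlinarith
  exact (le_min h1 h2).trans (le_of_lt hσ.1)

theorem radial_nonneg (h : ∀ σ, 0 ≤ ρ σ) (h1 : ∀ σ, 1 ≤ σ → ρ σ = 0) (x : Space d) :
    0 ≤ radial d ρ x := by
  rcases le_total (‖x‖ ^ 2) 1 with hx | hx
  · exact intervalIntegral.integral_nonneg hx fun σ _ => h σ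
  · refine (intervalIntegral.integral_zero_ae (Eventually.of_forall fun σ hσ => h1 σ ?_)).ge
    exact (le_of_eq (min_eq_right hx).symm).trans hσ.1.le

/-- A fixed domain of integration prepares for Fubini. When `‖x‖ > 1` the interval defining `radial`
is reversed, and both sides vanish because `ρ` is zero beyond `1`. -/
theorem radial_eq_integral (h1 : ∀ σ, 1 ≤ σ → ρ σ = 0) (x : Space d) :
    radial d ρ x = ∫ σ in Ioc (0 : ℝ) 1, ρ σ * (if ‖x‖ ^ 2 < σ then 1 else 0) := by
  have e : (fun σ => ρ σ * (if ‖x‖ ^ 2 < σ then 1 else 0)) = (Ioi (‖x‖ ^ 2)).indicator ρ := by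
    ext σ
    by_cases hσ : ‖x‖ ^ 2 < σ <;> simp [hσ, indicator]
  rw [e, setIntegral_indicator measurableSet_Ioi, radial]
  have hs : Ioc (0 : ℝ) 1 ∩ Ioi (‖x‖ ^ 2) = Ioc (‖x‖ ^ 2) 1 := by
    ext σ
    simp only [mem_inter_iff, mem_Ioc, mem_Ioi]
    constructor
    · rintro ⟨⟨_, h2⟩, h3⟩; exact ⟨h3, h2⟩
    · rintro ⟨h3, h2⟩; exact ⟨⟨(sq_nonneg _).trans_lt h3, h2⟩, h3⟩
  rw [hs]
  rcases le_total (‖x‖ ^ 2) 1 with hx | hx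
  · rw [intervalIntegral.integral_of_le hx]
  · rw [Ioc_eq_empty (not_lt.2 hx), setIntegral_empty]
    refine intervalIntegral.integral_zero_ae (Eventually.of_forall fun σ hσ => h1 σ ?_)
    exact (le_of_eq (min_eq_right hx).symm).trans hσ.1.le

/-- The layer cake formula for radial weights. -/
theorem integral_radial_mul {μ : Measure (Space d)} [SFinite μ] {f : Space d → ℝ}
    (hf : Integrable f μ) (hρ : Continuous ρ) (h1 : ∀ σ, 1 ≤ σ → ρ σ = 0) :
    ∫ x, radial d ρ x * f x ∂μ = ∫ σ in (0 : ℝ)..1, ρ σ * cumul μ f (√σ) := by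
  have hint : Integrable (fun z : Space d × ℝ => f z.1 *
      (ρ z.2 * (if ‖z.1‖ ^ 2 < z.2 then 1 else 0))) (μ.prod (volume.restrict (Ioc 0 1))) := by
    have hρi : Integrable ρ (volume.restrict (Ioc (0 : ℝ) 1)) :=
      (hρ.integrableOn_Icc (a := 0) (b := 1)).mono_set Ioc_subset_Icc_self
    refine (hf.mul_prod hρi).mono ?_ (Eventually.of_forall fun z => ?_)
    · have hm : MeasurableSet {z : Space d × ℝ | ‖z.1‖ ^ 2 < z.2} :=
        measurableSet_lt (by fun_prop) (by fun_prop)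
      have : AEStronglyMeasurable (fun z : Space d × ℝ => if ‖z.1‖ ^ 2 < z.2 then (1 : ℝ) else 0)
          (μ.prod (volume.restrict (Ioc (0 : ℝ) 1))) :=
        (StronglyMeasurable.ite hm stronglyMeasurable_const
          stronglyMeasurable_const).aestronglyMeasurable
      exact hf.1.comp_fst.mul ((hρ.comp continuous_snd).aestronglyMeasurable.mul this)
    · by_cases hz : ‖z.1‖ ^ 2 < z.2 <;> simp [hz]
      positivity
  calc ∫ x, radial d ρ x * f x ∂μ
      = ∫ x, (∫ σ in Ioc (0 : ℝ) 1, f x * (ρ σ * (if ‖x‖ ^ 2 < σ then 1 else 0))) ∂μ := by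
        congr 1 with x
        rw [integral_const_mul, ← radial_eq_integral h1, mul_comm]
    _ = ∫ σ in Ioc (0 : ℝ) 1, (∫ x, f x * (ρ σ * (if ‖x‖ ^ 2 < σ then 1 else 0)) ∂μ) :=
        integral_integral_swap hint
    _ = ∫ σ in (0 : ℝ)..1, ρ σ * cumul μ f (√σ) := by
        rw [intervalIntegral.integral_of_le zero_le_one]
        congr 1 with σ
        rw [cumul_eq_indicator, ← integral_const_mul]
        congr 1 with x
        have : x ∈ Metric.ball (0 : Space d) (√σ) ↔ ‖x‖ ^ 2 < σ := by
          rw [mem_ball_zero_iff, Real.lt_sqrt (norm_nonneg _)]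
        by_cases hx : ‖x‖ ^ 2 < σ
        · rw [indicator_of_mem (this.2 hx)]; simp [hx]; ring
        · rw [indicator_of_notMem (fun h => hx (this.1 h))]; simp [hx]

end radial

/-- Smooth approximations of the indicator function of `[r², s²)`. -/
noncomputable def shellBump (r s : ℝ) (k : ℕ) (σ : ℝ) : ℝ :=
  Real.smoothTransition (k * (s ^ 2 - σ)) * Real.smoothTransition (k * (σ - r ^ 2) + 1)

section shellBump
variable {r s : ℝ}

theorem contDiff_shellBump (r s : ℝ) (k : ℕ) : ContDiff ℝ ∞ (shellBump r s k) := by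
  unfold shellBump
  refine (Real.smoothTransition.contDiff.comp ?_).mul (Real.smoothTransition.contDiff.comp ?_)
  · fun_prop
  · fun_prop

theorem shellBump_nonneg (k : ℕ) (σ : ℝ) : 0 ≤ shellBump r s k σ :=
  mul_nonneg (Real.smoothTransition.nonneg _) (Real.smoothTransition.nonneg _)

theorem shellBump_le_one (k : ℕ) (σ : ℝ) : shellBump r s k σ ≤ 1 :=
  mul_le_one₀ (Real.smoothTransition.le_one _) (Real.smoothTransition.nonneg _)
    (Real.smoothTransition.le_one _)

theorem shellBump_eq_zero (k : ℕ) {σ : ℝ} (h : s ^ 2 ≤ σ) : shellBump r s k σ = 0 := by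
  unfold shellBump
  rw [Real.smoothTransition.zero_of_nonpos, zero_mul]
  exact mul_nonpos_of_nonneg_of_nonpos (Nat.cast_nonneg _) (by linarith)

/-- The shift `+ 1` makes the second factor equal to `1` for all `σ ≥ r²`, endpoint included, and
the first factor vanishes at `σ = s²`. The sequence is eventually constant in `k`, with exactly the
half-open indicator as limit. -/
theorem tendsto_shellBump (σ : ℝ) :
    Tendsto (fun k => shellBump r s k σ) atTop
      (𝓝 ((Ico (r ^ 2) (s ^ 2)).indicator (fun _ => 1) σ)) := by
  have hk : Tendsto (fun k : ℕ => (k : ℝ)) atTop atTop := tendsto_natCast_atTop_atTop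
  refine tendsto_const_nhds.congr' ?_
  rcases le_or_gt (s ^ 2) σ with h | h
  · filter_upwards with k
    rw [shellBump_eq_zero k h, indicator_of_notMem (fun hm => not_lt.2 h hm.2)]
  have h1 : ∀ᶠ k : ℕ in atTop, Real.smoothTransition (k * (s ^ 2 - σ)) = 1 := by
    filter_upwards [(hk.atTop_mul_const (sub_pos.2 h)).eventually_ge_atTop 1] with k hk
    exact Real.smoothTransition.one_of_one_le hk
  rcases le_or_gt (r ^ 2) σ with h' | h'
  · filter_upwards [h1] with k hk1
    rw [indicator_of_mem (mem_Ico.2 ⟨h', h⟩), shellBump, hk1, Real.smoothTransition.one_of_one_le, one_mul]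
    have : 0 ≤ (k : ℝ) * (σ - r ^ 2) := mul_nonneg (Nat.cast_nonneg _) (by linarith)
    linarith
  · filter_upwards [(hk.atTop_mul_const (sub_pos.2 h')).eventually_ge_atTop 1] with k hk
    rw [indicator_of_notMem (fun hm => not_le.2 h' hm.1), shellBump,
      Real.smoothTransition.zero_of_nonpos (x := k * (σ - r ^ 2) + 1), mul_zero]
    nlinarith

/-- The half-open shell is the exact difference of two open balls, so nothing is required about the
measure of spheres. -/
theorem tendsto_integral_shellBump_mul {d : ℕ} {μ : Measure (Space d)} {f : Space d → ℝ}
    (hf : Integrable f μ) (hr : 0 ≤ r) (hrs : r ≤ s) :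
    Tendsto (fun k => ∫ x, shellBump r s k (‖x‖ ^ 2) * f x ∂μ) atTop
      (𝓝 (cumul μ f s - cumul μ f r)) := by
  have e : cumul μ f s - cumul μ f r =
      ∫ x, (Ico (r ^ 2) (s ^ 2)).indicator (fun _ => 1) (‖x‖ ^ 2) * f x ∂μ := by
    rw [cumul_eq_indicator, cumul_eq_indicator,
      ← integral_sub (hf.indicator measurableSet_ball) (hf.indicator measurableSet_ball)]
    congr 1 with x
    have hs0 : 0 ≤ s := hr.trans hrs
    rcases lt_or_ge ‖x‖ r with h1 | h1
    · have h2 := h1.trans_le hrs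
      rw [indicator_of_mem (by simpa using h2), indicator_of_mem (by simpa using h1),
        indicator_of_notMem]
      · simp
      · intro hm; nlinarith [hm.1, norm_nonneg x]
    · rcases lt_or_ge ‖x‖ s with h2 | h2
      · rw [indicator_of_notMem (s := Metric.ball 0 r) (by simpa using h1),
          indicator_of_mem (by simpa using h2),
          indicator_of_mem (mem_Ico.2 ⟨by gcongr, by gcongr⟩)]
        simp
      · rw [indicator_of_notMem (s := Metric.ball 0 r) (by simpa using h1),
          indicator_of_notMem (by simpa using h2), indicator_of_notMem]
        · simp
        · intro hm
          have : s ^ 2 ≤ ‖x‖ ^ 2 := by gcongr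
          exact not_lt.2 this hm.2
  rw [e]
  refine tendsto_integral_of_dominated_convergence (fun x => ‖f x‖) (fun k => ?_) hf.norm
    (fun k => Eventually.of_forall fun x => ?_) (Eventually.of_forall fun x => ?_)
  · have : Continuous fun x : Space d => shellBump r s k (‖x‖ ^ 2) :=
      (contDiff_shellBump r s k).continuous.comp (by fun_prop)
    exact this.aestronglyMeasurable.mul hf.1
  · rw [norm_mul, Real.norm_of_nonneg (shellBump_nonneg _ _)]
    exact mul_le_of_le_one_left (norm_nonneg _) (shellBump_le_one _ _)
  · exact (tendsto_shellBump _).mul_const _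

theorem tendsto_intervalIntegral_shellBump_mul {Φ : ℝ → ℝ} (hΦ : Continuous Φ)
    (hr : 0 ≤ r) (hrs : r ≤ s) (hs : s ≤ 1) :
    Tendsto (fun k => ∫ σ in (0 : ℝ)..1, shellBump r s k σ * Φ σ) atTop
      (𝓝 (∫ σ in r ^ 2..s ^ 2, Φ σ)) := by
  have hrs2 : r ^ 2 ≤ s ^ 2 := by gcongr
  have hs2 : s ^ 2 ≤ 1 := by nlinarith
  have e : ∫ σ in r ^ 2..s ^ 2, Φ σ =
      ∫ σ in (0 : ℝ)..1, (Ico (r ^ 2) (s ^ 2)).indicator (fun _ => 1) σ * Φ σ := by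
    rw [intervalIntegral.integral_of_le hrs2, intervalIntegral.integral_of_le zero_le_one,
      ← integral_Ico_eq_integral_Ioc, ← integral_Ico_eq_integral_Ioc]
    have : (fun σ => (Ico (r ^ 2) (s ^ 2)).indicator (fun _ => (1 : ℝ)) σ * Φ σ) =
        (Ico (r ^ 2) (s ^ 2)).indicator Φ := by
      ext σ; by_cases h : σ ∈ Ico (r ^ 2) (s ^ 2) <;> simp [h]
    rw [this, setIntegral_indicator measurableSet_Ico,
      inter_eq_right.2 (Ico_subset_Ico (sq_nonneg r) hs2)]
  rw [e]
  refine intervalIntegral.tendsto_integral_filter_of_dominated_convergence (fun σ => ‖Φ σ‖)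
    (Eventually.of_forall fun k => ?_) (Eventually.of_forall fun k => Eventually.of_forall
      fun σ _ => ?_) (hΦ.norm.intervalIntegrable _ _) (Eventually.of_forall fun σ _ => ?_)
  · exact ((contDiff_shellBump r s k).continuous.mul hΦ).aestronglyMeasurable
  · rw [norm_mul, Real.norm_of_nonneg (shellBump_nonneg _ _)]
    exact mul_le_of_le_one_left (norm_nonneg _) (shellBump_le_one _ _)
  · exact (tendsto_shellBump _).mul_const _

end shellBump

/-! ### Square integrable functions -/

section L2
variable {α E F : Type*} [MeasurableSpace α] {μ : Measure α} [NormedAddCommGroup E]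
  [NormedAddCommGroup F]

/-- The `L²` norm as a real number. -/
noncomputable def l2 (μ : Measure α) (f : α → E) : ℝ := (eLpNorm f 2 μ).toReal

theorem l2_nonneg (f : α → E) : 0 ≤ l2 μ f := ENNReal.toReal_nonneg

theorem integrable_of_norm_le_mul {f : α → E} {g : α → F} {b : α → ℝ} (hf : MemLp f 2 μ)
    (hg : MemLp g 2 μ) (hb : AEStronglyMeasurable b μ) (C : ℝ)
    (h : ∀ᵐ x ∂μ, ‖b x‖ ≤ C * (‖f x‖ * ‖g x‖)) : Integrable b μ :=
  ((hf.norm.integrable_mul hg.norm).const_mul C).mono' hb h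

theorem abs_integral_le_l2_mul {f : α → E} {g : α → F} {b : α → ℝ} (hf : MemLp f 2 μ)
    (hg : MemLp g 2 μ) {C : ℝ} (hC : 0 ≤ C)
    (h : ∀ᵐ x ∂μ, ‖b x‖ ≤ C * (‖f x‖ * ‖g x‖)) :
    |∫ x, b x ∂μ| ≤ C * (l2 μ f * l2 μ g) := by
  have hi : Integrable (fun x => ‖f x‖ * ‖g x‖) μ := hf.norm.integrable_mul hg.norm
  have h1 : |∫ x, b x ∂μ| ≤ ∫ x, C * (‖f x‖ * ‖g x‖) ∂μ :=
    norm_integral_le_of_norm_le (hi.const_mul C) h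
  rw [integral_const_mul] at h1
  refine h1.trans (mul_le_mul_of_nonneg_left ?_ hC)
  have h2 := eLpNorm_smul_le_mul_eLpNorm (p := 2) (q := 2) (r := 1) hg.norm.1 hf.norm.1
  rw [eLpNorm_one_eq_lintegral_enorm, eLpNorm_norm, eLpNorm_norm] at h2
  rw [integral_eq_lintegral_of_nonneg_ae (Eventually.of_forall fun x => by positivity) hi.1, l2, l2,
    ← ENNReal.toReal_mul]
  refine ENNReal.toReal_mono (ENNReal.mul_ne_top hf.2.ne hg.2.ne) (le_trans (le_of_eq ?_) h2)
  congr 1 with x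
  rw [Pi.smul_apply', smul_eq_mul, Real.enorm_eq_ofReal (by positivity)]

theorem tendsto_l2 {w : ℕ → α → E} (h : Tendsto (fun k => eLpNorm (w k) 2 μ) atTop (𝓝 0)) :
    Tendsto (fun k => l2 μ (w k)) atTop (𝓝 0) := by
  simpa [l2, Function.comp_def] using (ENNReal.tendsto_toReal ENNReal.zero_ne_top).comp h

theorem exists_seq_tendsto_ae_of_l2 {f : ℕ → α → E} {g : α → E}
    (hf : ∀ k, AEStronglyMeasurable (f k) μ) (hg : AEStronglyMeasurable g μ)
    (h : Tendsto (fun k => eLpNorm (fun x => f k x - g x) 2 μ) atTop (𝓝 0)) :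
    ∃ ns : ℕ → ℕ, StrictMono ns ∧ ∀ᵐ x ∂μ, Tendsto (fun i => f (ns i) x) atTop (𝓝 (g x)) :=
  (tendstoInMeasure_of_tendsto_eLpNorm two_ne_zero hf hg h).exists_seq_tendsto_ae

end L2

/-! ### Gradients of smooth functions -/

section gradient
variable {d : ℕ}

theorem gradient_apply_eq (f : Space d → ℝ) (x : Space d) :
    ∇ f x = (InnerProductSpace.toDual ℝ (Space d)).symm (fderiv ℝ f x) := rfl

theorem continuous_gradient {f : Space d → ℝ} (hf : ContDiff ℝ ∞ f) : Continuous (∇ f) :=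
  (InnerProductSpace.toDual ℝ (Space d)).symm.continuous.comp
    (hf.continuous_fderiv (by simp))

theorem ContDiff.hasGradientAt {f : Space d → ℝ} (hf : ContDiff ℝ ∞ f) (x : Space d) :
    HasGradientAt f (∇ f x) x :=
  (hf.differentiable (by simp) x).hasGradientAt

theorem gradient_mul_comp {f g : Space d → ℝ} {ψ : ℝ → ℝ} {ψ' : ℝ} {x : Space d}
    (hf : ContDiff ℝ ∞ f) (hg : ContDiff ℝ ∞ g) (hψ : HasDerivAt ψ ψ' (g x)) :
    ∇ (fun y => f y * ψ (g y)) x = (ψ (g x)) • ∇ f x + (f x * ψ') • ∇ g x := by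
  refine HasGradientAt.gradient ?_
  have h1 := (ContDiff.hasGradientAt hf x).hasFDerivAt
  have h2 := hψ.comp_hasFDerivAt x (ContDiff.hasGradientAt hg x).hasFDerivAt
  rw [hasGradientAt_iff_hasFDerivAt]
  convert! h1.mul h2 using 1
  ext y
  simp
  ring

theorem gradient_comp_smul {f : Space d → ℝ} (hf : ContDiff ℝ ∞ f) (c : ℝ) (x : Space d) :
    ∇ (fun y => f (c • y)) x = c • ∇ f (c • x) := by
  refine HasGradientAt.gradient ?_
  rw [hasGradientAt_iff_hasFDerivAt]
  have h1 := (ContDiff.hasGradientAt hf (c • x)).hasFDerivAt.comp x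
    ((hasFDerivAt_id x).const_smul c)
  convert! h1 using 1
  ext y
  simp

theorem hasDerivAt_comp_smul {f : Space d → ℝ} (hf : ContDiff ℝ ∞ f) (x : Space d) (c : ℝ) :
    HasDerivAt (fun c : ℝ => f (c • x)) (inner ℝ (∇ f (c • x)) x) c := by
  have h1 := (ContDiff.hasGradientAt hf (c • x)).hasFDerivAt.comp_hasDerivAt c
    ((hasDerivAt_id c).smul_const x)
  convert! h1 using 1
  simp

theorem hasCompactSupport_of_eq_zero {E : Type*} [Zero E] {f : Space d → E} {R : ℝ}
    (h : ∀ x, R ≤ ‖x‖ → f x = 0) : HasCompactSupport f :=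
  HasCompactSupport.intro (isCompact_closedBall (0 : Space d) R) fun x hx =>
    h x (by simpa using (not_le.1 (fun h => hx (by simpa using h))).le)

theorem gradient_eq_zero_of_lt {f : Space d → ℝ} {R : ℝ} (h : ∀ x, R ≤ ‖x‖ → f x = 0)
    {x : Space d} (hx : R < ‖x‖) : ∇ f x = 0 := by
  have : f =ᶠ[𝓝 x] fun _ => 0 := by
    filter_upwards [continuous_norm.continuousAt.eventually (lt_mem_nhds hx)] with y hy
    exact h y hy.le
  rw [this.gradient_eq, gradient_fun_const]

theorem exists_bound_of_eq_zero {f : Space d → ℝ} {R : ℝ} (hf : ContDiff ℝ ∞ f)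
    (h : ∀ x, R ≤ ‖x‖ → f x = 0) :
    ∃ C, 0 ≤ C ∧ (∀ x, |f x| ≤ C) ∧ ∀ x, ‖∇ f x‖ ≤ C := by
  obtain ⟨C1, h1⟩ := hf.continuous.bounded_above_of_compact_support
    (hasCompactSupport_of_eq_zero h)
  obtain ⟨C2, h2⟩ := (continuous_gradient hf).bounded_above_of_compact_support
    (hasCompactSupport_of_eq_zero (R := R + 1) fun x hx =>
      gradient_eq_zero_of_lt h (by linarith))
  exact ⟨max C1 C2, (norm_nonneg _).trans ((h1 0).trans (le_max_left _ _)),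
    fun x => (h1 x).trans (le_max_left _ _), fun x => (h2 x).trans (le_max_right _ _)⟩

end gradient

/-! ### Admissible test functions -/

section

variable {d : ℕ}

theorem memLp_of_continuous {E : Type*} [NormedAddCommGroup E] [SecondCountableTopology E]
    {μ : Measure (Space d)} [IsFiniteMeasure μ] {R : ℝ} (hμ : ∀ᵐ x ∂μ, ‖x‖ ≤ R)
    {f : Space d → E} (hf : Continuous f) (q : ℝ≥0∞) : MemLp f q μ := by
  obtain ⟨C, hC⟩ := (isCompact_closedBall (0 : Space d) R).exists_bound_of_continuousOn
    hf.continuousOn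
  refine MemLp.of_bound hf.aestronglyMeasurable C ?_
  filter_upwards [hμ] with x hx using hC x (by simpa using hx)

theorem ae_norm_lt_halfBall (d : ℕ) (r : ℝ) :
    ∀ᵐ x ∂(volume : Measure (Space d)).restrict (halfBall d r), ‖x‖ < r := by
  filter_upwards [ae_restrict_mem (isOpen_halfBall d r).measurableSet] with x hx using hx.1

theorem ae_norm_lt_flatMeasure (d : ℕ) (r : ℝ) : ∀ᵐ x ∂flatMeasure d r, ‖x‖ < r := by
  rw [flatMeasure_eq_restrict d le_rfl]
  filter_upwards [ae_restrict_mem measurableSet_ball] with x hx using by simpa using hx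

theorem memLp_halfBall {E : Type*} [NormedAddCommGroup E] [SecondCountableTopology E] {r : ℝ}
    {f : Space d → E} (hf : Continuous f) (q : ℝ≥0∞) :
    MemLp f q (volume.restrict (halfBall d r)) :=
  memLp_of_continuous ((ae_norm_lt_halfBall d r).mono fun _ h => h.le) hf q

/-- The smooth functions `φ k` approximate `v` in `W^{1,2}(B_R⁺)`, where `V` is the gradient
of `v`, and their restrictions approximate `σ` in `L²(Γ_R)`. -/
structure SmoothApprox (d : ℕ) (R : ℝ) (v : Space d → ℝ) (V : Space d → Space d)
    (σ : Space d → ℝ) (φ : ℕ → Space d → ℝ) : Prop where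
  smooth : ∀ k, ContDiff ℝ ∞ (φ k)
  memLp_val : MemLp v 2 (volume.restrict (halfBall d R))
  memLp_grad : MemLp V 2 (volume.restrict (halfBall d R))
  memLp_trace : MemLp σ 2 (flatMeasure d R)
  tendsto_val : Tendsto (fun k => eLpNorm (fun x => φ k x - v x) 2
    (volume.restrict (halfBall d R))) atTop (𝓝 0)
  tendsto_grad : Tendsto (fun k => eLpNorm (fun x => ∇ (φ k) x - V x) 2
    (volume.restrict (halfBall d R))) atTop (𝓝 0)
  tendsto_trace : Tendsto (fun k => eLpNorm (fun x => φ k x - σ x) 2 (flatMeasure d R))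
    atTop (𝓝 0)

theorem SmoothApprox.subseq {R : ℝ} {v : Space d → ℝ} {V : Space d → Space d}
    {σ : Space d → ℝ} {φ : ℕ → Space d → ℝ} (h : SmoothApprox d R v V σ φ) {ns : ℕ → ℕ}
    (hns : StrictMono ns) : SmoothApprox d R v V σ (fun k => φ (ns k)) where
  smooth _ := h.smooth _
  memLp_val := h.memLp_val
  memLp_grad := h.memLp_grad
  memLp_trace := h.memLp_trace
  tendsto_val := h.tendsto_val.comp hns.tendsto_atTop
  tendsto_grad := h.tendsto_grad.comp hns.tendsto_atTop
  tendsto_trace := h.tendsto_trace.comp hns.tendsto_atTop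

theorem SmoothApprox.exists_ae {R : ℝ} {v : Space d → ℝ} {V : Space d → Space d}
    {σ : Space d → ℝ} {φ : ℕ → Space d → ℝ} (h : SmoothApprox d R v V σ φ) :
    ∃ φ', SmoothApprox d R v V σ φ' ∧
      (∀ᵐ x ∂volume.restrict (halfBall d R), Tendsto (fun k => φ' k x) atTop (𝓝 (v x))) ∧
      ∀ᵐ x ∂flatMeasure d R, Tendsto (fun k => φ' k x) atTop (𝓝 (σ x)) := by
  obtain ⟨ns, hns, h1⟩ := exists_seq_tendsto_ae_of_l2
    (fun k => (h.smooth k).continuous.aestronglyMeasurable) h.memLp_val.1 h.tendsto_val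
  have h' := h.subseq hns
  obtain ⟨ms, hms, h2⟩ := exists_seq_tendsto_ae_of_l2
    (fun k => (h'.smooth k).continuous.aestronglyMeasurable) h.memLp_trace.1 h'.tendsto_trace
  refine ⟨_, h'.subseq hms, ?_, h2⟩
  filter_upwards [h1] with x hx using hx.comp hms.tendsto_atTop

theorem SmoothApprox.restrict {R R' : ℝ} {v : Space d → ℝ} {V : Space d → Space d}
    {σ : Space d → ℝ} {φ : ℕ → Space d → ℝ} (h : SmoothApprox d R v V σ φ) (hR : R' ≤ R) :
    SmoothApprox d R' v V σ φ := by
  have h1 : (volume : Measure (Space d)).restrict (halfBall d R') ≤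
      volume.restrict (halfBall d R) :=
    Measure.restrict_mono (halfBall_subset_halfBall d hR) le_rfl
  have h2 : flatMeasure d R' ≤ flatMeasure d R := by
    rw [flatMeasure_eq_restrict d hR]; exact Measure.restrict_le_self
  exact ⟨h.smooth, h.memLp_val.mono_measure h1, h.memLp_grad.mono_measure h1,
    h.memLp_trace.mono_measure h2,
    tendsto_of_tendsto_of_tendsto_of_le_of_le tendsto_const_nhds h.tendsto_val
      (fun _ => zero_le) fun _ => eLpNorm_mono_measure _ h1,
    tendsto_of_tendsto_of_tendsto_of_le_of_le tendsto_const_nhds h.tendsto_grad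
      (fun _ => zero_le) fun _ => eLpNorm_mono_measure _ h1,
    tendsto_of_tendsto_of_tendsto_of_le_of_le tendsto_const_nhds h.tendsto_trace
      (fun _ => zero_le) fun _ => eLpNorm_mono_measure _ h2⟩

/-- A weak solution `u` with gradient `G` and trace `τ` on `Γ`, together with a smooth
approximation. -/
structure Solution (d : ℕ) (p kp km : ℝ) (u : Space d → ℝ) (G : Space d → Space d)
    (τ : Space d → ℝ) (φ : ℕ → Space d → ℝ) : Prop where
  two_le : 2 ≤ p
  kp_nonneg : 0 ≤ kp
  km_nonneg : 0 ≤ km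
  one_le : 1 ≤ d
  approx : SmoothApprox d 1 u G τ φ
  memLp_p : MemLp τ (ENNReal.ofReal p) (flatMeasure d 1)
  weak_eq : ∀ ξ : Space d → ℝ, ContDiff ℝ ∞ ξ →
    (∀ x, ‖x‖ = 1 → 0 < x (Fin.last d) → ξ x = 0) →
    ∫ x in halfBall d 1, inner ℝ (G x) (∇ ξ x) = -∫ x, flux p kp km (τ x) * ξ x ∂flatMeasure d 1

/-! ### Testing the weak equation with Sobolev functions -/

section Solution

variable {p kp km : ℝ} {u : Space d → ℝ} {G : Space d → Space d} {τ : Space d → ℝ}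
  {φ : ℕ → Space d → ℝ}

theorem Solution.integrable_abs_rpow (h : Solution d p kp km u G τ φ) :
    Integrable (fun x => |τ x| ^ p) (flatMeasure d 1) := by
  have hp : 0 < p := by linarith [h.two_le]
  have := h.memLp_p.integrable_norm_rpow (by simpa using hp) ENNReal.ofReal_ne_top
  simpa [ENNReal.toReal_ofReal hp.le] using this

theorem Solution.aestronglyMeasurable_flux (h : Solution d p kp km u G τ φ) :
    AEStronglyMeasurable (fun x => flux p kp km (τ x)) (flatMeasure d 1) :=
  (continuous_flux h.two_le kp km).comp_aestronglyMeasurable h.memLp_p.1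

theorem Solution.integrable_flux (h : Solution d p kp km u G τ φ) :
    Integrable (fun x => flux p kp km (τ x)) (flatMeasure d 1) := by
  have hi := ((h.integrable_abs_rpow.add (integrable_const (1 : ℝ))).const_mul (kp + km))
  refine hi.mono' h.aestronglyMeasurable_flux (Eventually.of_forall fun x => ?_)
  have := abs_flux_mul_le h.two_le h.kp_nonneg h.km_nonneg (τ x) 1
  simpa using this

theorem Solution.integrable_penalty (h : Solution d p kp km u G τ φ) :
    Integrable (fun x => penalty p kp km (τ x)) (flatMeasure d 1) := by
  have hi := ((h.integrable_abs_rpow.add h.integrable_abs_rpow).const_mul (kp + km))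
  refine hi.mono' ((continuous_penalty h.two_le kp km).comp_aestronglyMeasurable h.memLp_p.1)
    (Eventually.of_forall fun x => ?_)
  have := abs_flux_mul_le h.two_le h.kp_nonneg h.km_nonneg (τ x) (τ x)
  rwa [flux_mul_self h.two_le] at this

theorem Solution.integrable_energy (h : Solution d p kp km u G τ φ) :
    Integrable (fun x => ‖G x‖ ^ 2) (volume.restrict (halfBall d 1)) :=
  h.approx.memLp_grad.integrable_norm_pow two_ne_zero

theorem setIntegral_halfBall_eq {R S : ℝ} (hR : R ≤ S) {f : Space d → ℝ}
    (hf : ∀ x, R ≤ ‖x‖ → f x = 0) : ∫ x in halfBall d S, f x = ∫ x in halfBall d R, f x := by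
  rw [volume_restrict_halfBall d hR]
  refine (setIntegral_eq_integral_of_forall_compl_eq_zero fun x hx => hf x ?_).symm
  simpa using hx

theorem integral_flatMeasure_eq {R S : ℝ} (hR : R ≤ S) {f : Space d → ℝ}
    (hf : ∀ x, R ≤ ‖x‖ → f x = 0) : ∫ x, f x ∂flatMeasure d S = ∫ x, f x ∂flatMeasure d R := by
  rw [flatMeasure_eq_restrict d hR]
  refine (setIntegral_eq_integral_of_forall_compl_eq_zero fun x hx => hf x ?_).symm
  simpa using hx

variable {R R' : ℝ} {v : Space d → ℝ} {V : Space d → Space d} {σ η : Space d → ℝ}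
  {φ' : ℕ → Space d → ℝ}

/-- The smooth approximations converge on the flat part only in `L²`, which is too weak against a
flux of power `p - 1`. After truncation the boundary integrand is dominated by a multiple of the
flux, and almost everywhere convergence of a subsequence suffices. The strict inequality `R' < R`
makes the gradient of the test function vanish for `‖x‖ ≥ R`, so only the values of `v` in the
smaller half ball matter. -/
theorem Solution.test_trunc (h : Solution d p kp km u G τ φ) (hR : R ≤ 1) (hR' : R' < R)
    (ha : SmoothApprox d R v V σ φ') (hη : ContDiff ℝ ∞ η) (hη0 : ∀ x, R' ≤ ‖x‖ → η x = 0)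
    {M : ℝ} (hM : 0 < M) :
    ∫ x in halfBall d R, (trunc M (v x) * inner ℝ (G x) (∇ η x) +
        η x * (1 / (1 + (v x / M) ^ 2)) * inner ℝ (G x) (V x)) =
      -∫ x, flux p kp km (τ x) * (η x * trunc M (σ x)) ∂flatMeasure d R := by
  obtain ⟨ψ, hψ, hψv, hψσ⟩ := ha.exists_ae
  obtain ⟨C, hC0, hC1, hC2⟩ := exists_bound_of_eq_zero hη hη0
  have hGR : MemLp G 2 (volume.restrict (halfBall d R)) := (h.approx.restrict hR).memLp_grad
  have hflux : Integrable (fun x => flux p kp km (τ x)) (flatMeasure d R) := by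
    rw [flatMeasure_eq_restrict d hR]; exact h.integrable_flux.integrableOn
  have hct : Continuous (trunc M) := (contDiff_trunc M).continuous
  have hcd : Continuous fun t : ℝ => 1 / (1 + (t / M) ^ 2) :=
    continuous_const.div (by fun_prop) fun t => by positivity
  have hcη := hη.continuous
  have hcg := continuous_gradient hη
  have hsmooth : ∀ k, ContDiff ℝ ∞ fun x => η x * trunc M (ψ k x) := fun k =>
    hη.mul ((contDiff_trunc M).comp (hψ.smooth k))
  have hgrad : ∀ k x, ∇ (fun x => η x * trunc M (ψ k x)) x =
      trunc M (ψ k x) • ∇ η x + (η x * (1 / (1 + (ψ k x / M) ^ 2))) • ∇ (ψ k) x := fun k x =>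
    gradient_mul_comp hη (hψ.smooth k) (hasDerivAt_trunc hM _)
  -- the equation for the approximations
  have heq : ∀ k, (∫ x in halfBall d R, (trunc M (ψ k x) * inner ℝ (G x) (∇ η x) +
        η x * (1 / (1 + (ψ k x / M) ^ 2)) * inner ℝ (G x) (V x))) +
        ∫ x in halfBall d R, η x * (1 / (1 + (ψ k x / M) ^ 2)) *
          inner ℝ (G x) (∇ (ψ k) x - V x) =
      -∫ x, flux p kp km (τ x) * (η x * trunc M (ψ k x)) ∂flatMeasure d R := by
    intro k
    have h1 := h.weak_eq _ (hsmooth k) fun x hx _ => by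
      rw [hη0 x (by linarith), zero_mul]
    rw [setIntegral_halfBall_eq hR, integral_flatMeasure_eq hR] at h1
    · rw [← h1, ← integral_add]
      · congr 1 with x
        rw [hgrad, inner_add_right, inner_smul_right, inner_smul_right, inner_sub_right]
        ring
      · have hcψ := (hψ.smooth k).continuous
        refine (integrable_of_norm_le_mul hGR (memLp_halfBall hcg 2)
          (b := fun x => trunc M (ψ k x) * inner ℝ (G x) (∇ η x)) ?_ (M * 2) ?_).add
          (integrable_of_norm_le_mul hGR hψ.memLp_grad ?_ C ?_)
        · exact (hct.comp hcψ).aestronglyMeasurable.mul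
            (hGR.1.inner hcg.aestronglyMeasurable)
        · refine Eventually.of_forall fun x => ?_
          rw [norm_mul]
          gcongr
          · exact abs_trunc_le_const hM _
          · exact norm_inner_le_norm _ _
        · exact (hcη.mul (hcd.comp hcψ)).aestronglyMeasurable.mul
            (hGR.1.inner hψ.memLp_grad.1)
        · refine Eventually.of_forall fun x => ?_
          rw [norm_mul, norm_mul]
          refine mul_le_mul ?_ (norm_inner_le_norm _ _) (norm_nonneg _) hC0
          exact (mul_le_of_le_one_right (norm_nonneg _) (deriv_trunc_mem _)).trans (hC1 x)
      · have hcψ := (hψ.smooth k).continuous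
        have hw : MemLp (fun x => ∇ (ψ k) x - V x) 2 (volume.restrict (halfBall d R)) :=
          (memLp_halfBall (continuous_gradient (hψ.smooth k)) 2).sub hψ.memLp_grad
        refine integrable_of_norm_le_mul hGR hw ?_ C ?_
        · exact (hcη.mul (hcd.comp hcψ)).aestronglyMeasurable.mul
            (hGR.1.inner hw.1)
        · refine Eventually.of_forall fun x => ?_
          rw [norm_mul, norm_mul]
          refine mul_le_mul ?_ (norm_inner_le_norm _ _) (norm_nonneg _) hC0
          exact (mul_le_of_le_one_right (norm_nonneg _) (deriv_trunc_mem _)).trans (hC1 x)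
    · intro x hx
      rw [hη0 x (hR'.le.trans hx)]; simp
    · intro x hx
      rw [gradient_eq_zero_of_lt (R := R') (fun y hy => by rw [hη0 y hy, zero_mul])
        (hR'.trans_le hx), inner_zero_right]
  -- pass to the limit
  have lim1 : Tendsto (fun k => ∫ x in halfBall d R,
      (trunc M (ψ k x) * inner ℝ (G x) (∇ η x) +
        η x * (1 / (1 + (ψ k x / M) ^ 2)) * inner ℝ (G x) (V x))) atTop
      (𝓝 (∫ x in halfBall d R, (trunc M (v x) * inner ℝ (G x) (∇ η x) +
        η x * (1 / (1 + (v x / M) ^ 2)) * inner ℝ (G x) (V x)))) := by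
    refine tendsto_integral_of_dominated_convergence
      (fun x => M * 2 * (‖G x‖ * ‖∇ η x‖) + C * (‖G x‖ * ‖V x‖)) (fun k => ?_) ?_
      (fun k => Eventually.of_forall fun x => ?_) ?_
    · have hcψ := (hψ.smooth k).continuous
      exact ((hct.comp hcψ).aestronglyMeasurable.mul
        (hGR.1.inner hcg.aestronglyMeasurable)).add
        ((hcη.mul (hcd.comp hcψ)).aestronglyMeasurable.mul (hGR.1.inner hψ.memLp_grad.1))
    · exact ((hGR.norm.integrable_mul (memLp_halfBall hcg 2).norm).const_mul _).add
        ((hGR.norm.integrable_mul ha.memLp_grad.norm).const_mul _)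
    · refine (norm_add_le _ _).trans (add_le_add ?_ ?_)
      · rw [norm_mul]
        gcongr
        · exact abs_trunc_le_const hM _
        · exact norm_inner_le_norm _ _
      · rw [norm_mul, norm_mul]
        refine mul_le_mul ?_ (norm_inner_le_norm _ _) (norm_nonneg _) hC0
        exact (mul_le_of_le_one_right (norm_nonneg _) (deriv_trunc_mem _)).trans (hC1 x)
    · filter_upwards [hψv] with x hx
      exact (((hct.tendsto _).comp hx).mul_const _).add
        ((((hcd.tendsto _).comp hx).const_mul _).mul_const _)
  -- The error of replacing `∇ψ_k` by `V` is at most `C ‖G‖ ‖∇ψ_k - V‖` in `L²` norms.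
  have lim2 : Tendsto (fun k => ∫ x in halfBall d R, η x * (1 / (1 + (ψ k x / M) ^ 2)) *
      inner ℝ (G x) (∇ (ψ k) x - V x)) atTop (𝓝 0) := by
    have hz := ((tendsto_l2 hψ.tendsto_grad).const_mul
      (l2 (volume.restrict (halfBall d R)) G)).const_mul C
    simp only [mul_zero] at hz
    refine squeeze_zero_norm (fun k => ?_) hz
    refine abs_integral_le_l2_mul hGR
      ((memLp_halfBall (continuous_gradient (hψ.smooth k)) 2).sub hψ.memLp_grad) hC0
      (Eventually.of_forall fun x => ?_)
    rw [norm_mul, norm_mul]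
    refine mul_le_mul ?_ (norm_inner_le_norm _ _) (norm_nonneg _) hC0
    exact (mul_le_of_le_one_right (norm_nonneg _) (deriv_trunc_mem _)).trans (hC1 x)
  have lim3 : Tendsto (fun k => ∫ x, flux p kp km (τ x) * (η x * trunc M (ψ k x))
      ∂flatMeasure d R) atTop
      (𝓝 (∫ x, flux p kp km (τ x) * (η x * trunc M (σ x)) ∂flatMeasure d R)) := by
    refine tendsto_integral_of_dominated_convergence
      (fun x => ‖flux p kp km (τ x)‖ * (C * (M * 2))) (fun k => ?_) (hflux.norm.mul_const _)
      (fun k => Eventually.of_forall fun x => ?_) ?_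
    · exact hflux.1.mul
        (hcη.mul (hct.comp (hψ.smooth k).continuous)).aestronglyMeasurable
    · rw [norm_mul, norm_mul]
      gcongr
      · exact hC1 x
      · exact abs_trunc_le_const hM _
    · filter_upwards [hψσ] with x hx
      exact (((hct.tendsto _).comp hx).const_mul _).const_mul _
  have := (lim1.add lim2).congr heq
  rw [add_zero] at this
  exact tendsto_nhds_unique this lim3.neg

/-- The weak equation holds for the products of a cutoff function and a function in
`W^{1,2}` whose trace is integrable against the flux. -/
theorem Solution.test (h : Solution d p kp km u G τ φ) (hR : R ≤ 1) (hR' : R' < R)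
    (ha : SmoothApprox d R v V σ φ') (hη : ContDiff ℝ ∞ η) (hη0 : ∀ x, R' ≤ ‖x‖ → η x = 0)
    (hi : Integrable (fun x => flux p kp km (τ x) * σ x) (flatMeasure d R)) :
    ∫ x in halfBall d R, (v x * inner ℝ (G x) (∇ η x) + η x * inner ℝ (G x) (V x)) =
      -∫ x, η x * (flux p kp km (τ x) * σ x) ∂flatMeasure d R := by
  obtain ⟨C, hC0, hC1, hC2⟩ := exists_bound_of_eq_zero hη hη0
  have hGR : MemLp G 2 (volume.restrict (halfBall d R)) := (h.approx.restrict hR).memLp_grad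
  have hflux : Integrable (fun x => flux p kp km (τ x)) (flatMeasure d R) := by
    rw [flatMeasure_eq_restrict d hR]; exact h.integrable_flux.integrableOn
  have hcη := hη.continuous
  have hcg := continuous_gradient hη
  have hM : ∀ k : ℕ, (0 : ℝ) < k + 1 := fun k => by positivity
  have hct : ∀ k : ℕ, Continuous (trunc ((k : ℝ) + 1)) := fun k => (contDiff_trunc _).continuous
  have hcd : ∀ k : ℕ, Continuous fun t : ℝ => 1 / (1 + (t / ((k : ℝ) + 1)) ^ 2) := fun k =>
    continuous_const.div (by fun_prop) fun t => by positivity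
  -- Now the truncation height tends to infinity. The truncation is bounded by the identity and its
  -- derivative by `1`, which gives a majorant independent of `k`; on the flat part the majorant
  -- comes from `hi`.
  have lim1 : Tendsto (fun k : ℕ => ∫ x in halfBall d R,
      (trunc ((k : ℝ) + 1) (v x) * inner ℝ (G x) (∇ η x) +
        η x * (1 / (1 + (v x / ((k : ℝ) + 1)) ^ 2)) * inner ℝ (G x) (V x))) atTop
      (𝓝 (∫ x in halfBall d R, (v x * inner ℝ (G x) (∇ η x) + η x * inner ℝ (G x) (V x)))) := by
    refine tendsto_integral_of_dominated_convergence
      (fun x => C * (‖v x‖ * ‖G x‖) + C * (‖G x‖ * ‖V x‖)) (fun k => ?_) ?_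
      (fun k => Eventually.of_forall fun x => ?_) (Eventually.of_forall fun x => ?_)
    · exact (((hct k).comp_aestronglyMeasurable ha.memLp_val.1).mul
        (hGR.1.inner hcg.aestronglyMeasurable)).add
        ((hcη.aestronglyMeasurable.mul
          ((hcd k).comp_aestronglyMeasurable ha.memLp_val.1)).mul (hGR.1.inner ha.memLp_grad.1))
    · exact ((ha.memLp_val.norm.integrable_mul hGR.norm).const_mul _).add
        ((hGR.norm.integrable_mul ha.memLp_grad.norm).const_mul _)
    · refine (norm_add_le _ _).trans (add_le_add ?_ ?_)
      · rw [norm_mul]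
        calc ‖trunc ((k : ℝ) + 1) (v x)‖ * ‖inner ℝ (G x) (∇ η x)‖
            ≤ ‖v x‖ * (‖G x‖ * C) := by
              gcongr
              · exact abs_trunc_le (hM k) _
              · exact (norm_inner_le_norm _ _).trans (by gcongr; exact hC2 x)
          _ = C * (‖v x‖ * ‖G x‖) := by ring
      · rw [norm_mul, norm_mul]
        refine mul_le_mul ?_ (norm_inner_le_norm _ _) (norm_nonneg _) hC0
        exact (mul_le_of_le_one_right (norm_nonneg _) (deriv_trunc_mem _)).trans (hC1 x)
    · refine ((tendsto_trunc _).mul_const _).add ?_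
      have := ((tendsto_deriv_trunc (v x)).const_mul (η x)).mul_const (inner ℝ (G x) (V x))
      simpa using this
  have lim2 : Tendsto (fun k : ℕ => ∫ x, flux p kp km (τ x) * (η x * trunc ((k : ℝ) + 1) (σ x))
      ∂flatMeasure d R) atTop
      (𝓝 (∫ x, η x * (flux p kp km (τ x) * σ x) ∂flatMeasure d R)) := by
    refine tendsto_integral_of_dominated_convergence
      (fun x => C * ‖flux p kp km (τ x) * σ x‖) (fun k => ?_) (hi.norm.const_mul _)
      (fun k => Eventually.of_forall fun x => ?_) (Eventually.of_forall fun x => ?_)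
    · exact hflux.1.mul (hcη.aestronglyMeasurable.mul
        ((hct k).comp_aestronglyMeasurable ha.memLp_trace.1))
    · rw [norm_mul, norm_mul, norm_mul]
      calc ‖flux p kp km (τ x)‖ * (‖η x‖ * ‖trunc ((k : ℝ) + 1) (σ x)‖)
          ≤ ‖flux p kp km (τ x)‖ * (C * ‖σ x‖) := by
            gcongr
            · exact hC1 x
            · exact abs_trunc_le (hM k) _
        _ = _ := by ring
    · have := ((tendsto_trunc (σ x)).const_mul (η x)).const_mul (flux p kp km (τ x))
      rwa [mul_left_comm] at this
  exact tendsto_nhds_unique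
    (lim1.congr fun k => h.test_trunc hR hR' ha hη hη0 (hM k)) lim2.neg

end Solution

end

/-! ### Dilations of approximable functions -/

section dilation

variable {d : ℕ} {E : Type*} [NormedAddCommGroup E]

theorem measurableEmbedding_smul {c : ℝ} (hc : 0 < c) :
    MeasurableEmbedding fun x : Space d => c • x :=
  (Homeomorph.smulOfNeZero c hc.ne').measurableEmbedding

theorem eLpNorm_comp_smul_halfBall {c : ℝ} (hc : 0 < c) (R : ℝ) (f : Space d → E) :
    eLpNorm (fun x => f (c • x)) 2 (volume.restrict (halfBall d R)) =
      ENNReal.ofReal ((c ^ (d + 1))⁻¹) ^ (1 / 2 : ℝ≥0∞).toReal *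
        eLpNorm f 2 (volume.restrict (halfBall d (c * R))) := by
  have h := (measurableEmbedding_smul (d := d) hc).eLpNorm_map_measure (g := f) (p := 2)
    (μ := volume.restrict (halfBall d R))
  rw [map_smul_halfBall d hc, eLpNorm_smul_measure_of_ne_top (by simp)] at h
  exact h.symm

theorem eLpNorm_comp_smul_flatMeasure {c : ℝ} (hc : 0 < c) (R : ℝ) (f : Space d → E) :
    eLpNorm (fun x => f (c • x)) 2 (flatMeasure d R) =
      ENNReal.ofReal ((c ^ d)⁻¹) ^ (1 / 2 : ℝ≥0∞).toReal *
        eLpNorm f 2 (flatMeasure d (c * R)) := by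
  have h := (measurableEmbedding_smul (d := d) hc).eLpNorm_map_measure (g := f) (p := 2)
    (μ := flatMeasure d R)
  rw [map_smul_flatMeasure d hc, eLpNorm_smul_measure_of_ne_top (by simp)] at h
  exact h.symm

theorem memLp_comp_smul_halfBall {c : ℝ} (hc : 0 < c) {R : ℝ} {f : Space d → E} {q : ℝ≥0∞}
    (hf : MemLp f q (volume.restrict (halfBall d (c * R)))) :
    MemLp (fun x => f (c • x)) q (volume.restrict (halfBall d R)) := by
  have h := (measurableEmbedding_smul (d := d) hc).memLp_map_measure_iff (g := f) (p := q)
    (μ := volume.restrict (halfBall d R))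
  rw [map_smul_halfBall d hc] at h
  exact h.1 (hf.smul_measure ENNReal.ofReal_ne_top)

theorem memLp_comp_smul_flatMeasure {c : ℝ} (hc : 0 < c) {R : ℝ} {f : Space d → E} {q : ℝ≥0∞}
    (hf : MemLp f q (flatMeasure d (c * R))) :
    MemLp (fun x => f (c • x)) q (flatMeasure d R) := by
  have h := (measurableEmbedding_smul (d := d) hc).memLp_map_measure_iff (g := f) (p := q)
    (μ := flatMeasure d R)
  rw [map_smul_flatMeasure d hc] at h
  exact h.1 (hf.smul_measure ENNReal.ofReal_ne_top)

theorem integral_comp_smul_halfBall {c : ℝ} (hc : 0 < c) (R : ℝ) (f : Space d → ℝ) :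
    ∫ x in halfBall d R, f (c • x) = (c ^ (d + 1))⁻¹ * ∫ x in halfBall d (c * R), f x := by
  have h := (measurableEmbedding_smul (d := d) hc).integral_map
    (μ := volume.restrict (halfBall d R)) f
  rw [map_smul_halfBall d hc, integral_smul_measure,
    ENNReal.toReal_ofReal (by positivity), smul_eq_mul] at h
  exact h.symm

theorem integral_comp_smul_flatMeasure {c : ℝ} (hc : 0 < c) (R : ℝ) (f : Space d → ℝ) :
    ∫ x, f (c • x) ∂flatMeasure d R = (c ^ d)⁻¹ * ∫ x, f x ∂flatMeasure d (c * R) := by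
  have h := (measurableEmbedding_smul (d := d) hc).integral_map (μ := flatMeasure d R) f
  rw [map_smul_flatMeasure d hc, integral_smul_measure,
    ENNReal.toReal_ofReal (by positivity), smul_eq_mul] at h
  exact h.symm

theorem SmoothApprox.dilate {R c : ℝ} (hc : 0 < c) {v : Space d → ℝ} {V : Space d → Space d}
    {σ : Space d → ℝ} {φ : ℕ → Space d → ℝ} (h : SmoothApprox d (c * R) v V σ φ) :
    SmoothApprox d R (fun x => v (c • x)) (fun x => c • V (c • x)) (fun x => σ (c • x))
      (fun k x => φ k (c • x)) where
  smooth k := (h.smooth k).comp (contDiff_const_smul c)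
  memLp_val := memLp_comp_smul_halfBall hc h.memLp_val
  memLp_grad := (memLp_comp_smul_halfBall hc h.memLp_grad).const_smul c
  memLp_trace := memLp_comp_smul_flatMeasure hc h.memLp_trace
  tendsto_val := by
    simp_rw [fun k => eLpNorm_comp_smul_halfBall hc R (fun x => φ k x - v x)]
    simpa using ENNReal.Tendsto.const_mul h.tendsto_val (Or.inr (by finiteness))
  tendsto_grad := by
    have : ∀ k, eLpNorm (fun x => ∇ (fun x => φ k (c • x)) x - c • V (c • x)) 2
        (volume.restrict (halfBall d R)) = ‖c‖ₑ *
        (ENNReal.ofReal ((c ^ (d + 1))⁻¹) ^ (1 / 2 : ℝ≥0∞).toReal *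
        eLpNorm (fun x => ∇ (φ k) x - V x) 2 (volume.restrict (halfBall d (c * R)))) := by
      intro k
      rw [← eLpNorm_comp_smul_halfBall hc, ← eLpNorm_const_smul]
      refine congrArg (fun f => eLpNorm f 2 _) (funext fun x => ?_)
      rw [gradient_comp_smul (h.smooth k), Pi.smul_apply, smul_sub]
    simp_rw [this]
    simpa using ENNReal.Tendsto.const_mul
      (ENNReal.Tendsto.const_mul h.tendsto_grad (Or.inr (by finiteness)))
      (Or.inr (by finiteness))
  tendsto_trace := by
    simp_rw [fun k => eLpNorm_comp_smul_flatMeasure hc R (fun x => φ k x - σ x)]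
    simpa using ENNReal.Tendsto.const_mul h.tendsto_trace (Or.inr (by finiteness))

theorem norm_inner_mul_le {R : ℝ} (a : Space d) {x : Space d} (hx : ‖x‖ ≤ R) (m : ℝ) :
    ‖inner ℝ a x * m‖ ≤ R * (‖a‖ * ‖m‖) := by
  rw [norm_mul, ← mul_assoc, mul_comm R]
  exact mul_le_mul_of_nonneg_right ((norm_inner_le_norm _ _).trans
    (mul_le_mul_of_nonneg_left hx (norm_nonneg _))) (norm_nonneg _)

/-- Derivative of a dilated smooth weight. -/
theorem hasDerivAt_integral_comp_smul_mul {μ : Measure (Space d)} {R : ℝ} (hR : 0 ≤ R)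
    (hμ : ∀ᵐ x ∂μ, ‖x‖ ≤ R) {η f : Space d → ℝ} (hη : ContDiff ℝ ∞ η) (hf : Integrable f μ)
    (c : ℝ) :
    HasDerivAt (fun c : ℝ => ∫ x, η (c • x) * f x ∂μ)
      (∫ x, inner ℝ (∇ η (c • x)) x * f x ∂μ) c := by
  have hcg := continuous_gradient hη
  obtain ⟨C, hC⟩ := (isCompact_closedBall (0 : Space d) ((|c| + 1) * R)).exists_bound_of_continuousOn
    hcg.continuousOn
  obtain ⟨C', hC'⟩ := (isCompact_closedBall (0 : Space d) (|c| * R)).exists_bound_of_continuousOn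
    hη.continuous.continuousOn
  have hC0 : 0 ≤ C := (norm_nonneg _).trans (hC 0 (by simp; positivity))
  have hm : ∀ c : ℝ, AEStronglyMeasurable (fun x => η (c • x) * f x) μ := fun c =>
    (hη.continuous.comp (continuous_const_smul c)).aestronglyMeasurable.mul hf.1
  -- The derivative falls on the smooth weight only, so integrability of `f` is enough. Factors
  -- within distance `1` of `c` are at most `|c| + 1` in absolute value, which is the radius used to
  -- choose `C`.
  refine (hasDerivAt_integral_of_dominated_loc_of_deriv_le (Metric.ball_mem_nhds c one_pos)
    (bound := fun x => C * R * ‖f x‖) (F' := fun c x => inner ℝ (∇ η (c • x)) x * f x)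
    (Eventually.of_forall hm) ?_ ?_ ?_ (hf.norm.const_mul _) ?_).2
  · refine (hf.norm.const_mul C').mono' (hm c) ?_
    filter_upwards [hμ] with x hx
    rw [norm_mul]
    refine mul_le_mul_of_nonneg_right (hC' _ ?_) (norm_nonneg _)
    rw [mem_closedBall_zero_iff, norm_smul, Real.norm_eq_abs]
    exact mul_le_mul_of_nonneg_left hx (abs_nonneg _)
  · have : Continuous fun x : Space d => inner ℝ (∇ η (c • x)) x :=
      (hcg.comp (continuous_const_smul c)).inner continuous_id
    exact this.aestronglyMeasurable.mul hf.1
  · filter_upwards [hμ] with x hx y hy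
    refine (norm_inner_mul_le _ hx _).trans ?_
    rw [mul_comm C, mul_assoc]
    refine mul_le_mul_of_nonneg_left (mul_le_mul_of_nonneg_right (hC _ ?_) (norm_nonneg _)) hR
    have hy' : |y| ≤ |c| + 1 := by
      have h1 : |y - c| < 1 := by simpa [Real.dist_eq] using hy
      have h2 := abs_add_le (y - c) c
      rw [sub_add_cancel] at h2
      linarith
    rw [mem_closedBall_zero_iff, norm_smul, Real.norm_eq_abs]
    exact mul_le_mul hy' hx (norm_nonneg _) (by positivity)
  · exact Eventually.of_forall fun x y _ => (hasDerivAt_comp_smul hη x y).mul_const _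

/-- Dilation multiplies the `L²` norm by `c^(-(d+1)/2)`, at most `2^((d+1)/2)` here. Uniformity in
`c` is what makes the derivatives in `SmoothApprox.hasDerivAt_pairing` converge uniformly. -/
theorem exists_l2_comp_smul_le (d : ℕ) : ∃ K : ℝ, ∀ {E : Type} [NormedAddCommGroup E] {c R : ℝ},
    1 / 2 < c → c * R ≤ 1 → ∀ {f : Space d → E}, MemLp f 2 (volume.restrict (halfBall d 1)) →
    l2 (volume.restrict (halfBall d R)) (fun x => f (c • x)) ≤
      K * l2 (volume.restrict (halfBall d 1)) f := by
  refine ⟨(ENNReal.ofReal (2 ^ (d + 1)) ^ (1 / 2 : ℝ≥0∞).toReal).toReal, ?_⟩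
  intro E _ c R hc hcR f hf
  have hc0 : 0 < c := by linarith
  rw [l2, l2, ← ENNReal.toReal_mul, eLpNorm_comp_smul_halfBall hc0]
  have hfin : eLpNorm f 2 (volume.restrict (halfBall d 1)) ≠ ⊤ := hf.2.ne
  refine ENNReal.toReal_mono (by finiteness) ?_
  gcongr
  · rw [← inv_pow]
    refine pow_le_pow_left₀ (by positivity) ?_ _
    rw [inv_le_comm₀ hc0 two_pos]; linarith
  · exact halfBall_subset_halfBall d hcR

/-- The pairing of the dilations of an approximable function with a fixed square integrable
function is differentiable in the dilation factor. -/
theorem SmoothApprox.hasDerivAt_pairing {u : Space d → ℝ} {G : Space d → Space d}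
    {τ : Space d → ℝ} {φ : ℕ → Space d → ℝ} (h : SmoothApprox d 1 u G τ φ) {R : ℝ}
    (hR0 : 0 ≤ R) (hR : R < 1) {m : Space d → ℝ}
    (hm : MemLp m 2 (volume.restrict (halfBall d R))) :
    HasDerivAt (fun c : ℝ => ∫ x in halfBall d R, u (c • x) * m x)
      (∫ x in halfBall d R, inner ℝ (G x) x * m x) 1 := by
  set s : Set ℝ := {c | 1 / 2 < c ∧ c * R < 1} with hs
  have hso : IsOpen s :=
    (isOpen_lt continuous_const continuous_id).inter
      (isOpen_lt (continuous_id.mul continuous_const) continuous_const)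
  have h1s : (1 : ℝ) ∈ s := ⟨by norm_num, by simpa using hR⟩
  obtain ⟨K, hK⟩ := exists_l2_comp_smul_le d
  have hmi : Integrable m (volume.restrict (halfBall d R)) := hm.integrable one_le_two
  have hnorm : ∀ᵐ x ∂(volume : Measure (Space d)).restrict (halfBall d R), ‖x‖ ≤ R :=
    (ae_norm_lt_halfBall d R).mono fun x hx => hx.le
  have hmeml : ∀ c ∈ s, ∀ {E : Type} [NormedAddCommGroup E] {f : Space d → E},
      MemLp f 2 (volume.restrict (halfBall d 1)) →
      MemLp (fun x => f (c • x)) 2 (volume.restrict (halfBall d R)) := by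
    intro c hc E _ f hf
    refine memLp_comp_smul_halfBall (by linarith [hc.1]) (hf.mono_measure ?_)
    exact Measure.restrict_mono (halfBall_subset_halfBall d hc.2.le) le_rfl
  -- The pairings of the smooth approximations are differentiable in `c`. On `s`, where dilates of
  -- the small half ball stay in the unit one, their derivatives converge uniformly, so the limit is
  -- differentiable with the limiting derivative.
  have key := hasDerivAt_of_tendstoUniformlyOn (l := atTop) hso
    (f := fun k c => ∫ x in halfBall d R, φ k (c • x) * m x)
    (f' := fun k c => ∫ x in halfBall d R, inner ℝ (∇ (φ k) (c • x)) x * m x)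
    (g := fun c => ∫ x in halfBall d R, u (c • x) * m x)
    (g' := fun c => ∫ x in halfBall d R, inner ℝ (G (c • x)) x * m x) ?_ ?_ ?_ h1s
  · simpa using key
  · -- uniform convergence of the derivatives
    have hz : Tendsto (fun k => R * (K * l2 (volume.restrict (halfBall d 1))
        (fun x => ∇ (φ k) x - G x) * l2 (volume.restrict (halfBall d R)) m)) atTop (𝓝 0) := by
      simpa using (((tendsto_l2 h.tendsto_grad).const_mul K).mul_const
        (l2 (volume.restrict (halfBall d R)) m)).const_mul R
    rw [Metric.tendstoUniformlyOn_iff]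
    intro ε hε
    filter_upwards [hz.eventually (gt_mem_nhds hε)] with k hk c hc
    have hw : MemLp (fun x => ∇ (φ k) x - G x) 2 (volume.restrict (halfBall d 1)) :=
      (memLp_halfBall (continuous_gradient (h.smooth k)) 2).sub h.memLp_grad
    refine lt_of_le_of_lt ?_ hk
    rw [dist_comm, Real.dist_eq]
    have hsub : |∫ x in halfBall d R, (inner ℝ (∇ (φ k) (c • x)) x * m x -
        inner ℝ (G (c • x)) x * m x)| ≤ R * (K * l2 (volume.restrict (halfBall d 1))
        (fun x => ∇ (φ k) x - G x) * l2 (volume.restrict (halfBall d R)) m) := by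
      have e := hK (f := fun x => ∇ (φ k) x - G x) hc.1 hc.2.le hw
      have := abs_integral_le_l2_mul (f := fun x => ∇ (φ k) (c • x) - G (c • x)) (g := m)
        (hmeml c hc hw) hm (C := R) hR0
        (b := fun x => inner ℝ (∇ (φ k) (c • x)) x * m x - inner ℝ (G (c • x)) x * m x) (by
          filter_upwards [hnorm] with x hx
          rw [← sub_mul, ← inner_sub_left]
          exact norm_inner_mul_le _ hx _)
      have e2 := mul_le_mul_of_nonneg_right e (l2_nonneg (μ := volume.restrict (halfBall d R)) m)
      have e3 := mul_le_mul_of_nonneg_left e2 hR0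
      exact this.trans e3
    rw [integral_sub] at hsub
    · exact hsub
    · refine integrable_of_norm_le_mul
        (hmeml c hc (memLp_halfBall (continuous_gradient (h.smooth k)) 2)) hm ?_ R ?_
      · exact ((hmeml c hc (memLp_halfBall (continuous_gradient (h.smooth k)) 2)).1.inner
          aestronglyMeasurable_id).mul hm.1
      · filter_upwards [hnorm] with x hx using norm_inner_mul_le _ hx _
    · refine integrable_of_norm_le_mul (hmeml c hc h.memLp_grad) hm ?_ R ?_
      · exact ((hmeml c hc h.memLp_grad).1.inner aestronglyMeasurable_id).mul hm.1
      · filter_upwards [hnorm] with x hx using norm_inner_mul_le _ hx _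
  · exact Eventually.of_forall fun k c _ =>
      hasDerivAt_integral_comp_smul_mul hR0 hnorm (h.smooth k) hmi c
  · -- pointwise convergence
    intro c hc
    have hz : Tendsto (fun k => 1 * (K * l2 (volume.restrict (halfBall d 1))
        (fun x => φ k x - u x) * l2 (volume.restrict (halfBall d R)) m)) atTop (𝓝 0) := by
      simpa using (((tendsto_l2 h.tendsto_val).const_mul K).mul_const
        (l2 (volume.restrict (halfBall d R)) m)).const_mul 1
    rw [tendsto_iff_norm_sub_tendsto_zero]
    refine squeeze_zero (fun k => norm_nonneg _) (fun k => ?_) hz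
    have hcφ := (h.smooth k).continuous
    have hw : MemLp (fun x => φ k x - u x) 2 (volume.restrict (halfBall d 1)) :=
      (memLp_halfBall hcφ 2).sub h.memLp_val
    rw [← integral_sub]
    · have e := hK (f := fun x => φ k x - u x) hc.1 hc.2.le hw
      have e2 := mul_le_mul_of_nonneg_right e (l2_nonneg (μ := volume.restrict (halfBall d R)) m)
      have e3 := mul_le_mul_of_nonneg_left e2 zero_le_one
      have := abs_integral_le_l2_mul (f := fun x => φ k (c • x) - u (c • x)) (g := m)
        (hmeml c hc hw) hm (C := 1) zero_le_one
        (b := fun x => φ k (c • x) * m x - u (c • x) * m x)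
        (Eventually.of_forall fun x => by rw [← sub_mul, norm_mul, one_mul])
      exact this.trans e3
    · exact (hmeml c hc (memLp_halfBall hcφ 2)).integrable_mul hm
    · exact (hmeml c hc h.memLp_val).integrable_mul hm

end dilation

/-! ### The radial identities -/

theorem nonneg_of_hasDerivAt_of_eventually_le {f : ℝ → ℝ} {c x : ℝ} (hf : HasDerivAt f c x)
    (h : ∀ᶠ y in 𝓝[>] x, f x ≤ f y) : 0 ≤ c := by
  have h1 : Tendsto (slope f x) (𝓝[>] x) (𝓝 c) :=
    (hasDerivWithinAt_iff_tendsto_slope' (lt_irrefl x)).1 hf.hasDerivWithinAt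
  refine ge_of_tendsto h1 ?_
  filter_upwards [h, self_mem_nhdsWithin] with y hy hxy
  rw [slope_def_field]
  exact div_nonneg (by linarith) (sub_nonneg.2 (le_of_lt hxy))

section

variable {d : ℕ} {p kp km : ℝ} {u : Space d → ℝ} {G : Space d → Space d} {τ : Space d → ℝ}
  {φ : ℕ → Space d → ℝ}

theorem Solution.memLp_radial (h : Solution d p kp km u G τ φ) :
    MemLp (fun x => inner ℝ (G x) x) 2 (volume.restrict (halfBall d 1)) := by
  refine h.approx.memLp_grad.norm.mono
    (h.approx.memLp_grad.1.inner aestronglyMeasurable_id) ?_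
  filter_upwards [ae_norm_lt_halfBall d 1] with x hx
  rw [norm_norm]
  exact (norm_inner_le_norm _ _).trans (mul_le_of_le_one_right (norm_nonneg _) hx.le)

theorem Solution.integrable_pairing (h : Solution d p kp km u G τ φ) :
    Integrable (fun x => u x * inner ℝ (G x) x) (volume.restrict (halfBall d 1)) :=
  h.approx.memLp_val.integrable_mul h.memLp_radial

theorem Solution.integrable_radial_sq (h : Solution d p kp km u G τ φ) :
    Integrable (fun x => inner ℝ (G x) x ^ 2) (volume.restrict (halfBall d 1)) :=
  h.memLp_radial.integrable_sq

/-- The equation is tested with `η u` for `η = radial d ρ`: the gradient of `η` is `-2 ρ x`, and the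
flux times the trace is the penalty. -/
theorem Solution.radial_identity (h : Solution d p kp km u G τ φ) {ρ : ℝ → ℝ}
    (hρ : ContDiff ℝ ∞ ρ) {R' : ℝ} (hR0 : 0 ≤ R') (hR1 : R' < 1)
    (hρ0 : ∀ σ, R' ^ 2 ≤ σ → ρ σ = 0) :
    2 * ∫ x in halfBall d 1, ρ (‖x‖ ^ 2) * (u x * inner ℝ (G x) x) =
      (∫ x in halfBall d 1, radial d ρ x * ‖G x‖ ^ 2) +
        ∫ x, radial d ρ x * penalty p kp km (τ x) ∂flatMeasure d 1 := by
  have hη0 : ∀ x : Space d, R' ≤ ‖x‖ → radial d ρ x = 0 := fun x hx =>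
    radial_eq_zero hR0 hR1.le hρ0 hx
  have hη : ContDiff ℝ ∞ (radial d ρ) := contDiff_radial hρ
  obtain ⟨C, hC0, hC1, hC2⟩ := exists_bound_of_eq_zero hη hη0
  have ht := h.test le_rfl hR1 h.approx hη hη0 (by
    simp_rw [flux_mul_self h.two_le]; exact h.integrable_penalty)
  simp_rw [flux_mul_self h.two_le, gradient_radial hρ.continuous, inner_smul_right,
    real_inner_self_eq_norm_sq] at ht
  rw [integral_add] at ht
  · have e : ∫ x in halfBall d 1, u x * (-(2 * ρ (‖x‖ ^ 2)) * inner ℝ (G x) x) =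
        -(2 * ∫ x in halfBall d 1, ρ (‖x‖ ^ 2) * (u x * inner ℝ (G x) x)) := by
      rw [← integral_const_mul, ← integral_neg]
      congr 1 with x; ring
    rw [e] at ht
    linarith
  · have hc : Continuous fun x : Space d => -(2 * ρ (‖x‖ ^ 2)) := by
      have := hρ.continuous; fun_prop
    obtain ⟨C', hC'⟩ := (isCompact_closedBall (0 : Space d) 1).exists_bound_of_continuousOn
      hc.continuousOn
    simp_rw [mul_left_comm (u _)]
    refine h.integrable_pairing.bdd_mul (c := C') hc.aestronglyMeasurable ?_
    filter_upwards [ae_norm_lt_halfBall d 1] with x hx using hC' x (by simpa using hx.le)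
  · exact h.integrable_energy.bdd_mul (c := C) hη.continuous.aestronglyMeasurable
      (Eventually.of_forall hC1)

theorem continuous_cumul_sqrt {μ : Measure (Space d)} (hμ : NullSpheres μ)
    {f : Space d → ℝ} (hf : Integrable f μ) : Continuous fun σ => cumul μ f (√σ) :=
  (continuous_cumul hμ hf).comp Real.continuous_sqrt

theorem one_le_of_shell {s : ℝ} (hs : s < 1) (hs0 : 0 ≤ s) {σ : ℝ} (hσ : 1 ≤ σ) : s ^ 2 ≤ σ := by
  nlinarith

theorem tendsto_integral_radial_shellBump {μ : Measure (Space d)} [SFinite μ]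
    (hμ : NullSpheres μ) {f : Space d → ℝ} (hf : Integrable f μ) {r s : ℝ} (hr : 0 ≤ r)
    (hrs : r ≤ s) (hs : s < 1) :
    Tendsto (fun k => ∫ x, radial d (shellBump r s k) x * f x ∂μ) atTop
      (𝓝 (∫ σ in r ^ 2..s ^ 2, cumul μ f (√σ))) := by
  refine (tendsto_intervalIntegral_shellBump_mul (continuous_cumul_sqrt hμ hf) hr hrs hs.le).congr
    fun k => ?_
  exact (integral_radial_mul hf (contDiff_shellBump r s k).continuous fun σ hσ =>
    shellBump_eq_zero k (one_le_of_shell hs (hr.trans hrs) hσ)).symm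

/-- In the limit of shell cutoffs, `ρ` becomes an indicator on the left, while on the right the
layer cake formula turns `η` into an integral over squared radii. This is the integrated form of `W'
= r (A + b)`. -/
theorem Solution.pairing_shell (h : Solution d p kp km u G τ φ) {r s : ℝ} (hr : 0 ≤ r)
    (hrs : r ≤ s) (hs : s < 1) :
    2 * (cumul (volume.restrict (halfBall d 1)) (fun x => u x * inner ℝ (G x) x) s -
      cumul (volume.restrict (halfBall d 1)) (fun x => u x * inner ℝ (G x) x) r) =
    (∫ σ in r ^ 2..s ^ 2, cumul (volume.restrict (halfBall d 1)) (fun x => ‖G x‖ ^ 2) (√σ)) +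
      ∫ σ in r ^ 2..s ^ 2, cumul (flatMeasure d 1) (fun x => penalty p kp km (τ x)) (√σ) := by
  have hs0 := hr.trans hrs
  have l1 := (tendsto_integral_shellBump_mul h.integrable_pairing hr hrs).const_mul 2
  have l2 := (tendsto_integral_radial_shellBump (nullSpheres_volume d 1) h.integrable_energy
    hr hrs hs).add (tendsto_integral_radial_shellBump (nullSpheres_flatMeasure h.one_le 1)
    h.integrable_penalty hr hrs hs)
  refine tendsto_nhds_unique (l1.congr fun k => ?_) l2
  exact h.radial_identity (contDiff_shellBump r s k) hs0 hs fun σ hσ => shellBump_eq_zero k hσ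

/-- The energy comparison between `u` and its dilation `u (c • ·)`. -/
theorem Solution.dilation_comparison (h : Solution d p kp km u G τ φ) {η : Space d → ℝ}
    (hη : ContDiff ℝ ∞ η) {R' : ℝ} (hη0 : ∀ x, R' ≤ ‖x‖ → η x = 0)
    (hηn : ∀ x, 0 ≤ η x) {c : ℝ} (hc1 : 1 ≤ c) (hc : R' < c⁻¹) :
    (∫ x in halfBall d c⁻¹, u x * inner ℝ (G x) (∇ η x)) +
        (1 / 2 * (∫ x in halfBall d 1, η x * ‖G x‖ ^ 2) +
        1 / p * ∫ x, η x * penalty p kp km (τ x) ∂flatMeasure d 1) ≤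
      (∫ x in halfBall d c⁻¹, u (c • x) * inner ℝ (G x) (∇ η x)) +
        (1 / 2 * (c ^ 2 * (c ^ (d + 1))⁻¹ *
          ∫ x in halfBall d 1, η (c⁻¹ • x) * ‖G x‖ ^ 2) +
        1 / p * ((c ^ d)⁻¹ *
          ∫ x, η (c⁻¹ • x) * penalty p kp km (τ x) ∂flatMeasure d 1)) := by
  have hc0 : 0 < c := by linarith
  have hR1 : c⁻¹ ≤ 1 := inv_le_one_of_one_le₀ hc1
  have hcc : c * c⁻¹ = 1 := mul_inv_cancel₀ hc0.ne'
  obtain ⟨C, hC0, hC1, hC2⟩ := exists_bound_of_eq_zero hη hη0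
  have ap1 := h.approx.restrict hR1
  have ap2 : SmoothApprox d c⁻¹ (fun x => u (c • x)) (fun x => c • G (c • x))
      (fun x => τ (c • x)) (fun k x => φ k (c • x)) :=
    SmoothApprox.dilate hc0 (by rw [hcc]; exact h.approx)
  have hν : flatMeasure d c⁻¹ ≤ flatMeasure d 1 := by
    rw [flatMeasure_eq_restrict d hR1]; exact Measure.restrict_le_self
  have hp0 : 0 < p := by linarith [h.two_le]
  have habs1 : Integrable (fun x => |τ x| ^ p) (flatMeasure d c⁻¹) :=
    h.integrable_abs_rpow.mono_measure hν
  have habs2 : Integrable (fun x => |τ (c • x)| ^ p) (flatMeasure d c⁻¹) := by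
    have hm : MemLp (fun x => τ (c • x)) (ENNReal.ofReal p) (flatMeasure d c⁻¹) :=
      memLp_comp_smul_flatMeasure hc0 (by rw [hcc]; exact h.memLp_p)
    have := hm.integrable_norm_rpow (by simpa using hp0) ENNReal.ofReal_ne_top
    simpa [ENNReal.toReal_ofReal hp0.le] using this
  have hF1 : Integrable (fun x => penalty p kp km (τ x)) (flatMeasure d c⁻¹) :=
    h.integrable_penalty.mono_measure hν
  have hF2 : Integrable (fun x => penalty p kp km (τ (c • x))) (flatMeasure d c⁻¹) := by
    refine ((habs2.add habs2).const_mul (kp + km)).mono'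
      ((continuous_penalty h.two_le kp km).comp_aestronglyMeasurable ap2.memLp_trace.1)
      (Eventually.of_forall fun x => ?_)
    have := abs_flux_mul_le h.two_le h.kp_nonneg h.km_nonneg (τ (c • x)) (τ (c • x))
    rwa [flux_mul_self h.two_le] at this
  have hi1 : Integrable (fun x => flux p kp km (τ x) * τ x) (flatMeasure d c⁻¹) := by
    simp_rw [flux_mul_self h.two_le]; exact hF1
  have hi2 : Integrable (fun x => flux p kp km (τ x) * τ (c • x)) (flatMeasure d c⁻¹) :=
    ((habs1.add habs2).const_mul (kp + km)).mono'
      (((continuous_flux h.two_le kp km).comp_aestronglyMeasurable ap1.memLp_trace.1).mul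
        ap2.memLp_trace.1)
      (Eventually.of_forall fun x =>
        abs_flux_mul_le h.two_le h.kp_nonneg h.km_nonneg (τ x) (τ (c • x)))
  -- Both `u` and its dilate are admissible on the half ball of radius `c⁻¹`. The difference of the
  -- two equations contains `⟨G, c G(c ·) - G⟩` and the flux times `τ(c ·) - τ`, each bounded by a
  -- difference of convex energies.
  have t1 := h.test hR1 hc ap1 hη hη0 hi1
  have t2 := h.test hR1 hc ap2 hη hη0 hi2
  have hcη := hη.continuous
  have hbd : ∀ {μ : Measure (Space d)} {f : Space d → ℝ}, Integrable f μ →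
      Integrable (fun x => η x * f x) μ := fun hf =>
    hf.bdd_mul (c := C) hcη.aestronglyMeasurable (Eventually.of_forall hC1)
  have hm : MemLp (fun x => inner ℝ (G x) (∇ η x)) 2 (volume.restrict (halfBall d c⁻¹)) := by
    refine (ap1.memLp_grad.norm.const_mul C).mono
      (ap1.memLp_grad.1.inner (continuous_gradient hη).aestronglyMeasurable)
      (Eventually.of_forall fun x => ?_)
    rw [norm_mul, norm_norm, Real.norm_of_nonneg hC0, mul_comm]
    exact (norm_inner_le_norm _ _).trans (by gcongr; exact hC2 x)
  have hin : ∀ {V : Space d → Space d}, MemLp V 2 (volume.restrict (halfBall d c⁻¹)) →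
      Integrable (fun x => inner ℝ (G x) (V x)) (volume.restrict (halfBall d c⁻¹)) := fun hV =>
    integrable_of_norm_le_mul ap1.memLp_grad hV (ap1.memLp_grad.1.inner hV.1) 1
      (Eventually.of_forall fun x => by rw [one_mul]; exact norm_inner_le_norm _ _)
  have hm1 : Integrable (fun x => u x * inner ℝ (G x) (∇ η x))
      (volume.restrict (halfBall d c⁻¹)) := ap1.memLp_val.integrable_mul hm
  have hm2 : Integrable (fun x => u (c • x) * inner ℝ (G x) (∇ η x))
      (volume.restrict (halfBall d c⁻¹)) := ap2.memLp_val.integrable_mul hm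
  rw [integral_add hm1 (hbd (hin ap1.memLp_grad))] at t1
  rw [integral_add hm2 (hbd (hin ap2.memLp_grad))] at t2
  -- convexity in the interior
  have e1 : ∫ x in halfBall d c⁻¹, η x * inner ℝ (G x) (c • G (c • x)) ≤
      1 / 2 * (∫ x in halfBall d c⁻¹, η x * ‖c • G (c • x)‖ ^ 2) +
      1 / 2 * ∫ x in halfBall d c⁻¹, η x * ‖G x‖ ^ 2 := by
    have i1 : Integrable (fun x => η x * ‖c • G (c • x)‖ ^ 2)
        (volume.restrict (halfBall d c⁻¹)) :=
      hbd (ap2.memLp_grad.integrable_norm_pow two_ne_zero)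
    have i2 : Integrable (fun x => η x * ‖G x‖ ^ 2) (volume.restrict (halfBall d c⁻¹)) :=
      hbd (ap1.memLp_grad.integrable_norm_pow two_ne_zero)
    rw [← integral_const_mul, ← integral_const_mul,
      ← integral_add (i1.const_mul _) (i2.const_mul _)]
    refine integral_mono (hbd (hin ap2.memLp_grad)) ((i1.const_mul _).add (i2.const_mul _))
      fun x => ?_
    have h1 := real_inner_le_norm (G x) (c • G (c • x))
    have h2 : inner ℝ (G x) (c • G (c • x)) ≤ 1 / 2 * ‖c • G (c • x)‖ ^ 2 + 1 / 2 * ‖G x‖ ^ 2 := by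
      nlinarith [sq_nonneg (‖G x‖ - ‖c • G (c • x)‖)]
    have h3 := mul_le_mul_of_nonneg_left h2 (hηn x)
    simp only
    linarith
  -- convexity on the boundary
  have e2 : (∫ x, η x * (flux p kp km (τ x) * τ (c • x)) ∂flatMeasure d c⁻¹) -
      ∫ x, η x * (flux p kp km (τ x) * τ x) ∂flatMeasure d c⁻¹ ≤
      1 / p * ((∫ x, η x * penalty p kp km (τ (c • x)) ∂flatMeasure d c⁻¹) -
      ∫ x, η x * penalty p kp km (τ x) ∂flatMeasure d c⁻¹) := by
    rw [← integral_sub (hbd hi2) (hbd hi1), ← integral_sub (hbd hF2) (hbd hF1),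
      ← integral_const_mul]
    refine integral_mono ((hbd hi2).sub (hbd hi1)) (((hbd hF2).sub (hbd hF1)).const_mul _)
      fun x => ?_
    have h2 := flux_mul_sub_le h.two_le h.kp_nonneg h.km_nonneg (τ x) (τ (c • x))
    have h3 := mul_le_mul_of_nonneg_left h2 (hηn x)
    simp only
    linarith
  -- change of variables
  have s1 : ∫ x in halfBall d c⁻¹, η x * ‖c • G (c • x)‖ ^ 2 = c ^ 2 * (c ^ (d + 1))⁻¹ *
      ∫ x in halfBall d 1, η (c⁻¹ • x) * ‖G x‖ ^ 2 := by
    have := integral_comp_smul_halfBall hc0 c⁻¹ (fun x : Space d => η (c⁻¹ • x) * ‖G x‖ ^ 2)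
    rw [hcc] at this
    rw [mul_assoc, ← this, ← integral_const_mul]
    congr 1 with x
    rw [smul_smul, inv_mul_cancel₀ hc0.ne', one_smul, norm_smul, Real.norm_of_nonneg hc0.le]
    ring
  have s2 : ∫ x, η x * penalty p kp km (τ (c • x)) ∂flatMeasure d c⁻¹ = (c ^ d)⁻¹ *
      ∫ x, η (c⁻¹ • x) * penalty p kp km (τ x) ∂flatMeasure d 1 := by
    have := integral_comp_smul_flatMeasure hc0 c⁻¹
      (fun x : Space d => η (c⁻¹ • x) * penalty p kp km (τ x))
    rw [hcc] at this
    rw [← this]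
    congr 1 with x
    rw [smul_smul, inv_mul_cancel₀ hc0.ne', one_smul]
  have s3 : ∫ x in halfBall d 1, η x * ‖G x‖ ^ 2 = ∫ x in halfBall d c⁻¹, η x * ‖G x‖ ^ 2 :=
    setIntegral_halfBall_eq hR1 fun x hx => by rw [hη0 x (hc.le.trans hx), zero_mul]
  have s4 : ∫ x, η x * penalty p kp km (τ x) ∂flatMeasure d 1 =
      ∫ x, η x * penalty p kp km (τ x) ∂flatMeasure d c⁻¹ :=
    integral_flatMeasure_eq hR1 fun x hx => by rw [hη0 x (hc.le.trans hx), zero_mul]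
  rw [← s1, ← s2, s3, s4]
  simp_rw [real_inner_self_eq_norm_sq] at t1
  linarith

/-- A Rellich type inequality. -/
theorem Solution.rellich (h : Solution d p kp km u G τ φ) {ρ : ℝ → ℝ}
    (hρ : ContDiff ℝ ∞ ρ) {R' : ℝ} (hR0 : 0 < R') (hR1 : R' < 1)
    (hρ0 : ∀ σ, R' ^ 2 ≤ σ → ρ σ = 0) (hρn : ∀ σ, 0 ≤ ρ σ) :
    2 * (∫ x in halfBall d 1, ρ (‖x‖ ^ 2) * inner ℝ (G x) x ^ 2) +
        ((d - 1) / 2 * (∫ x in halfBall d 1, radial d ρ x * ‖G x‖ ^ 2) +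
        d / p * ∫ x, radial d ρ x * penalty p kp km (τ x) ∂flatMeasure d 1) ≤
      (∫ x in halfBall d 1, ρ (‖x‖ ^ 2) * ‖x‖ ^ 2 * ‖G x‖ ^ 2) +
        2 / p * ∫ x, ρ (‖x‖ ^ 2) * ‖x‖ ^ 2 * penalty p kp km (τ x) ∂flatMeasure d 1 := by
  have hη0 : ∀ x : Space d, R' ≤ ‖x‖ → radial d ρ x = 0 := fun x hx =>
    radial_eq_zero hR0.le hR1.le hρ0 hx
  have hη : ContDiff ℝ ∞ (radial d ρ) := contDiff_radial hρ
  have hηn : ∀ x : Space d, 0 ≤ radial d ρ x := fun x =>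
    radial_nonneg hρn (fun σ hσ => hρ0 σ (one_le_of_shell hR1 hR0.le hσ)) x
  obtain ⟨C, hC0, hC1, hC2⟩ := exists_bound_of_eq_zero hη hη0
  set m : Space d → ℝ := fun x => inner ℝ (G x) (∇ (radial d ρ) x) with hmdef
  have hm0 : ∀ x, R' ≤ ‖x‖ → m x = 0 := fun x hx => by
    have : R' ^ 2 ≤ ‖x‖ ^ 2 := by gcongr
    simp only [hmdef]
    rw [gradient_radial hρ.continuous, hρ0 _ this]
    simp
  have ap := h.approx.restrict hR1.le
  have hm : MemLp m 2 (volume.restrict (halfBall d R')) := by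
    refine (ap.memLp_grad.norm.const_mul C).mono
      (ap.memLp_grad.1.inner (continuous_gradient hη).aestronglyMeasurable)
      (Eventually.of_forall fun x => ?_)
    rw [norm_mul, norm_norm, Real.norm_of_nonneg hC0, mul_comm]
    exact (norm_inner_le_norm _ _).trans (by gcongr; exact hC2 x)
  -- After the change of variables the energies depend on `c` only through the cutoff and explicit
  -- powers, so they are differentiable although `G` and `τ` are not. The pairing with `u(c ·)` is
  -- handled by `SmoothApprox.hasDerivAt_pairing`.
  set B : ℝ → ℝ := fun c => (∫ x in halfBall d R', u (c • x) * m x) +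
        (1 / 2 * (c ^ 2 * (c ^ (d + 1))⁻¹ *
          ∫ x in halfBall d 1, radial d ρ (c⁻¹ • x) * ‖G x‖ ^ 2) +
        1 / p * ((c ^ d)⁻¹ *
          ∫ x, radial d ρ (c⁻¹ • x) * penalty p kp km (τ x) ∂flatMeasure d 1)) with hB
  -- For `c > 1` close to `1` the support of `η` stays inside the half ball of radius `c⁻¹`, where
  -- the dilate is defined. One-sided minimality is enough to give `0 ≤ B' 1`.
  have hBle : ∀ᶠ c in 𝓝[>] (1 : ℝ), B 1 ≤ B c := by
    have hlt : ∀ᶠ c in 𝓝 (1 : ℝ), R' < c⁻¹ :=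
      (continuousAt_inv₀ one_ne_zero).eventually (lt_mem_nhds (by simpa using hR1))
    filter_upwards [nhdsWithin_le_nhds hlt, self_mem_nhdsWithin] with c hc hc1
    have key := h.dilation_comparison hη hη0 hηn (le_of_lt hc1) hc
    rw [setIntegral_halfBall_eq hc.le fun x hx => by
        rw [show inner ℝ (G x) (∇ (radial d ρ) x) = 0 from hm0 x hx, mul_zero],
      setIntegral_halfBall_eq (f := fun x => u (c • x) * _) hc.le fun x hx => by
        rw [show inner ℝ (G x) (∇ (radial d ρ) x) = 0 from hm0 x hx, mul_zero]] at key
    simp only [hB, hmdef, one_smul, inv_one, one_pow, one_mul]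
    exact key
  set JA := ∫ x in halfBall d 1, inner ℝ (∇ (radial d ρ) ((1 : ℝ) • x)) x * ‖G x‖ ^ 2 with hJA
  set JF := ∫ x, inner ℝ (∇ (radial d ρ) ((1 : ℝ) • x)) x * penalty p kp km (τ x)
    ∂flatMeasure d 1 with hJF
  have dinv : HasDerivAt (fun c : ℝ => c⁻¹) (-1) 1 := by
    simpa using hasDerivAt_inv (one_ne_zero (α := ℝ))
  have dA : HasDerivAt (fun c : ℝ => ∫ x in halfBall d 1, radial d ρ (c⁻¹ • x) * ‖G x‖ ^ 2)
      (JA * (-1)) 1 := by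
    refine HasDerivAt.comp_of_eq (h₂ := fun c : ℝ => ∫ x in halfBall d 1,
      radial d ρ (c • x) * ‖G x‖ ^ 2) (y := 1) 1 ?_ dinv (by simp)
    exact hasDerivAt_integral_comp_smul_mul zero_le_one
      ((ae_norm_lt_halfBall d 1).mono fun x hx => hx.le) hη h.integrable_energy 1
  have dF : HasDerivAt (fun c : ℝ => ∫ x, radial d ρ (c⁻¹ • x) * penalty p kp km (τ x)
      ∂flatMeasure d 1) (JF * (-1)) 1 := by
    refine HasDerivAt.comp_of_eq (h₂ := fun c : ℝ => ∫ x,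
      radial d ρ (c • x) * penalty p kp km (τ x) ∂flatMeasure d 1) (y := 1) 1 ?_ dinv (by simp)
    exact hasDerivAt_integral_comp_smul_mul zero_le_one
      ((ae_norm_lt_flatMeasure d 1).mono fun x hx => hx.le) hη h.integrable_penalty 1
  have dq := h.approx.hasDerivAt_pairing hR0.le hR1 hm
  have dp : ∀ n : ℕ, HasDerivAt (fun c : ℝ => (c ^ n)⁻¹) (-(n : ℝ)) 1 := fun n => by
    have := (hasDerivAt_pow n (1 : ℝ)).fun_inv (by simp)
    simpa using this
  have d2 : HasDerivAt (fun c : ℝ => c ^ 2) 2 1 := by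
    simpa using hasDerivAt_pow 2 (1 : ℝ)
  have dB := dq.add ((((d2.mul (dp (d + 1))).mul dA).const_mul (1 / 2)).add
    (((dp d).mul dF).const_mul (1 / p)))
  -- The powers `c^(2-(d+1))` and `c^(-d)` are the source of the coefficients `(d - 1) / 2` and `d /
  -- p`.
  have hpos := nonneg_of_hasDerivAt_of_eventually_le (f := B) dB hBle
  have eA : JA = -(2 * ∫ x in halfBall d 1, ρ (‖x‖ ^ 2) * ‖x‖ ^ 2 * ‖G x‖ ^ 2) := by
    rw [hJA, ← integral_const_mul, ← integral_neg]
    congr 1 with x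
    rw [one_smul, gradient_radial hρ.continuous, real_inner_smul_left,
      real_inner_self_eq_norm_sq]
    ring
  have eF : JF = -(2 * ∫ x, ρ (‖x‖ ^ 2) * ‖x‖ ^ 2 * penalty p kp km (τ x) ∂flatMeasure d 1) := by
    rw [hJF, ← integral_const_mul, ← integral_neg]
    congr 1 with x
    rw [one_smul, gradient_radial hρ.continuous, real_inner_smul_left,
      real_inner_self_eq_norm_sq]
    ring
  have eq : ∫ x in halfBall d R', inner ℝ (G x) x * m x =
      -(2 * ∫ x in halfBall d 1, ρ (‖x‖ ^ 2) * inner ℝ (G x) x ^ 2) := by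
    rw [← setIntegral_halfBall_eq hR1.le fun x hx => by rw [hm0 x hx, mul_zero],
      ← integral_const_mul, ← integral_neg]
    congr 1 with x
    simp only [hmdef]
    rw [gradient_radial hρ.continuous, real_inner_smul_right]
    ring
  rw [eq, eA, eF] at hpos
  simp only [Pi.mul_apply, one_pow, inv_one, one_smul, mul_one, one_mul] at hpos
  push_cast at hpos
  have hpe : (2 : ℝ) / p = 2 * (1 / p) := by ring
  have hde : (d : ℝ) / p = d * (1 / p) := by ring
  rw [hpe, hde]
  linarith

/-- The weight `‖x‖ ^ 2` is bounded by `s ^ 2` on the support of the cutoff. For fixed `r > 0` the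
loss is a factor tending to `1` as `s` decreases to `r`, so it is harmless to first order. -/
theorem Solution.rellich_shell (h : Solution d p kp km u G τ φ) {r s : ℝ} (hr : 0 ≤ r)
    (hrs : r < s) (hs : s < 1) :
    2 * (cumul (volume.restrict (halfBall d 1)) (fun x => inner ℝ (G x) x ^ 2) s -
        cumul (volume.restrict (halfBall d 1)) (fun x => inner ℝ (G x) x ^ 2) r) +
      ((d - 1) / 2 * (∫ σ in r ^ 2..s ^ 2,
          cumul (volume.restrict (halfBall d 1)) (fun x => ‖G x‖ ^ 2) (√σ)) +
        d / p * ∫ σ in r ^ 2..s ^ 2,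
          cumul (flatMeasure d 1) (fun x => penalty p kp km (τ x)) (√σ)) ≤
      s ^ 2 * (cumul (volume.restrict (halfBall d 1)) (fun x => ‖G x‖ ^ 2) s -
        cumul (volume.restrict (halfBall d 1)) (fun x => ‖G x‖ ^ 2) r) +
      2 / p * (s ^ 2 * (cumul (flatMeasure d 1) (fun x => penalty p kp km (τ x)) s -
        cumul (flatMeasure d 1) (fun x => penalty p kp km (τ x)) r)) := by
  have hs0 := hr.trans hrs.le
  have hp0 : 0 < p := by linarith [h.two_le]
  have l1 := (tendsto_integral_shellBump_mul h.integrable_radial_sq hr hrs.le).const_mul 2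
  have l2 := (tendsto_integral_radial_shellBump (nullSpheres_volume d 1) h.integrable_energy
    hr hrs.le hs).const_mul (((d : ℝ) - 1) / 2)
  have l3 := (tendsto_integral_radial_shellBump (nullSpheres_flatMeasure h.one_le 1)
    h.integrable_penalty hr hrs.le hs).const_mul ((d : ℝ) / p)
  have l4 := (tendsto_integral_shellBump_mul h.integrable_energy hr hrs.le).const_mul (s ^ 2)
  have l5 := ((tendsto_integral_shellBump_mul h.integrable_penalty hr hrs.le).const_mul
    (s ^ 2)).const_mul (2 / p)
  refine le_of_tendsto_of_tendsto' (l1.add (l2.add l3)) (l4.add l5) fun k => ?_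
  refine (h.rellich (contDiff_shellBump r s k) (hr.trans_lt hrs) hs
    (fun σ hσ => shellBump_eq_zero k hσ) fun σ => shellBump_nonneg k σ).trans ?_
  have hcont : Continuous fun x : Space d => shellBump r s k (‖x‖ ^ 2) :=
    (contDiff_shellBump r s k).continuous.comp (by fun_prop)
  have hb : ∀ {μ : Measure (Space d)} {f : Space d → ℝ}, Integrable f μ → (∀ x, 0 ≤ f x) →
      ∫ x, shellBump r s k (‖x‖ ^ 2) * ‖x‖ ^ 2 * f x ∂μ ≤
        s ^ 2 * ∫ x, shellBump r s k (‖x‖ ^ 2) * f x ∂μ := by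
    intro μ f hf hf0
    have hi : Integrable (fun x => shellBump r s k (‖x‖ ^ 2) * f x) μ := by
      refine hf.bdd_mul (c := 1) hcont.aestronglyMeasurable (Eventually.of_forall fun x => ?_)
      rw [Real.norm_of_nonneg (shellBump_nonneg _ _)]
      exact shellBump_le_one _ _
    rw [← integral_const_mul]
    refine integral_mono_of_nonneg (Eventually.of_forall fun x => ?_) (hi.const_mul _)
      (Eventually.of_forall fun x => ?_)
    · exact mul_nonneg (mul_nonneg (shellBump_nonneg _ _) (sq_nonneg _)) (hf0 x)
    · simp only
      rcases le_or_gt (s ^ 2) (‖x‖ ^ 2) with hx | hx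
      · rw [shellBump_eq_zero k hx]; simp
      · have := mul_le_mul_of_nonneg_left hx.le
          (mul_nonneg (shellBump_nonneg (r := r) (s := s) k (‖x‖ ^ 2)) (hf0 x))
        linarith
  have hb1 := hb h.integrable_energy fun x => sq_nonneg _
  have hb2 := hb h.integrable_penalty fun x => penalty_nonneg h.kp_nonneg h.km_nonneg _
  have hb3 := mul_le_mul_of_nonneg_left hb2 (by positivity : 0 ≤ 2 / p)
  exact add_le_add hb1 hb3

end

/-! ### Polar coordinates in half balls -/

section polar

variable {d : ℕ}

theorem integral_volumeIoiPow (n : ℕ) (f : ℝ → ℝ) :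
    ∫ t : Ioi (0 : ℝ), f t ∂Measure.volumeIoiPow n = ∫ t in Ioi (0 : ℝ), t ^ n * f t := by
  rw [Measure.volumeIoiPow, integral_withDensity_eq_integral_toReal_smul (by fun_prop)
    (by simp)]
  rw [← integral_subtype_comap measurableSet_Ioi fun t : ℝ => t ^ n * f t]
  refine integral_congr_ae (Eventually.of_forall fun t => ?_)
  have : (0 : ℝ) < t := t.2
  simp only [smul_eq_mul]
  rw [ENNReal.toReal_ofReal (by positivity)]

theorem integral_eq_integral_polar {f : Space d → ℝ} (hf : Integrable f) :
    ∫ x, f x = ∫ z : Metric.sphere (0 : Space d) 1,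
      (∫ t in Ioi (0 : ℝ), t ^ d * f (t • (z : Space d))) ∂(volume : Measure (Space d)).toSphere := by
  have hdim : Module.finrank ℝ (Space d) - 1 = d := by simp
  have hmp := (volume : Measure (Space d)).measurePreserving_homeomorphUnitSphereProd
  rw [hdim] at hmp
  have hme := (homeomorphUnitSphereProd (Space d)).measurableEmbedding
  set F : Metric.sphere (0 : Space d) 1 × Ioi (0 : ℝ) → ℝ :=
    fun q => f ((q.2 : ℝ) • (q.1 : Space d)) with hF
  have hcomp : (fun x : ({0}ᶜ : Set (Space d)) => F (homeomorphUnitSphereProd (Space d) x)) =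
      fun x : ({0}ᶜ : Set (Space d)) => f x := by
    ext x
    have := homeomorphUnitSphereProd_symm_apply_coe (Space d)
      (homeomorphUnitSphereProd (Space d) x)
    rw [Homeomorph.symm_apply_apply] at this
    rw [hF, this]
  have hint : Integrable F (((volume : Measure (Space d)).toSphere).prod
      (Measure.volumeIoiPow d)) := by
    rw [← hmp.integrable_comp_emb hme]
    change Integrable (fun x : ({0}ᶜ : Set (Space d)) =>
      F (homeomorphUnitSphereProd (Space d) x)) _
    rw [hcomp]
    exact (integrableOn_iff_comap_subtypeVal (measurableSet_singleton _).compl).1 hf.integrableOn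
  calc ∫ x, f x = ∫ x in ({0}ᶜ : Set (Space d)), f x := by
        rw [restrict_compl_singleton]
    _ = ∫ x : ({0}ᶜ : Set (Space d)), f x ∂(Measure.comap Subtype.val volume) :=
        (integral_subtype_comap (measurableSet_singleton _).compl f).symm
    _ = ∫ q, F q ∂(((volume : Measure (Space d)).toSphere).prod (Measure.volumeIoiPow d)) := by
        rw [← hmp.integral_comp hme, ← hcomp]
    _ = _ := by
        rw [integral_prod _ hint]
        refine integral_congr_ae (Eventually.of_forall fun z => ?_)
        exact integral_volumeIoiPow d fun t => f (t • (z : Space d))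

/-- The upper half of the unit sphere. -/
def upperSphere (d : ℕ) : Set (Metric.sphere (0 : Space d) 1) :=
  {z | 0 < (z : Space d) (Fin.last d)}

theorem measurableSet_upperSphere (d : ℕ) : MeasurableSet (upperSphere d) := by
  have : Continuous fun z : Metric.sphere (0 : Space d) 1 => (z : Space d) (Fin.last d) := by
    fun_prop
  exact (isOpen_lt continuous_const this).measurableSet

/-- The half space is a cone: for `t > 0`, the sign of the last coordinate of `t • z` depends on `z`
alone, so the radial and spherical constraints decouple. -/
theorem setIntegral_halfBall_eq_polar {r : ℝ} (hr : 0 < r) {f : Space d → ℝ}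
    (hf : Continuous f) :
    ∫ x in halfBall d r, f x = ∫ z in upperSphere d,
      (∫ t in (0 : ℝ)..r, t ^ d * f (t • (z : Space d))) ∂(volume : Measure (Space d)).toSphere := by
  have hm := (isOpen_halfBall d r).measurableSet
  have hint : IntegrableOn f (halfBall d r) := (memLp_halfBall hf 1).integrable le_rfl
  rw [← integral_indicator hm, integral_eq_integral_polar (hint.integrable_indicator hm),
    ← integral_indicator (measurableSet_upperSphere d)]
  congr 1 with z
  have hz : ‖(z : Space d)‖ = 1 := by simp
  have key : ∀ t ∈ Ioi (0 : ℝ), (t • (z : Space d) ∈ halfBall d r ↔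
      t < r ∧ z ∈ upperSphere d) := by
    intro t ht
    have ht' : 0 < t := ht
    simp only [halfBall, upperSphere, mem_ofPred_eq, norm_smul, hz, Real.norm_eq_abs,
      abs_of_pos ht', mul_one, PiLp.smul_apply, smul_eq_mul, mul_pos_iff_of_pos_left ht']
  by_cases hu : z ∈ upperSphere d
  · rw [indicator_of_mem hu, intervalIntegral.integral_of_le hr.le, integral_Ioc_eq_integral_Ioo]
    have : Ioo 0 r = Ioi 0 ∩ Iio r := rfl
    rw [this, ← setIntegral_indicator measurableSet_Iio]
    refine setIntegral_congr_fun measurableSet_Ioi fun t ht => ?_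
    by_cases htr : t < r
    · rw [indicator_of_mem ((key t ht).2 ⟨htr, hu⟩), indicator_of_mem (mem_Iio.2 htr)]
    · rw [indicator_of_notMem (fun h => htr ((key t ht).1 h).1), mul_zero,
        indicator_of_notMem (fun h : t ∈ Iio r => htr h)]
  · rw [indicator_of_notMem hu]
    refine setIntegral_eq_zero_of_forall_eq_zero fun t ht => ?_
    rw [indicator_of_notMem (fun h => hu ((key t ht).1 h).2), mul_zero]

theorem integral_capMeasure {r : ℝ} (hr : 0 < r) {f : Space d → ℝ}
    (hf : Continuous f) :
    ∫ x, f x ∂capMeasure d r =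
      r ^ d * ∫ z in upperSphere d, f (r • (z : Space d)) ∂(volume : Measure (Space d)).toSphere := by
  have hc : Continuous fun z : Metric.sphere (0 : Space d) 1 => r • (z : Space d) := by fun_prop
  have hS : MeasurableSet {x : Space d | 0 < x (Fin.last d)} := by
    have h1 : Continuous fun x : Space d => x (Fin.last d) := by fun_prop
    exact (isOpen_lt continuous_const h1).measurableSet
  have hpre : (fun z : Metric.sphere (0 : Space d) 1 => r • (z : Space d)) ⁻¹'
      {x : Space d | 0 < x (Fin.last d)} = upperSphere d := by
    ext z
    simp [upperSphere, hr]
  rw [capMeasure, Measure.restrict_smul, integral_smul_measure,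
    ENNReal.toReal_ofReal (by positivity), smul_eq_mul,
    setIntegral_map hS hf.aestronglyMeasurable hc.aemeasurable, hpre]

instance (d : ℕ) (r : ℝ) : IsFiniteMeasure (capMeasure d r) := by
  unfold capMeasure
  have : IsFiniteMeasure (ENNReal.ofReal (r ^ d) • ((volume : Measure (Space d)).toSphere.map
      (fun z : Metric.sphere (0 : Space d) 1 => r • (z : Space d)))) :=
    Measure.smul_finite _ ENNReal.ofReal_ne_top
  infer_instance

theorem ae_norm_le_capMeasure (d : ℕ) {r : ℝ} (hr : 0 < r) :
    ∀ᵐ x ∂capMeasure d r, ‖x‖ ≤ r := by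
  have hc : Continuous fun z : Metric.sphere (0 : Space d) 1 => r • (z : Space d) := by fun_prop
  unfold capMeasure
  refine ae_restrict_of_ae (Measure.ae_smul_measure ?_ _)
  rw [ae_map_iff hc.aemeasurable (measurableSet_le (by fun_prop) (by fun_prop))]
  refine Eventually.of_forall fun z => ?_
  have hz : ‖(z : Space d)‖ = 1 := by simp
  rw [norm_smul, hz, mul_one, Real.norm_of_nonneg hr.le]

theorem memLp_capMeasure {r : ℝ} (hr : 0 < r) {f : Space d → ℝ} (hf : Continuous f) (q : ℝ≥0∞) :
    MemLp f q (capMeasure d r) := memLp_of_continuous (ae_norm_le_capMeasure d hr) hf q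

/-- The trace identity on the spherical cap. -/
theorem mul_integral_sq_capMeasure {r : ℝ} (hr : 0 < r) {f : Space d → ℝ}
    (hf : ContDiff ℝ ∞ f) :
    r * ∫ x, f x ^ 2 ∂capMeasure d r =
      ∫ x in halfBall d r, ((d + 1) * (f x * f x) + 2 * (f x * inner ℝ (∇ f x) x)) := by
  have hcf := hf.continuous
  have hcg := continuous_gradient hf
  rw [integral_capMeasure hr (by fun_prop), setIntegral_halfBall_eq_polar hr (by fun_prop),
    ← mul_assoc, ← integral_const_mul]
  congr 1 with z
  -- On each ray the volume integrand, with its Jacobian, is the derivative of `t^(d+1) f(t z)²`,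
  -- which vanishes at `t = 0`. This is the divergence theorem for `f² x`; the flat part contributes
  -- nothing because `x` is tangent to it.
  have hd : ∀ t ∈ uIcc 0 r, HasDerivAt (fun t : ℝ => t ^ (d + 1) * f (t • (z : Space d)) ^ 2)
      (t ^ d * ((d + 1) * (f (t • (z : Space d)) * f (t • (z : Space d))) +
        2 * (f (t • (z : Space d)) *
          inner ℝ (∇ f (t • (z : Space d))) (t • (z : Space d))))) t := by
    intro t _
    have h1 := (hasDerivAt_pow (d + 1) t).mul ((hasDerivAt_comp_smul hf (z : Space d) t).pow 2)
    convert! h1 using 1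
    rw [real_inner_smul_right]
    simp only [Nat.add_sub_cancel, Pi.pow_apply]
    push_cast
    ring
  rw [intervalIntegral.integral_eq_sub_of_hasDerivAt hd
    (Continuous.intervalIntegrable (by fun_prop) _ _)]
  simp only [zero_pow (Nat.succ_ne_zero d), zero_mul, sub_zero]
  ring

end polar

/-! ### Uniqueness of weak gradients -/

section weak

variable {d : ℕ} {U : Set (Space d)} {u : Space d → ℝ} {G G' : Space d → Space d}

theorem integrable_smul_of_locallyIntegrableOn (hG : LocallyIntegrableOn G U)
    {φ : Space d → ℝ} (hφ : Continuous φ) (hc : HasCompactSupport φ) (hU : tsupport φ ⊆ U) :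
    Integrable fun x => φ x • G x := by
  have hK : IntegrableOn G (tsupport φ) := hG.integrableOn_compact_subset hU hc
  have h1 : IntegrableOn (fun x => φ x • G x) (tsupport φ) :=
    hK.continuousOn_smul hφ.continuousOn hc
  refine (integrableOn_iff_integrable_of_support_subset fun x hx => ?_).1 h1
  refine subset_tsupport _ fun h0 => hx ?_
  simp only [h0, zero_smul]

theorem setIntegral_eq_integral_of_tsupport_subset {φ : Space d → ℝ} (hU : tsupport φ ⊆ U)
    (G : Space d → Space d) : ∫ x in U, φ x • G x = ∫ x, φ x • G x :=
  setIntegral_eq_integral_of_forall_compl_eq_zero fun x hx => by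
    rw [image_eq_zero_of_notMem_tsupport fun h => hx (hU h), zero_smul]

theorem setIntegral_smul_gradient_eq {φ : Space d → ℝ} (hU : tsupport φ ⊆ U)
    (u : Space d → ℝ) : ∫ x in U, u x • ∇ φ x = ∫ x, u x • ∇ φ x := by
  refine setIntegral_eq_integral_of_forall_compl_eq_zero fun x hx => ?_
  have h0 : φ =ᶠ[𝓝 x] fun _ => 0 := notMem_tsupport_iff_eventuallyEq.1 fun h => hx (hU h)
  rw [h0.gradient_eq, gradient_fun_const, smul_zero]

theorem IsWeakGradient.ae_eq (hU : IsOpen U) (h : IsWeakGradient U u G)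
    (h' : IsWeakGradient U u G') : G =ᵐ[volume.restrict U] G' := by
  have key := hU.ae_eq_zero_of_integral_contDiff_smul_eq_zero (h.2.1.sub h'.2.1)
    fun φ hφ hc hsub => by
      have e := h.2.2 φ hφ hc hsub
      have e' := h'.2.2 φ hφ hc hsub
      rw [setIntegral_eq_integral_of_tsupport_subset hsub] at e e'
      simp_rw [Pi.sub_apply, smul_sub]
      rw [integral_sub (integrable_smul_of_locallyIntegrableOn h.2.1 hφ.continuous hc hsub)
        (integrable_smul_of_locallyIntegrableOn h'.2.1 hφ.continuous hc hsub)]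
      have := neg_injective (e.symm.trans e')
      rw [this, sub_self]
  rw [Filter.EventuallyEq, ae_restrict_iff' hU.measurableSet]
  filter_upwards [key] with x hx hxU
  exact sub_eq_zero.1 (hx hxU)

/-- Test functions supported in `V` are test functions in `U`. With uniqueness, this identifies the
gradient chosen on a smaller half ball with the one chosen on the unit half ball. -/
theorem IsWeakGradient.mono {V : Set (Space d)} (h : IsWeakGradient U u G) (hV : V ⊆ U) :
    IsWeakGradient V u G := by
  refine ⟨h.1.mono_set hV, h.2.1.mono_set hV, fun φ hφ hc hsub => ?_⟩
  have := h.2.2 φ hφ hc (hsub.trans hV)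
  rwa [setIntegral_eq_integral_of_tsupport_subset (hsub.trans hV),
    setIntegral_smul_gradient_eq (hsub.trans hV),
    ← setIntegral_eq_integral_of_tsupport_subset hsub, ← setIntegral_smul_gradient_eq hsub] at this

theorem isWeakGradient_weakGradient (h : ∃ G, IsWeakGradient U u G) :
    IsWeakGradient U u (weakGradient U u) := by
  rw [weakGradient, dif_pos h]; exact h.choose_spec

end weak

/-! ### Convergence of products -/

section products

variable {α : Type*} [MeasurableSpace α] {μ : Measure α}

/-- Expand `ab - AB = (a - A)(b - B) + (a - A) B + A (b - B)`. Convergence in `L¹`, not just of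
integrals, controls the integrals over all subballs at once. -/
theorem tendsto_integral_abs_mul_sub_mul {a b : ℕ → α → ℝ} {A B : α → ℝ}
    (ha : ∀ k, MemLp (a k) 2 μ) (hb : ∀ k, MemLp (b k) 2 μ) (hA : MemLp A 2 μ) (hB : MemLp B 2 μ)
    (h1 : Tendsto (fun k => eLpNorm (fun x => a k x - A x) 2 μ) atTop (𝓝 0))
    (h2 : Tendsto (fun k => eLpNorm (fun x => b k x - B x) 2 μ) atTop (𝓝 0)) :
    Tendsto (fun k => ∫ x, |a k x * b k x - A x * B x| ∂μ) atTop (𝓝 0) := by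
  have t1 := tendsto_l2 h1
  have t2 := tendsto_l2 h2
  have hz : Tendsto (fun k => l2 μ (fun x => a k x - A x) * l2 μ (fun x => b k x - B x) +
      l2 μ (fun x => a k x - A x) * l2 μ B + l2 μ A * l2 μ (fun x => b k x - B x)) atTop (𝓝 0) := by
    simpa using ((t1.mul t2).add (t1.mul_const (l2 μ B))).add (t2.const_mul (l2 μ A))
  refine squeeze_zero (fun k => integral_nonneg fun x => abs_nonneg _) (fun k => ?_) hz
  have m1 : MemLp (fun x => a k x - A x) 2 μ := (ha k).sub hA
  have m2 : MemLp (fun x => b k x - B x) 2 μ := (hb k).sub hB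
  have e : ∀ {f g : α → ℝ}, MemLp f 2 μ → MemLp g 2 μ →
      Integrable (fun x => |f x * g x|) μ ∧ ∫ x, |f x * g x| ∂μ ≤ l2 μ f * l2 μ g := by
    intro f g hf hg
    refine ⟨(hf.integrable_mul hg).abs, ?_⟩
    have := abs_integral_le_l2_mul hf hg zero_le_one (b := fun x => |f x * g x|)
      (Eventually.of_forall fun x => by simp [abs_mul])
    rw [one_mul] at this
    exact (le_abs_self _).trans this
  obtain ⟨i1, e1⟩ := e m1 m2
  obtain ⟨i2, e2⟩ := e m1 hB
  obtain ⟨i3, e3⟩ := e hA m2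
  refine le_trans ?_ (add_le_add (add_le_add e1 e2) e3)
  have i12 : Integrable (fun x => |(a k x - A x) * (b k x - B x)| + |(a k x - A x) * B x|) μ :=
    i1.add i2
  rw [← integral_add i1 i2, ← integral_add i12 i3]
  refine integral_mono_of_nonneg (Eventually.of_forall fun x => abs_nonneg _)
    (i12.add i3) (Eventually.of_forall fun x => ?_)
  calc |a k x * b k x - A x * B x|
      = |(a k x - A x) * (b k x - B x) + (a k x - A x) * B x + A x * (b k x - B x)| := by
        congr 1; ring
    _ ≤ _ := abs_add_three _ _ _

theorem tendsto_integral_mul {a b : ℕ → α → ℝ} {A B : α → ℝ}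
    (ha : ∀ k, MemLp (a k) 2 μ) (hb : ∀ k, MemLp (b k) 2 μ) (hA : MemLp A 2 μ) (hB : MemLp B 2 μ)
    (h1 : Tendsto (fun k => eLpNorm (fun x => a k x - A x) 2 μ) atTop (𝓝 0))
    (h2 : Tendsto (fun k => eLpNorm (fun x => b k x - B x) 2 μ) atTop (𝓝 0)) :
    Tendsto (fun k => ∫ x, a k x * b k x ∂μ) atTop (𝓝 (∫ x, A x * B x ∂μ)) := by
  rw [tendsto_iff_norm_sub_tendsto_zero]
  refine squeeze_zero (fun k => norm_nonneg _) (fun k => ?_)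
    (tendsto_integral_abs_mul_sub_mul ha hb hA hB h1 h2)
  have i1 : Integrable (fun x => a k x * b k x) μ := (ha k).integrable_mul (hb k)
  have i2 : Integrable (fun x => A x * B x) μ := hA.integrable_mul hB
  rw [← integral_sub i1 i2]
  exact norm_integral_le_integral_norm _

theorem l2_sq_eq {f : α → ℝ} (hf : MemLp f 2 μ) : l2 μ f ^ 2 = ∫ x, f x ^ 2 ∂μ := by
  have h := hf.eLpNorm_eq_integral_rpow_norm two_ne_zero (by simp)
  rw [l2, h, ENNReal.toReal_ofReal (by positivity)]
  simp only [ENNReal.toReal_ofNat, Real.rpow_ofNat, Real.norm_eq_abs, sq_abs]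
  rw [← Real.rpow_natCast, ← Real.rpow_mul (integral_nonneg fun x => sq_nonneg _)]
  norm_num

end products

/-! ### Traces on spherical caps and the height function -/

section

variable {d : ℕ}

/-- The divergence of `x ↦ f(x)² x`, where `F` is the gradient of `f`. -/
noncomputable def traceDensity (f : Space d → ℝ) (F : Space d → Space d) (x : Space d) : ℝ :=
  (d + 1) * (f x * f x) + 2 * (f x * inner ℝ (F x) x)

theorem memLp_inner_self {r : ℝ} (hr : r ≤ 1) {F : Space d → Space d}
    (hF : MemLp F 2 (volume.restrict (halfBall d r))) :
    MemLp (fun x => inner ℝ (F x) x) 2 (volume.restrict (halfBall d r)) := by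
  refine hF.norm.mono (hF.1.inner aestronglyMeasurable_id) ?_
  filter_upwards [ae_norm_lt_halfBall d r] with x hx
  rw [norm_norm]
  exact (norm_inner_le_norm _ _).trans
    (mul_le_of_le_one_right (norm_nonneg _) (hx.le.trans hr))

theorem integrable_traceDensity {r : ℝ} (hr : r ≤ 1) {f : Space d → ℝ} {F : Space d → Space d}
    (hf : MemLp f 2 (volume.restrict (halfBall d r)))
    (hF : MemLp F 2 (volume.restrict (halfBall d r))) :
    Integrable (traceDensity f F) (volume.restrict (halfBall d r)) :=
  ((hf.integrable_mul hf).const_mul ((d : ℝ) + 1)).add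
    ((hf.integrable_mul (memLp_inner_self hr hF)).const_mul 2)

theorem tendsto_integral_abs_traceDensity {r : ℝ} (hr : r ≤ 1) {φ : ℕ → Space d → ℝ}
    {u : Space d → ℝ} {G : Space d → Space d} (hφ : ∀ k, ContDiff ℝ ∞ (φ k))
    (hu : MemLp u 2 (volume.restrict (halfBall d r)))
    (hG : MemLp G 2 (volume.restrict (halfBall d r)))
    (h1 : Tendsto (fun k => eLpNorm (fun x => φ k x - u x) 2 (volume.restrict (halfBall d r)))
      atTop (𝓝 0))
    (h2 : Tendsto (fun k => eLpNorm (fun x => ∇ (φ k) x - G x) 2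
      (volume.restrict (halfBall d r))) atTop (𝓝 0)) :
    Tendsto (fun k => ∫ x in halfBall d r,
      |traceDensity (φ k) (∇ (φ k)) x - traceDensity u G x|) atTop (𝓝 0) := by
  have m1 : ∀ k, MemLp (φ k) 2 (volume.restrict (halfBall d r)) := fun k =>
    memLp_halfBall (hφ k).continuous 2
  have m2 : ∀ k, MemLp (fun x => inner ℝ (∇ (φ k) x) x) 2 (volume.restrict (halfBall d r)) :=
    fun k => memLp_inner_self hr (memLp_halfBall (continuous_gradient (hφ k)) 2)
  have mG := memLp_inner_self hr hG
  have h3 : Tendsto (fun k => eLpNorm (fun x => inner ℝ (∇ (φ k) x) x - inner ℝ (G x) x) 2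
      (volume.restrict (halfBall d r))) atTop (𝓝 0) := by
    refine tendsto_of_tendsto_of_tendsto_of_le_of_le tendsto_const_nhds h2
      (fun _ => zero_le) fun k => eLpNorm_mono_ae ?_
    filter_upwards [ae_norm_lt_halfBall d r] with x hx
    rw [← inner_sub_left]
    exact (norm_inner_le_norm _ _).trans
      (mul_le_of_le_one_right (norm_nonneg _) (hx.le.trans hr))
  have t1 := tendsto_integral_abs_mul_sub_mul m1 m1 hu hu h1 h1
  have t2 := tendsto_integral_abs_mul_sub_mul m1 m2 hu mG h1 h3
  have hz := (t1.const_mul ((d : ℝ) + 1)).add (t2.const_mul 2)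
  simp only [mul_zero, add_zero] at hz
  refine squeeze_zero (fun k => integral_nonneg fun x => abs_nonneg _) (fun k => ?_) hz
  have i1 : Integrable (fun x => ((d : ℝ) + 1) * |φ k x * φ k x - u x * u x|)
      (volume.restrict (halfBall d r)) :=
    ((((m1 k).integrable_mul (m1 k)).sub (hu.integrable_mul hu)).abs).const_mul _
  have i2 : Integrable (fun x => 2 * |φ k x * inner ℝ (∇ (φ k) x) x - u x * inner ℝ (G x) x|)
      (volume.restrict (halfBall d r)) :=
    ((((m1 k).integrable_mul (m2 k)).sub (hu.integrable_mul mG)).abs).const_mul _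
  rw [← integral_const_mul, ← integral_const_mul, ← integral_add i1 i2]
  refine integral_mono_of_nonneg (Eventually.of_forall fun x => abs_nonneg _) (i1.add i2)
    (Eventually.of_forall fun x => ?_)
  have hd : (0 : ℝ) ≤ (d : ℝ) + 1 := by positivity
  calc |traceDensity (φ k) (∇ (φ k)) x - traceDensity u G x|
      = |((d : ℝ) + 1) * (φ k x * φ k x - u x * u x) +
          2 * (φ k x * inner ℝ (∇ (φ k) x) x - u x * inner ℝ (G x) x)| := by
        unfold traceDensity; congr 1; ring
    _ ≤ _ := (abs_add_le _ _).trans (by rw [abs_mul, abs_mul, abs_of_nonneg hd, abs_two])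

theorem tendsto_setIntegral_traceDensity {r : ℝ} (hr : r ≤ 1) {φ : ℕ → Space d → ℝ}
    {u : Space d → ℝ} {G : Space d → Space d} (hφ : ∀ k, ContDiff ℝ ∞ (φ k))
    (hu : MemLp u 2 (volume.restrict (halfBall d r)))
    (hG : MemLp G 2 (volume.restrict (halfBall d r)))
    (h1 : Tendsto (fun k => eLpNorm (fun x => φ k x - u x) 2 (volume.restrict (halfBall d r)))
      atTop (𝓝 0))
    (h2 : Tendsto (fun k => eLpNorm (fun x => ∇ (φ k) x - G x) 2
      (volume.restrict (halfBall d r))) atTop (𝓝 0)) :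
    Tendsto (fun k => ∫ x in halfBall d r, traceDensity (φ k) (∇ (φ k)) x) atTop
      (𝓝 (∫ x in halfBall d r, traceDensity u G x)) := by
  rw [tendsto_iff_norm_sub_tendsto_zero]
  refine squeeze_zero (fun k => norm_nonneg _) (fun k => ?_)
    (tendsto_integral_abs_traceDensity hr hφ hu hG h1 h2)
  rw [← integral_sub (integrable_traceDensity hr (memLp_halfBall (hφ k).continuous 2)
    (memLp_halfBall (continuous_gradient (hφ k)) 2)) (integrable_traceDensity hr hu hG)]
  exact norm_integral_le_integral_norm _

/-- The integral of the square of a trace on a spherical cap. -/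
theorem IsTrace.mul_integral_sq {r : ℝ} (hr0 : 0 < r) (hr : r ≤ 1)
    {u σ : Space d → ℝ} {G : Space d → Space d}
    (hu : MemLp u 2 (volume.restrict (halfBall d r)))
    (hG : MemLp G 2 (volume.restrict (halfBall d r)))
    (hw : weakGradient (halfBall d r) u =ᵐ[volume.restrict (halfBall d r)] G)
    (h : IsTrace (halfBall d r) (capMeasure d r) u σ) :
    r * ∫ x, σ x ^ 2 ∂capMeasure d r = ∫ x in halfBall d r, traceDensity u G x := by
  obtain ⟨hσ, φ, hφ, h1, h2, h3⟩ := h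
  have h2' : Tendsto (fun k => eLpNorm (fun x => ∇ (φ k) x - G x) 2
      (volume.restrict (halfBall d r))) atTop (𝓝 0) := by
    refine h2.congr fun k => eLpNorm_congr_ae ?_
    filter_upwards [hw] with x hx
    rw [hx]
  have l1 := tendsto_setIntegral_traceDensity hr hφ hu hG h1 h2'
  have hm : ∀ k, MemLp (φ k) 2 (capMeasure d r) := fun k =>
    memLp_capMeasure hr0 (hφ k).continuous 2
  have l2 := (tendsto_integral_mul hm hm hσ hσ h3 h3).const_mul r
  simp_rw [← sq] at l2
  refine tendsto_nhds_unique (l2.congr fun k => ?_) l1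
  exact mul_integral_sq_capMeasure hr0 (hφ k)

/-- The trace inequality on a spherical cap for smooth functions. -/
theorem l2_capMeasure_le {r : ℝ} (hr0 : 0 < r) (hr : r ≤ 1) {f : Space d → ℝ}
    (hf : ContDiff ℝ ∞ f) :
    l2 (capMeasure d r) f ≤ √((d + 3) / r) * (l2 (volume.restrict (halfBall d r)) f +
      l2 (volume.restrict (halfBall d r)) (∇ f)) := by
  have hm := memLp_capMeasure hr0 hf.continuous 2
  have m1 : MemLp f 2 (volume.restrict (halfBall d r)) := memLp_halfBall hf.continuous 2
  have m2 : MemLp (∇ f) 2 (volume.restrict (halfBall d r)) :=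
    memLp_halfBall (continuous_gradient hf) 2
  set a := l2 (volume.restrict (halfBall d r)) f
  set b := l2 (volume.restrict (halfBall d r)) (∇ f)
  have ha : 0 ≤ a := l2_nonneg _
  have hb : 0 ≤ b := l2_nonneg _
  have key := mul_integral_sq_capMeasure hr0 hf
  rw [← l2_sq_eq hm, integral_add, integral_const_mul, integral_const_mul] at key
  · have e1 := abs_integral_le_l2_mul m1 m1 zero_le_one (b := fun x => f x * f x)
      (Eventually.of_forall fun x => by rw [norm_mul, one_mul])
    have e2 := abs_integral_le_l2_mul m1 m2 zero_le_one (b := fun x => f x * inner ℝ (∇ f x) x) (by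
      filter_upwards [ae_norm_lt_halfBall d r] with x hx
      rw [norm_mul, one_mul]
      refine mul_le_mul_of_nonneg_left ?_ (norm_nonneg _)
      exact (norm_inner_le_norm _ _).trans
        (mul_le_of_le_one_right (norm_nonneg _) (hx.le.trans hr)))
    have e1' := (le_abs_self _).trans e1
    have e2' := (le_abs_self _).trans e2
    have hd : (0 : ℝ) ≤ d := Nat.cast_nonneg d
    refine le_of_sq_le_sq ?_ (by positivity)
    -- The constant comes from `(d+1) a² + 2 a b ≤ (d+3) (a + b)²`.
    rw [mul_pow, Real.sq_sqrt (by positivity), div_mul_eq_mul_div, le_div_iff₀ hr0, mul_comm]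
    nlinarith [mul_nonneg ha hb, mul_nonneg hd (mul_nonneg ha hb), mul_nonneg hd (sq_nonneg b),
      mul_le_mul_of_nonneg_left e1' (by linarith : (0 : ℝ) ≤ d + 1), sq_nonneg b]
  · exact (m1.integrable_mul m1).const_mul _
  · exact (m1.integrable_mul (memLp_inner_self hr m2)).const_mul _

/-- By the trace inequality, the restrictions of the approximating functions to the cap are Cauchy
in `L²`; their limit is a trace. -/
theorem exists_isTrace_capMeasure {r : ℝ} (hr0 : 0 < r) (hr : r ≤ 1)
    {u τ : Space d → ℝ} {G : Space d → Space d} {φ : ℕ → Space d → ℝ}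
    (h : SmoothApprox d r u G τ φ)
    (hw : weakGradient (halfBall d r) u =ᵐ[volume.restrict (halfBall d r)] G) :
    ∃ σ, IsTrace (halfBall d r) (capMeasure d r) u σ := by
  set μ := (volume : Measure (Space d)).restrict (halfBall d r)
  set K := √((d + 3) / r)
  have hm : ∀ k, MemLp (φ k) 2 (capMeasure d r) := fun k =>
    memLp_capMeasure hr0 (h.smooth k).continuous 2
  have w1 : ∀ k, MemLp (fun x => φ k x - u x) 2 μ := fun k =>
    (memLp_halfBall (h.smooth k).continuous 2).sub h.memLp_val
  have w2 : ∀ k, MemLp (fun x => ∇ (φ k) x - G x) 2 μ := fun k =>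
    (memLp_halfBall (continuous_gradient (h.smooth k)) 2).sub h.memLp_grad
  have htri : ∀ {E : Type} [NormedAddCommGroup E] {f g : Space d → E}, MemLp f 2 μ →
      MemLp g 2 μ → l2 μ (f - g) ≤ l2 μ f + l2 μ g := by
    intro E _ f g hf hg
    rw [l2, l2, l2, ← ENNReal.toReal_add hf.2.ne hg.2.ne]
    exact ENNReal.toReal_mono (ENNReal.add_ne_top.2 ⟨hf.2.ne, hg.2.ne⟩)
      (eLpNorm_sub_le hf.1 hg.1 one_le_two)
  set N : ℕ → ℝ := fun k => K * (l2 μ (fun x => φ k x - u x) + l2 μ (fun x => ∇ (φ k) x - G x))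
    with hN
  have hN0 : Tendsto N atTop (𝓝 0) := by
    simpa using ((tendsto_l2 h.tendsto_val).add (tendsto_l2 h.tendsto_grad)).const_mul K
  have hdist : ∀ j k, dist ((hm j).toLp (φ j)) ((hm k).toLp (φ k)) ≤ N j + N k := by
    intro j k
    have hgrad : ∇ (φ j - φ k) = (fun x => ∇ (φ j) x - G x) - fun x => ∇ (φ k) x - G x := by
      ext1 x
      have e : ∇ (φ j - φ k) x = ∇ (φ j) x - ∇ (φ k) x := by
        rw [gradient_apply_eq, gradient_apply_eq, gradient_apply_eq,
          fderiv_sub ((h.smooth j).differentiable (by simp) x)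
            ((h.smooth k).differentiable (by simp) x), map_sub]
      rw [e, Pi.sub_apply, sub_sub_sub_cancel_right]
    have hval : φ j - φ k = (fun x => φ j x - u x) - fun x => φ k x - u x := by
      ext x; simp
    have e0 : dist ((hm j).toLp (φ j)) ((hm k).toLp (φ k)) = l2 (capMeasure d r) (φ j - φ k) := by
      rw [dist_edist, Lp.edist_toLp_toLp, l2]
    rw [e0]
    refine (l2_capMeasure_le hr0 hr ((h.smooth j).sub (h.smooth k))).trans ?_
    have k1 := htri (w1 j) (w1 k)
    have k2 := htri (w2 j) (w2 k)
    rw [← hval] at k1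
    rw [← hgrad] at k2
    calc _ ≤ K * ((l2 μ (fun x => φ j x - u x) + l2 μ (fun x => φ k x - u x)) +
        (l2 μ (fun x => ∇ (φ j) x - G x) + l2 μ (fun x => ∇ (φ k) x - G x))) :=
          mul_le_mul_of_nonneg_left (add_le_add k1 k2) (Real.sqrt_nonneg _)
      _ = N j + N k := by simp only [hN]; ring
  have hcauchy : CauchySeq fun k => (hm k).toLp (φ k) := by
    rw [Metric.cauchySeq_iff']
    intro ε hε
    obtain ⟨M, hM⟩ := eventually_atTop.1 (hN0.eventually (gt_mem_nhds (half_pos hε)))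
    exact ⟨M, fun n hn => (hdist n M).trans_lt (by linarith [hM n hn, hM M le_rfl])⟩
  obtain ⟨σ, hσ⟩ := cauchySeq_tendsto_of_complete hcauchy
  have hσm : MemLp σ 2 (capMeasure d r) := Lp.memLp σ
  rw [← Lp.toLp_coeFn σ hσm, Lp.tendsto_Lp_iff_tendsto_eLpNorm''] at hσ
  refine ⟨σ, hσm, φ, h.smooth, h.tendsto_val, ?_, hσ⟩
  refine h.tendsto_grad.congr fun k => eLpNorm_congr_ae ?_
  filter_upwards [hw] with x hx
  rw [hx]

variable {p kp km : ℝ} {u : Space d → ℝ} {G : Space d → Space d} {τ : Space d → ℝ}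
  {φ : ℕ → Space d → ℝ}

/-- The height involves a trace and a gradient chosen separately on each half ball. The identity
holds for any trace, so `r H(r)` is one fixed density integrated over growing half balls, free of
these choices. -/
theorem Solution.mul_height (h : Solution d p kp km u G τ φ)
    (hw : IsWeakGradient (halfBall d 1) u G) {r : ℝ} (hr : r ∈ Ioo (0 : ℝ) 1) :
    r * height d u r = cumul (volume.restrict (halfBall d 1)) (traceDensity u G) r := by
  have ap := h.approx.restrict hr.2.le
  have hw' := hw.mono (halfBall_subset_halfBall d hr.2.le)
  have hae : weakGradient (halfBall d r) u =ᵐ[volume.restrict (halfBall d r)] G :=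
    (isWeakGradient_weakGradient ⟨G, hw'⟩).ae_eq (isOpen_halfBall d r) hw'
  have hex := exists_isTrace_capMeasure hr.1 hr.2.le ap hae
  have htr : IsTrace (halfBall d r) (capMeasure d r) u
      (trace (halfBall d r) (capMeasure d r) u) := by
    rw [trace, dif_pos hex]; exact hex.choose_spec
  rw [cumul_volume hr.2.le, height]
  exact htr.mul_integral_sq hr.1 hr.2.le ap.memLp_val ap.memLp_grad hae

/-- The derivative of the integral of the square of a smooth function over half balls. -/
theorem hasDerivAt_setIntegral_sq {f : Space d → ℝ} (hf : ContDiff ℝ ∞ f) {r : ℝ} (hr : 0 < r) :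
    HasDerivAt (fun r => ∫ x in halfBall d r, f x * f x)
      ((∫ x in halfBall d r, traceDensity f (∇ f) x) / r) r := by
  have hff : ContDiff ℝ ∞ fun x => f x * f x := hf.mul hf
  have hcf := hf.continuous
  have hcg := continuous_gradient hf
  have h1 := hasDerivAt_integral_comp_smul_mul (μ := volume.restrict (halfBall d 1)) zero_le_one
    ((ae_norm_lt_halfBall d 1).mono fun x hx => hx.le) hff (integrable_const (1 : ℝ)) r
  have h2 := (hasDerivAt_pow (d + 1) r).mul h1
  have hgrad : ∀ x, ∇ (fun x => f x * f x) x = (2 * f x) • ∇ f x := by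
    intro x
    have := gradient_mul_comp hf hf (hasDerivAt_id (f x))
    simp only [id] at this
    rw [this, mul_one, ← add_smul, two_mul]
  -- Dilating to the unit half ball makes the domain independent of the radius, so the derivative
  -- falls on the integrand.
  have e1 : ∀ c : ℝ, 0 < c → ∫ x in halfBall d c, f x * f x =
      c ^ (d + 1) * ∫ x in halfBall d 1, (f (c • x) * f (c • x)) * 1 := by
    intro c hc
    have := integral_comp_smul_halfBall hc 1 (fun x : Space d => f x * f x)
    simp_rw [mul_one] at this ⊢
    rw [this, ← mul_assoc, mul_inv_cancel₀ (by positivity), one_mul]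
  refine HasDerivAt.congr_of_eventuallyEq ?_ (f := fun c : ℝ => c ^ (d + 1) *
    ∫ x in halfBall d 1, (f (c • x) * f (c • x)) * 1) ?_
  · convert! h2 using 1
    have e2 : ∫ x in halfBall d r, traceDensity f (∇ f) x = r ^ (d + 1) *
        ∫ x in halfBall d 1, traceDensity f (∇ f) (r • x) := by
      have := integral_comp_smul_halfBall hr 1 (traceDensity f (∇ f))
      rw [mul_one] at this
      rw [this, ← mul_assoc, mul_inv_cancel₀ (by positivity), one_mul]
    have e3 : ∫ x in halfBall d 1, traceDensity f (∇ f) (r • x) =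
        (d + 1) * (∫ x in halfBall d 1, (f (r • x) * f (r • x)) * 1) +
        r * ∫ x in halfBall d 1, inner ℝ (∇ (fun x => f x * f x) (r • x)) x * 1 := by
      rw [← integral_const_mul, ← integral_const_mul, ← integral_add]
      · congr 1 with x
        rw [hgrad, traceDensity, real_inner_smul_left, real_inner_smul_right]
        ring
      · exact (memLp_halfBall (by fun_prop) 1).integrable le_rfl
      · have hc2 := continuous_gradient hff
        exact (memLp_halfBall (by fun_prop) 1).integrable le_rfl
    rw [e2, e3]
    simp only [Nat.add_sub_cancel]
    push_cast
    field_simp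
    ring
  · filter_upwards [lt_mem_nhds hr] with c hc using e1 c hc

/-- The masses of the smooth approximations have the expected derivatives, and these converge
uniformly for radii above `r / 2`, where the division by the radius is bounded. With
`Solution.mul_height` this gives `U' = H` at every radius, not just almost every one. -/
theorem Solution.hasDerivAt_mass (h : Solution d p kp km u G τ φ) {r : ℝ}
    (hr : r ∈ Ioo (0 : ℝ) 1) :
    HasDerivAt (cumul (volume.restrict (halfBall d 1)) (fun x => u x * u x))
      (cumul (volume.restrict (halfBall d 1)) (traceDensity u G) r / r) r := by
  set s : Set ℝ := Ioo (r / 2) 1 with hs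
  have hrs : r ∈ s := ⟨by linarith [hr.1], hr.2⟩
  set μ := (volume : Measure (Space d)).restrict (halfBall d 1)
  have hap := h.approx
  have mφ : ∀ k, MemLp (φ k) 2 μ := fun k => memLp_halfBall (hap.smooth k).continuous 2
  have mg : ∀ k, MemLp (∇ (φ k)) 2 μ := fun k =>
    memLp_halfBall (continuous_gradient (hap.smooth k)) 2
  have hT := integrable_traceDensity le_rfl hap.memLp_val hap.memLp_grad
  have hTk := fun k => integrable_traceDensity le_rfl (mφ k) (mg k)
  have hsub : ∀ {f g : Space d → ℝ}, Integrable f μ → Integrable g μ → ∀ t,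
      |cumul μ f t - cumul μ g t| ≤ ∫ x, |f x - g x| ∂μ := by
    intro f g hf hg t
    rw [cumul, cumul, ← integral_sub hf.integrableOn hg.integrableOn]
    refine (norm_integral_le_integral_norm (fun x => f x - g x)).trans ?_
    exact setIntegral_le_integral (hf.sub hg).norm (Eventually.of_forall fun x => norm_nonneg _)
  refine hasDerivAt_of_tendstoUniformlyOn (l := atTop) (s := s) isOpen_Ioo
    (f := fun k => cumul μ (fun x => φ k x * φ k x))
    (f' := fun k t => cumul μ (traceDensity (φ k) (∇ (φ k))) t / t)
    (g' := fun t => cumul μ (traceDensity u G) t / t) ?_ ?_ ?_ hrs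
  · have hz := (tendsto_integral_abs_traceDensity le_rfl hap.smooth hap.memLp_val hap.memLp_grad
      hap.tendsto_val hap.tendsto_grad).div_const (r / 2)
    rw [zero_div] at hz
    rw [Metric.tendstoUniformlyOn_iff]
    intro ε hε
    filter_upwards [hz.eventually (gt_mem_nhds hε)] with k hk t ht
    have ht0 : 0 < r / 2 := by linarith [hr.1]
    refine lt_of_le_of_lt ?_ hk
    rw [dist_comm, Real.dist_eq, ← sub_div, abs_div, abs_of_pos (ht0.trans ht.1)]
    exact div_le_div₀ (integral_nonneg fun x => abs_nonneg _) (hsub (hTk k) hT t) ht0 ht.1.le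
  · refine Eventually.of_forall fun k t ht => ?_
    have ht0 : 0 < t := by linarith [hr.1, ht.1]
    rw [cumul_volume ht.2.le]
    refine (hasDerivAt_setIntegral_sq (hap.smooth k) ht0).congr_of_eventuallyEq ?_
    filter_upwards [gt_mem_nhds ht.2] with c hc
    exact cumul_volume hc.le _
  · intro t _
    rw [tendsto_iff_norm_sub_tendsto_zero]
    refine squeeze_zero (fun k => norm_nonneg _) (fun k => ?_)
      (tendsto_integral_abs_mul_sub_mul mφ mφ hap.memLp_val hap.memLp_val
        hap.tendsto_val hap.tendsto_val)
    exact hsub ((mφ k).integrable_mul (mφ k)) (hap.memLp_val.integrable_mul hap.memLp_val) t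

end

/-! ### Monotonicity of the frequency -/

/-- The relations between the radial quantities of a solution: the energies `A` in the ball and `b`
on the flat boundary, the radial energy `S`, the radial pairing `W`, the mass `U` and the
height `H`. -/
structure FrequencyData (d : ℕ) (p : ℝ) (A b S W U H : ℝ → ℝ) : Prop where
  two_le : 2 ≤ p
  continuous_A : Continuous A
  continuous_b : Continuous b
  continuous_U : Continuous U
  A_nonneg : ∀ r, 0 ≤ A r
  b_nonneg : ∀ r, 0 ≤ b r
  H_nonneg : ∀ r, 0 ≤ H r
  mul_H : ∀ r ∈ Ioo (0 : ℝ) 1, r * H r = (d + 1) * U r + 2 * W r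
  hasDerivAt_U : ∀ r ∈ Ioo (0 : ℝ) 1, HasDerivAt U (H r) r
  W_sub : ∀ r s, 0 ≤ r → r ≤ s → s < 1 →
    2 * (W s - W r) = (∫ σ in r ^ 2..s ^ 2, A (√σ)) + ∫ σ in r ^ 2..s ^ 2, b (√σ)
  rellich : ∀ r s, 0 ≤ r → r < s → s < 1 →
    2 * (S s - S r) + ((d - 1) / 2 * (∫ σ in r ^ 2..s ^ 2, A (√σ)) +
      d / p * ∫ σ in r ^ 2..s ^ 2, b (√σ)) ≤
    s ^ 2 * (A s - A r) + 2 / p * (s ^ 2 * (b s - b r))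
  cauchy : ∀ θ r s, 0 ≤ r → r ≤ s →
    2 * θ * (W s - W r) - θ ^ 2 * (U s - U r) ≤ S s - S r

namespace FrequencyData

variable {d : ℕ} {p : ℝ} {A b S W U H : ℝ → ℝ}

theorem hasDerivAt_integral_sqrt {f : ℝ → ℝ} (hf : Continuous f) {r : ℝ} (hr : 0 < r) (c : ℝ) :
    HasDerivAt (fun s : ℝ => ∫ σ in c..s ^ 2, f (√σ)) (2 * r * f r) r := by
  have hc : Continuous fun σ => f (√σ) := hf.comp Real.continuous_sqrt
  have h1 := intervalIntegral.integral_hasDerivAt_right (hc.intervalIntegrable c (r ^ 2))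
    hc.stronglyMeasurable.stronglyMeasurableAtFilter hc.continuousAt
  rw [Real.sqrt_sq hr.le] at h1
  have h2 : HasDerivAt (fun s : ℝ => s ^ 2) (2 * r) r := by simpa using hasDerivAt_pow 2 r
  exact (HasDerivAt.comp (h₂ := fun y => ∫ σ in c..y, f (√σ)) (h := fun s : ℝ => s ^ 2) r h1
    h2).congr_deriv (by ring)

theorem hasDerivAt_W (h : FrequencyData d p A b S W U H) {r : ℝ} (hr : r ∈ Ioo (0 : ℝ) 1) :
    HasDerivAt W (r * (A r + b r)) r := by
  have h1 := ((hasDerivAt_integral_sqrt h.continuous_A hr.1 (0 ^ 2)).add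
    (hasDerivAt_integral_sqrt h.continuous_b hr.1 (0 ^ 2))).const_mul (1 / 2)
  have h2 := h1.const_add (W 0)
  refine HasDerivAt.congr_of_eventuallyEq (h2.congr_deriv (by ring)) ?_
  filter_upwards [Ioo_mem_nhds hr.1 hr.2] with s hs
  have := h.W_sub 0 s le_rfl hs.1.le hs.2
  change W s = W 0 + 1 / 2 * ((∫ σ in (0 : ℝ) ^ 2..s ^ 2, A (√σ)) +
    ∫ σ in (0 : ℝ) ^ 2..s ^ 2, b (√σ))
  rw [← this]
  ring

/-- Differentiate `H = ((d+1) U + 2 W) / r`; the quotient contributes `-H / r`, which lowers `d + 1`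
to `d`. -/
theorem hasDerivAt_H (h : FrequencyData d p A b S W U H) {r : ℝ} (hr : r ∈ Ioo (0 : ℝ) 1) :
    HasDerivAt H (d / r * H r + 2 * (A r + b r)) r := by
  have h1 := (((h.hasDerivAt_U r hr).const_mul ((d : ℝ) + 1)).add
    ((h.hasDerivAt_W hr).const_mul 2)).div (hasDerivAt_id r) hr.1.ne'
  refine HasDerivAt.congr_of_eventuallyEq (h1.congr_deriv ?_) ?_
  · have := h.mul_H r hr
    have hr0 := hr.1.ne'
    simp only [Pi.add_apply, id]
    rw [← this]
    field_simp
    ring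
  · filter_upwards [Ioo_mem_nhds hr.1 hr.2] with s hs
    simp only [Pi.div_apply, Pi.add_apply, id]
    rw [← h.mul_H s hs, mul_div_cancel_left₀ _ hs.1.ne']

/-- With `D = A + (2/p) b` and `w = t / H`, the increment of `w D` from `x` to `z` is `w(z) (D(z) -
D(x)) + D(x) (w(z) - w(x))`. The Rellich and Cauchy relations bound the first term below by `v(z)
R(z)`, where `v = w / z²` and `R` is differentiable, so `v R + D(x) w` serves as comparison
function. -/
theorem le_of_pos (h : FrequencyData d p A b S W U H) {r s : ℝ} (hr : 0 < r) (hrs : r ≤ s)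
    (hs : s < 1) (hpos : ∀ t ∈ Icc r s, 0 < H t) :
    r * ((A r + 2 / p * b r) / H r) ≤ s * ((A s + 2 / p * b s) / H s) := by
  have hI : ∀ t ∈ Icc r s, t ∈ Ioo (0 : ℝ) 1 := fun t ht =>
    ⟨hr.trans_le ht.1, ht.2.trans_lt hs⟩
  have hp0 : 0 < p := by linarith [h.two_le]
  have hcH : ContinuousOn H (Icc r s) := fun t ht =>
    (h.hasDerivAt_H (hI t ht)).continuousAt.continuousWithinAt
  refine le_of_forall_increment_ge (f := fun t => t * ((A t + 2 / p * b t) / H t)) hrs ?_ ?_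
  · refine continuousOn_id.mul (ContinuousOn.div ?_ hcH fun t ht => (hpos t ht).ne')
    exact (h.continuous_A.add (continuous_const.mul h.continuous_b)).continuousOn
  intro x hx
  have hxI := hI x ⟨hx.1, hx.2.le⟩
  have hx0 := hxI.1
  have hHx := hpos x ⟨hx.1, hx.2.le⟩
  -- This is `W' / U'` at `x`, the maximizer of `2 θ W' - θ² U'`: it recovers the sharp
  -- Cauchy-Schwarz bound without integrating over spheres.
  set θ : ℝ := x * (A x + b x) / H x with hθ
  set R : ℝ → ℝ := fun z => 2 * (2 * θ * (W z - W x) - θ ^ 2 * (U z - U x)) +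
    ((d - 1) / 2 * (∫ σ in x ^ 2..z ^ 2, A (√σ)) + d / p * ∫ σ in x ^ 2..z ^ 2, b (√σ)) with hR
  set R' : ℝ := 2 * (2 * θ * (x * (A x + b x)) - θ ^ 2 * H x) +
    ((d - 1) / 2 * (2 * x * A x) + d / p * (2 * x * b x)) with hR'
  have dR : HasDerivAt R R' x :=
    (((((h.hasDerivAt_W hxI).sub_const (W x)).const_mul (2 * θ)).sub
      (((h.hasDerivAt_U x hxI).sub_const (U x)).const_mul (θ ^ 2))).const_mul 2).add
    (((hasDerivAt_integral_sqrt h.continuous_A hx0 (x ^ 2)).const_mul (((d : ℝ) - 1) / 2)).add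
      ((hasDerivAt_integral_sqrt h.continuous_b hx0 (x ^ 2)).const_mul ((d : ℝ) / p)))
  have hRx : R x = 0 := by simp [hR]
  have dH := h.hasDerivAt_H hxI
  set w : ℝ → ℝ := fun z => z / H z with hw
  have dw : HasDerivAt w ((1 * H x - x * (d / x * H x + 2 * (A x + b x))) / H x ^ 2) x :=
    (hasDerivAt_id x).fun_div dH hHx.ne'
  set v : ℝ → ℝ := fun z => (z * H z)⁻¹ with hv
  have dv : HasDerivAt v (-(1 * H x + x * (d / x * H x + 2 * (A x + b x))) / (x * H x) ^ 2) x :=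
    ((hasDerivAt_id x).fun_mul dH).fun_inv (mul_pos hx0 hHx).ne'
  set D : ℝ := A x + 2 / p * b x with hD
  have dL := (dv.mul dR).add (dw.const_mul D)
  refine ⟨_, _, ?_, dL, ?_⟩
  · rw [hRx, mul_zero, zero_add]
    -- All terms with `d` cancel; the surplus `(1 - 2/p) b` is `A + b - D`, and its sign is where `p
    -- ≥ 2` is decisive.
    have e : v x * R' + D * ((1 * H x - x * (d / x * H x + 2 * (A x + b x))) / H x ^ 2) =
        2 * x * (A x + b x) * ((1 - 2 / p) * b x) / H x ^ 2 + 2 / p * b x / H x := by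
      simp only [hv, hR', hθ, hD]
      field_simp
      ring
    rw [e]
    have h1 : 0 ≤ 1 - 2 / p := by
      rw [sub_nonneg, div_le_one hp0]; exact h.two_le
    have hA := h.A_nonneg x
    have hb := h.b_nonneg x
    positivity
  · have hmem : Ioo x s ∈ 𝓝[>] x := Ioo_mem_nhdsGT hx.2
    filter_upwards [hmem] with z hz
    have hzI := hI z ⟨hx.1.trans hz.1.le, hz.2.le⟩
    have hz0 := hzI.1
    have hHz := hpos z ⟨hx.1.trans hz.1.le, hz.2.le⟩
    have key : R z ≤ z ^ 2 * ((A z + 2 / p * b z) - D) := by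
      have k1 := h.rellich x z hx0.le hz.1 hzI.2
      have k2 := h.cauchy θ x z hx0.le hz.1.le
      simp only [hR, hD]
      linarith
    have key2 : v z * R z ≤ w z * ((A z + 2 / p * b z) - D) := by
      have hvz : 0 ≤ v z := by simp only [hv]; positivity
      refine (mul_le_mul_of_nonneg_left key hvz).trans (le_of_eq ?_)
      simp only [hv, hw]
      field_simp
    have e1 : z * ((A z + 2 / p * b z) / H z) = w z * (A z + 2 / p * b z) := by
      simp only [hw]; ring
    have e2 : x * ((A x + 2 / p * b x) / H x) = D * w x := by simp only [hw, hD]; ring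
    simp only [Pi.add_apply, Pi.mul_apply, hRx, mul_zero, zero_add]
    rw [e1, e2]
    linarith

theorem eq_zero_of_le (h : FrequencyData d p A b S W U H) {r s : ℝ} (hr : 0 < r) (hrs : r ≤ s)
    (hs : s < 1) (h0 : H s = 0) : H r = 0 := by
  have hI : ∀ t ∈ Icc r s, t ∈ Ioo (0 : ℝ) 1 := fun t ht =>
    ⟨hr.trans_le ht.1, ht.2.trans_lt hs⟩
  have hmono : MonotoneOn H (Icc r s) := by
    refine monotoneOn_of_deriv_nonneg (convex_Icc r s)
      (fun t ht => (h.hasDerivAt_H (hI t ht)).continuousAt.continuousWithinAt) ?_ ?_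
    · rw [interior_Icc]
      exact fun t ht => (h.hasDerivAt_H
        (hI t (Ioo_subset_Icc_self ht))).differentiableAt.differentiableWithinAt
    · rw [interior_Icc]
      intro t ht
      have htI := hI t (Ioo_subset_Icc_self ht)
      rw [(h.hasDerivAt_H htI).deriv]
      have := h.A_nonneg t
      have := h.b_nonneg t
      have := h.H_nonneg t
      have := htI.1
      positivity
  have := hmono (left_mem_Icc.2 hrs) (right_mem_Icc.2 hrs) hrs
  exact le_antisymm (h0 ▸ this) (h.H_nonneg r)

/-- If the height vanishes at one radius, it vanishes at all radii. -/
theorem eq_zero_of_exists (h : FrequencyData d p A b S W U H) {r : ℝ} (hr : r ∈ Ioo (0 : ℝ) 1)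
    (h0 : H r = 0) : ∀ s ∈ Ioo (0 : ℝ) 1, H s = 0 := by
  intro s hs
  by_contra hne
  have hHs : 0 < H s := lt_of_le_of_ne (h.H_nonneg s) (Ne.symm hne)
  have hrs : r < s := by
    by_contra hle
    exact hne (h.eq_zero_of_le hs.1 (not_lt.1 hle) hr.2 h0)
  have hI : ∀ t ∈ Icc r s, t ∈ Ioo (0 : ℝ) 1 := fun t ht =>
    ⟨hr.1.trans_le ht.1, ht.2.trans_lt hs.2⟩
  have hcH : ContinuousOn H (Icc r s) := fun t ht =>
    (h.hasDerivAt_H (hI t ht)).continuousAt.continuousWithinAt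
  -- The last zero of `H` in `[r, s]`: on `(a, s]` the height is positive, so the monotonicity
  -- already proved bounds the frequency there by its value `N` at `s`.
  obtain ⟨a, ⟨ha, ha0⟩, hmax⟩ := (isCompact_Icc.of_isClosed_subset
    (hcH.preimage_isClosed_of_isClosed isClosed_Icc (isClosed_singleton (x := (0 : ℝ))))
      inter_subset_left).exists_isGreatest ⟨r, ⟨left_mem_Icc.2 hrs.le, h0⟩⟩
  have ha0' : H a = 0 := ha0
  have has : a < s := lt_of_le_of_ne ha.2 fun e => hne (e ▸ ha0')
  have hpos : ∀ t ∈ Ioc a s, 0 < H t := fun t ht =>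
    lt_of_le_of_ne (h.H_nonneg t) fun e =>
      not_le.2 ht.1 (hmax ⟨⟨ha.1.trans ht.1.le, ht.2⟩, e.symm⟩)
  have hp0 : 0 < p := by linarith [h.two_le]
  have haI := hI a ha
  set N := s * ((A s + 2 / p * b s) / H s) with hN
  have hN0 : 0 ≤ N := by
    have := h.A_nonneg s
    have := h.b_nonneg s
    have := hs.1
    positivity
  set C := (d + p * N) / a with hC
  -- Grönwall: `2 (A + b) ≤ p D ≤ p N H / t`, hence `H' ≤ C H` on `(a, s)`. As `H a = 0`, this
  -- contradicts `H s > 0`.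
  have hanti : AntitoneOn (fun t => H t * Real.exp (-C * t)) (Icc a s) := by
    have hd : ∀ t ∈ Icc a s, HasDerivAt (fun t => H t * Real.exp (-C * t))
        ((d / t * H t + 2 * (A t + b t)) * Real.exp (-C * t) +
          H t * (Real.exp (-C * t) * (-C * 1))) t := fun t ht =>
      (h.hasDerivAt_H (hI t ⟨ha.1.trans ht.1, ht.2⟩)).mul
        (((hasDerivAt_id t).const_mul (-C)).exp)
    refine antitoneOn_of_deriv_nonpos (convex_Icc a s)
      (fun t ht => (hd t ht).continuousAt.continuousWithinAt) ?_ ?_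
    · rw [interior_Icc]
      exact fun t ht =>
        (hd t (Ioo_subset_Icc_self ht)).differentiableAt.differentiableWithinAt
    · rw [interior_Icc]
      intro t ht
      rw [(hd t (Ioo_subset_Icc_self ht)).deriv]
      have ht0 : 0 < t := haI.1.trans ht.1
      have hHt := hpos t ⟨ht.1, ht.2.le⟩
      have hle := h.le_of_pos ht0 ht.2.le hs.2 fun q hq => hpos q ⟨ht.1.trans_le hq.1, hq.2⟩
      have hb := h.b_nonneg t
      have hA := h.A_nonneg t
      have e1 : 2 * (A t + b t) ≤ p * (A t + 2 / p * b t) := by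
        have : p * (A t + 2 / p * b t) = p * A t + 2 * b t := by field_simp
        nlinarith [h.two_le]
      have e2 : t * (A t + 2 / p * b t) ≤ N * H t := by
        rwa [← mul_div_assoc, div_le_iff₀ hHt] at hle
      have e3 : d / t * H t + 2 * (A t + b t) ≤ (d + p * N) / t * H t := by
        rw [div_mul_eq_mul_div, div_mul_eq_mul_div, ← le_sub_iff_add_le', ← sub_div,
          le_div_iff₀ ht0]
        have := mul_le_mul_of_nonneg_left e2 hp0.le
        have := mul_le_mul_of_nonneg_left e1 ht0.le
        linarith
      have e4 : (d + p * N) / t * H t ≤ C * H t := by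
        refine mul_le_mul_of_nonneg_right ?_ hHt.le
        rw [hC]
        have : (0 : ℝ) ≤ d + p * N := by positivity
        exact div_le_div_of_nonneg_left this haI.1 ht.1.le
      have e5 := Real.exp_pos (-C * t)
      nlinarith [mul_le_mul_of_nonneg_right (e3.trans e4) e5.le]
  have := hanti (left_mem_Icc.2 has.le) (right_mem_Icc.2 has.le) has.le
  simp only [ha0', zero_mul] at this
  exact absurd this (not_le.2 (mul_pos hHs (Real.exp_pos _)))

theorem U_eq_of_eq_zero (h : FrequencyData d p A b S W U H)
    (h0 : ∀ s ∈ Ioo (0 : ℝ) 1, H s = 0) : U 1 = U 0 := by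
  obtain ⟨c, hc, hUc⟩ := exists_hasDerivAt_eq_slope U H zero_lt_one h.continuous_U.continuousOn
    h.hasDerivAt_U
  rw [h0 c hc] at hUc
  linarith

theorem monotoneOn (h : FrequencyData d p A b S W U H) :
    MonotoneOn (fun r => r * ((A r + 2 / p * b r) / H r)) (Ioo (0 : ℝ) 1) := by
  intro r hr s hs hrs
  by_cases h0 : ∃ t ∈ Ioo (0 : ℝ) 1, H t = 0
  · obtain ⟨t, ht, h0⟩ := h0
    -- Division by zero gives `0`, so the frequency is identically `0` here, as the convention for
    -- `u ≡ 0` requires.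
    simp [h.eq_zero_of_exists ht h0 r hr, h.eq_zero_of_exists ht h0 s hs]
  · refine h.le_of_pos hr.1 hrs hs.2 fun t ht => lt_of_le_of_ne (h.H_nonneg t) fun e => h0
      ⟨t, ⟨hr.1.trans_le ht.1, ht.2.trans_lt hs.2⟩, e.symm⟩

end FrequencyData

/-! ### The frequency of a weak solution -/

variable {d : ℕ} {p kp km : ℝ} {u : Space d → ℝ} {G : Space d → Space d} {τ : Space d → ℝ}
  {φ : ℕ → Space d → ℝ}

theorem Solution.cumul_traceDensity (h : Solution d p kp km u G τ φ) (r : ℝ) :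
    cumul (volume.restrict (halfBall d 1)) (traceDensity u G) r =
      (d + 1) * cumul (volume.restrict (halfBall d 1)) (fun x => u x * u x) r +
      2 * cumul (volume.restrict (halfBall d 1)) (fun x => u x * inner ℝ (G x) x) r := by
  have h1 : Integrable (fun x => u x * u x) (volume.restrict (halfBall d 1)) :=
    h.approx.memLp_val.integrable_mul h.approx.memLp_val
  simp only [cumul, traceDensity]
  rw [integral_add (h1.restrict.const_mul _) (h.integrable_pairing.restrict.const_mul 2),
    integral_const_mul, integral_const_mul]

/-- Integrate `(⟨G, x⟩ - θ u)² ≥ 0` over the shell between the two radii. -/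
theorem Solution.cauchy (h : Solution d p kp km u G τ φ) (θ : ℝ) {r s : ℝ} (hrs : r ≤ s) :
    2 * θ * (cumul (volume.restrict (halfBall d 1)) (fun x => u x * inner ℝ (G x) x) s -
        cumul (volume.restrict (halfBall d 1)) (fun x => u x * inner ℝ (G x) x) r) -
      θ ^ 2 * (cumul (volume.restrict (halfBall d 1)) (fun x => u x * u x) s -
        cumul (volume.restrict (halfBall d 1)) (fun x => u x * u x) r) ≤
      cumul (volume.restrict (halfBall d 1)) (fun x => inner ℝ (G x) x ^ 2) s -
        cumul (volume.restrict (halfBall d 1)) (fun x => inner ℝ (G x) x ^ 2) r := by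
  have h1 : Integrable (fun x => u x * u x) (volume.restrict (halfBall d 1)) :=
    h.approx.memLp_val.integrable_mul h.approx.memLp_val
  have h2 := h.integrable_pairing
  have h3 := h.integrable_radial_sq
  have hint := (h3.sub (h2.const_mul (2 * θ))).add (h1.const_mul (θ ^ 2))
  have hm := cumul_mono (f := fun x => inner ℝ (G x) x ^ 2 - 2 * θ * (u x * inner ℝ (G x) x) +
    θ ^ 2 * (u x * u x)) hint (fun x => by nlinarith [sq_nonneg (inner ℝ (G x) x - θ * u x)]) hrs
  have h4 : Integrable (fun x => inner ℝ (G x) x ^ 2 - 2 * θ * (u x * inner ℝ (G x) x))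
      (volume.restrict (halfBall d 1)) := h3.sub (h2.const_mul _)
  have e : ∀ t, cumul (volume.restrict (halfBall d 1)) (fun x => inner ℝ (G x) x ^ 2 -
      2 * θ * (u x * inner ℝ (G x) x) + θ ^ 2 * (u x * u x)) t =
      cumul (volume.restrict (halfBall d 1)) (fun x => inner ℝ (G x) x ^ 2) t -
      2 * θ * cumul (volume.restrict (halfBall d 1)) (fun x => u x * inner ℝ (G x) x) t +
      θ ^ 2 * cumul (volume.restrict (halfBall d 1)) (fun x => u x * u x) t := fun t => by
    simp only [cumul]
    rw [integral_add h4.restrict (h1.restrict.const_mul _),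
      integral_sub h3.restrict (h2.restrict.const_mul _), integral_const_mul, integral_const_mul]
  rw [e, e] at hm
  linarith

theorem Solution.frequencyData (h : Solution d p kp km u G τ φ)
    (hw : IsWeakGradient (halfBall d 1) u G) :
    FrequencyData d p (cumul (volume.restrict (halfBall d 1)) fun x => ‖G x‖ ^ 2)
      (cumul (flatMeasure d 1) fun x => penalty p kp km (τ x))
      (cumul (volume.restrict (halfBall d 1)) fun x => inner ℝ (G x) x ^ 2)
      (cumul (volume.restrict (halfBall d 1)) fun x => u x * inner ℝ (G x) x)
      (cumul (volume.restrict (halfBall d 1)) fun x => u x * u x)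
      (height d u) where
  two_le := h.two_le
  continuous_A := continuous_cumul (nullSpheres_volume d 1) h.integrable_energy
  continuous_b := continuous_cumul (nullSpheres_flatMeasure h.one_le 1) h.integrable_penalty
  continuous_U := continuous_cumul (nullSpheres_volume d 1)
    (h.approx.memLp_val.integrable_mul h.approx.memLp_val)
  A_nonneg := cumul_nonneg fun x => by positivity
  b_nonneg := cumul_nonneg fun x => penalty_nonneg h.kp_nonneg h.km_nonneg _
  H_nonneg r := integral_nonneg fun x => sq_nonneg _
  mul_H r hr := by rw [h.mul_height hw hr, h.cumul_traceDensity]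
  hasDerivAt_U r hr := (h.hasDerivAt_mass hr).congr_deriv (by
    rw [← h.mul_height hw hr, mul_div_cancel_left₀ _ hr.1.ne'])
  W_sub r s hr hrs hs := h.pairing_shell hr hrs hs
  rellich r s hr hrs hs := h.rellich_shell hr hrs hs
  cauchy θ r s _ hrs := h.cauchy θ hrs

/-- The sequence witnessing the trace on the flat part also approximates `u` in `W^{1,2}`. The
chosen weak gradient is square integrable because it agrees almost everywhere with one that is. -/
theorem IsWeakSolution.exists_solution {g : Space d → ℝ} (hd : 1 ≤ d) (hp : 2 ≤ p)
    (hkp : 0 ≤ kp) (hkm : 0 ≤ km) (hu : IsWeakSolution d p kp km g u) :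
    ∃ φ, Solution d p kp km u (weakGradient (halfBall d 1) u)
      (trace (halfBall d 1) (flatMeasure d 1) u) φ := by
  obtain ⟨hτ, φ, hφ, h1, h2, h3⟩ := hu.trace_flat.1
  obtain ⟨G, hG, hG2⟩ := hu.memW12.2
  have hw := isWeakGradient_weakGradient ⟨G, hG⟩
  exact ⟨φ, hp, hkp, hkm, hd,
    ⟨hφ, hu.memW12.1, hG2.ae_eq (hG.ae_eq (isOpen_halfBall d 1) hw), hτ, h1, h2, h3⟩,
    hu.trace_flat.2, hu.weak_eq⟩

theorem Solution.perturbedFrequency_eq {r : ℝ} (hr : r ≤ 1) :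
    perturbedFrequency d p kp km u r = r * ((cumul (volume.restrict (halfBall d 1))
      (fun x => ‖weakGradient (halfBall d 1) u x‖ ^ 2) r + 2 / p * cumul (flatMeasure d 1)
      (fun x => penalty p kp km (trace (halfBall d 1) (flatMeasure d 1) u x)) r) /
        height d u r) := by
  rw [perturbedFrequency, perturbedEnergy, cumul_volume hr, cumul_flat hr]

/-- A single zero of the height forces it to vanish identically. Then the mass is constant in the
radius, hence equal to its value `0` on the empty ball of radius `0`, and `u` vanishes almost
everywhere. -/
theorem Solution.height_pos (h : Solution d p kp km u G τ φ)
    (hw : IsWeakGradient (halfBall d 1) u G) (h0 : ¬ u =ᵐ[volume.restrict (halfBall d 1)] 0)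
    {r : ℝ} (hr : r ∈ Ioo (0 : ℝ) 1) : 0 < height d u r := by
  have hF := h.frequencyData hw
  refine lt_of_le_of_ne (hF.H_nonneg r) fun e => h0 ?_
  have hU := hF.U_eq_of_eq_zero (hF.eq_zero_of_exists hr e.symm)
  rw [cumul_volume le_rfl] at hU
  have hz : cumul (volume.restrict (halfBall d 1)) (fun x => u x * u x) 0 = 0 := by
    simp [cumul]
  rw [hz, integral_eq_zero_iff_of_nonneg (fun x => mul_self_nonneg _)
    (h.approx.memLp_val.integrable_mul h.approx.memLp_val)] at hU
  filter_upwards [hU] with x hx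
  exact mul_self_eq_zero.1 hx

end PenalizedObstacle

theorem theorem5 (d : ℕ) (hd : 1 ≤ d) (p kp km : ℝ) (hp : 2 ≤ p) (hkp : 0 ≤ kp) (hkm : 0 ≤ km)
    (g u : PenalizedObstacle.Space d → ℝ)
    (hu : PenalizedObstacle.IsWeakSolution d p kp km g u) :
    (¬ u =ᵐ[volume.restrict (PenalizedObstacle.halfBall d 1)] 0 →
      ∀ r ∈ Ioo (0 : ℝ) 1, 0 < PenalizedObstacle.height d u r) ∧
    MonotoneOn (PenalizedObstacle.perturbedFrequency d p kp km u) (Ioo (0 : ℝ) 1) := by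
  obtain ⟨φ, h⟩ := hu.exists_solution hd hp hkp hkm
  obtain ⟨G, hG, -⟩ := hu.memW12.2
  have hw := PenalizedObstacle.isWeakGradient_weakGradient ⟨G, hG⟩
  refine ⟨fun h0 r hr => h.height_pos hw h0 hr, ?_⟩
  exact (h.frequencyData hw).monotoneOn.congr fun r hr =>
    (PenalizedObstacle.Solution.perturbedFrequency_eq hr.2.le).symm
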